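/- **Theorem (Limit of stretch and mechanical energy).** Let $\gamma>0$, $T_->0$, $\theta>0$, $\bar F\in\mathbb R$, $\omega=2\pi/\theta$, and let $(\hat{\mathcal F}(\ell))_{\ell\in\mathbb Z\setminus\{0\}}$ be complex numbers with $\hat{\mathcal F}(-\ell)=\overline{\hat{\mathcal F}(\ell)}$ and $\sum_{\ell\ne0}|\hat{\mathcal F}(\ell)|<\infty$. For $n\ge1$ put $$\mathcal F_n(t)=\bar F+\frac1{\sqrt n}\sum_{\ell\neq0}\hat{\mathcal F}(\ell)e^{i\ell\omega t}.$$ For each $n\ge 1$ let $(\mathbf r(t),\mathbf p(t))_{t\ge0}=(r_1,\dots,r_n,p_0,\dots,p_n)(t)$ be the càdlàg process in $\mathbb R^n\times\mathbb R^{n+1}$ that solves (as a strong solution), with the convention $r_0\equiv 0$, $$dr_x=(p_x-p_{x-1})\,dt\quad(1\le x\le n),\qquad dp_x=(r_{x+1}-r_x)\,dt-2p_x(t^-)\,dN_x(\gamma t)\quad(1\le x\le n-1),$$ $$dp_0=r_1\,dt-2\gamma p_0\,dt+\sqrt{4\gamma T_-}\,dw_-(t),\qquad dp_n=(\mathcal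 F_n(t)-r_n)\,dt-2p_n(t^-)\,dN_n(\gamma t),$$ where $N_1,\dots,N_n$ are Poisson processes of intensity $1$, $w_-$ is a standard Wiener process, and $N_1,\dots,N_n$, $w_-$ and the random initial configuration $(\mathbf r(0),\mathbf p(0))$ are independent. Let $\bar r_x(t)=\mathbb E[r_x(t)]$, $\bar p_x(t)=\mathbb E[p_x(t)]$ and $\bar r_0\equiv0$. Assume that the initial configuration is integrable, and that: 1. there is $\bar{\mathcal H}>0$ such that $\frac1n\sum_{x=0}^n\big(\bar r_x(0)^2+\bar p_x(0)^2\big)\le\bar{\mathcal H}$ for all $n\ge1$; 2. there is a continuous function $r_0:[0,1]\to\mathbb R$ such that $\lim_{n\to\infty}\frac1n\sum_{x=1}^n\big(\bar r_x(0)-r_0(x/n)\big)^2=0$. Consider the problem $$\partial_t r=\frac1{2\gamma}\partial_{uu}r\ \text{ on }(0,\infty)\times(0,1),\qquad r(t,0)=0,\quad r(t,1)=\bar F,\quad r(0,\cdot)=r_0. \tag{$*$}$$ A weak (measure-valued) solution of $(*)$ is a map $t\mapsto r(t,du)$ from $[0,\infty)$ to the finite signed measures on $[0,1]$, continuous for weak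 convergence, such that for all $t\ge0$ and all $\varphi\in C^2([0,1])$ with $\varphi(0)=\varphi(1)=0$ $$\int_0^1\varphi(u)\,r(t,du)-\int_0^1\varphi(u)r_0(u)\,du=\frac1{2\gamma}\int_0^t ds\int_0^1\varphi''(u)\,r(s,du)-\frac{\bar F t}{2\gamma}\varphi'(1).$$ Then $\mathbf r(t),\mathbf p(t)$ are integrable for all $n\ge1$, $t\ge0$; the problem $(*)$ has a unique weak solution; for $t>0$ this solution has a density $r(t,u)$ that is $C^\infty$ on $(0,\infty)\times[0,1]$; and for every continuous $\varphi:[0,1]\to\mathbb R$ and every $t>0$ $$\lim_{n\to\infty}\frac1n\sum_{x=1}^n\varphi\Big(\frac xn\Big)\bar r_x(n^2t)=\int_0^1 r(t,u)\varphi(u)\,du,$$ $$\lim_{n\to\infty}\frac1n\sum_{x=0}^n\varphi\Big(\frac xn\Big)\,\frac{\bar p_x(n^2t)^2+\bar r_x(n^2t)^2}2=\int_0^1\varphi(u)\,\tfrac12 r(t,u)^2\,du.$$ -/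

import Mathlib

open MeasureTheory ProbabilityTheory Filter Topology Set
open scoped NNReal

noncomputable section

namespace HarmonicChain

/-! ### Configurations of the chain -/

/-- The configuration space: the stretches `(r_1, …, r_n)` and the momenta `(p_0, …, p_n)`. -/
abbrev Config (n : ℕ) : Type := (Fin n → ℝ) × (Fin (n + 1) → ℝ)

/-- The stretch `r_x`, `1 ≤ x ≤ n`, with the convention `r_0 = r_{n+1} = 0`. -/
def stretch {n : ℕ} (z : Config n) (x : ℕ) : ℝ :=
  if h : 1 ≤ x ∧ x ≤ n then z.1 ⟨x - 1, by omega⟩ else 0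

/-- The momentum `p_x`, `0 ≤ x ≤ n`. -/
def momentum {n : ℕ} (z : Config n) (x : ℕ) : ℝ :=
  if h : x ≤ n then z.2 ⟨x, by omega⟩ else 0

/-- The boundary force
`F_n(t) = F̄ + n^{-1/2} ∑_{ℓ ≠ 0} Fhat(ℓ) exp(i ℓ ω t)`, with `ω = 2π/θ`. -/
def force (Fbar : ℝ) (Fhat : ℤ → ℂ) (θ : ℝ) (n : ℕ) (t : ℝ) : ℝ :=
  Fbar + (1 / Real.sqrt n) *
    (∑' ℓ : ℤ, if ℓ = 0 then (0 : ℂ)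
      else Fhat ℓ * Complex.exp (Complex.I * ℓ * ((2 * Real.pi / θ : ℝ) : ℂ) * t)).re

/-! ### The driving noises -/

/-- `N` is a Poisson process of intensity `1` under `P`. -/
structure IsPoissonProcess {Ω : Type*} [MeasurableSpace Ω] (N : ℝ≥0 → Ω → ℕ)
    (P : Measure Ω) : Prop where
  measurable : ∀ t, Measurable (N t)
  zero : ∀ᵐ ω ∂P, N 0 ω = 0
  indepIncrements : HasIndepIncrements N P
  law : ∀ s t, s ≤ t → HasLaw (fun ω => N t ω - N s ω) (poissonMeasure (t - s)) P
  mono : ∀ᵐ ω ∂P, Monotone (fun t => N t ω)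
  rightCont : ∀ᵐ ω ∂P, ∀ t, ContinuousWithinAt (fun s => N s ω) (Ici t) t

/-- The random input of the chain of length `n`: Poisson processes `N_1, …, N_n` of intensity `1`
and a standard Wiener process `w`, all independent, and independent of the initial
configuration `X0`. -/
structure IsRandomInput {Ω : Type*} [MeasurableSpace Ω] (P : Measure Ω) (n : ℕ)
    (N : ℕ → ℝ≥0 → Ω → ℕ) (w : ℝ≥0 → Ω → ℝ) (X0 : Ω → Config n) : Prop where
  poisson : ∀ x, 1 ≤ x → x ≤ n → IsPoissonProcess (N x) P
  wiener : IsBrownianReal w P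
  wiener_measurable : ∀ t, Measurable (w t)
  init_measurable : Measurable X0
  indep_poisson : iIndepFun (fun (x : Set.Icc 1 n) (ω : Ω) (t : ℝ≥0) => N x t ω) P
  indep_wiener : IndepFun (fun ω (t : ℝ≥0) => w t ω)
    (fun ω (x : Set.Icc 1 n) (t : ℝ≥0) => N x t ω) P
  indep_init : IndepFun X0
    (fun ω => ((fun t : ℝ≥0 => w t ω), fun (x : Set.Icc 1 n) (t : ℝ≥0) => N x t ω)) P

/-- The `σ`-algebra generated by the initial configuration and by the noises `w(s)` and
`N_x(γ s)`, `1 ≤ x ≤ n`, up to time `t`. -/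
@[reducible] def pastSigma {Ω : Type*} (γ : ℝ≥0) (n : ℕ) (N : ℕ → ℝ≥0 → Ω → ℕ) (w : ℝ≥0 → Ω → ℝ)
    (X0 : Ω → Config n) (t : ℝ≥0) : MeasurableSpace Ω :=
  MeasurableSpace.comap X0 inferInstance ⊔
    (⨆ s ∈ Set.Iic t, MeasurableSpace.comap (w s) inferInstance) ⊔
    (⨆ x ∈ Set.Icc 1 n, ⨆ s ∈ Set.Iic t, MeasurableSpace.comap (N x (γ * s)) inferInstance)

/-! ### The dynamics -/

/-- The pathwise integral `∫_{(0,t]} f(s^-) dc(s)` against a counting path `c`: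
the sum of `f(s^-)` over the jump times `s ∈ (0, t]` of `c`, weighted by the size of the jump. -/
def jumpIntegral (f : ℝ≥0 → ℝ) (c : ℝ≥0 → ℕ) (t : ℝ≥0) : ℝ :=
  ∑ᶠ s ∈ Set.Ioc 0 t,
    Function.leftLim f s * ((c s : ℝ) - Function.leftLim (fun u => (c u : ℝ)) s)

/-- The path `Z` solves the equations of motion of the chain of length `n`, driven by the counting
paths `N x`, the continuous path `w` and the force `F`. -/
structure SolvesDynamics (γ : ℝ≥0) (T : ℝ) (n : ℕ) (F : ℝ → ℝ) (N : ℕ → ℝ≥0 → ℕ)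
    (w : ℝ≥0 → ℝ) (Z : ℝ≥0 → Config n) : Prop where
  rightCont : ∀ t, ContinuousWithinAt Z (Ici t) t
  leftLimit : ∀ t, 0 < t → ∃ z, Tendsto Z (𝓝[<] t) (𝓝 z)
  /-- `dr_x = (p_x - p_{x-1}) dt`, for `1 ≤ x ≤ n` -/
  stretch_eq : ∀ x, 1 ≤ x → x ≤ n → ∀ t : ℝ≥0,
    stretch (Z t) x = stretch (Z 0) x +
      ∫ s in (0 : ℝ)..t, (momentum (Z s.toNNReal) x - momentum (Z s.toNNReal) (x - 1))
  /-- `dp_x = (r_{x+1} - r_x) dt - 2 p_x(t^-) dN_x(γ t)`, for `1 ≤ x ≤ n - 1` -/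
  momentum_bulk : ∀ x, 1 ≤ x → x < n → ∀ t : ℝ≥0,
    momentum (Z t) x = momentum (Z 0) x +
      (∫ s in (0 : ℝ)..t, (stretch (Z s.toNNReal) (x + 1) - stretch (Z s.toNNReal) x)) -
      2 * jumpIntegral (fun s => momentum (Z s) x) (fun s => N x (γ * s)) t
  /-- `dp_0 = r_1 dt - 2 γ p_0 dt + √(4 γ T) dw` -/
  momentum_left : ∀ t : ℝ≥0,
    momentum (Z t) 0 = momentum (Z 0) 0 +
      (∫ s in (0 : ℝ)..t, (stretch (Z s.toNNReal) 1 - 2 * γ * momentum (Z s.toNNReal) 0)) +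
      Real.sqrt (4 * γ * T) * w t
  /-- `dp_n = (F(t) - r_n) dt - 2 p_n(t^-) dN_n(γ t)` -/
  momentum_right : ∀ t : ℝ≥0,
    momentum (Z t) n = momentum (Z 0) n +
      (∫ s in (0 : ℝ)..t, (F s - stretch (Z s.toNNReal) n)) -
      2 * jumpIntegral (fun s => momentum (Z s) n) (fun s => N n (γ * s)) t

/-- `X` is the stretch/momentum process of the chain of length `n`: the (strong) solution of the
stochastic equations of motion, started from the random configuration `X 0` and adapted, up to null
sets, to the initial configuration and the noises. -/
structure IsChainProcess {Ω : Type*} [MeasurableSpace Ω] (P : Measure Ω) (γ : ℝ≥0) (T : ℝ)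
    (n : ℕ) (F : ℝ → ℝ) (N : ℕ → ℝ≥0 → Ω → ℕ) (w : ℝ≥0 → Ω → ℝ)
    (X : ℝ≥0 → Ω → Config n) : Prop where
  input : IsRandomInput P n N w (X 0)
  measurable : ∀ t, Measurable (X t)
  adapted : ∀ t, AEStronglyMeasurable[pastSigma γ n N w (X 0) t] (X t) P
  dynamics : ∀ᵐ ω ∂P,
    SolvesDynamics γ T n F (fun x t => N x t ω) (fun t => w t ω) (fun t => X t ω)

/-! ### Averages -/

/-- The mean stretch `r̄_x(t) = E[r_x(t)]`. -/
def meanStretch {Ω : Type*} [MeasurableSpace Ω] (P : Measure Ω) {n : ℕ}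
    (X : ℝ≥0 → Ω → Config n) (t : ℝ≥0) (x : ℕ) : ℝ :=
  ∫ ω, stretch (X t ω) x ∂P

/-- The mean momentum `p̄_x(t) = E[p_x(t)]`. -/
def meanMomentum {Ω : Type*} [MeasurableSpace Ω] (P : Measure Ω) {n : ℕ}
    (X : ℝ≥0 → Ω → Config n) (t : ℝ≥0) (x : ℕ) : ℝ :=
  ∫ ω, momentum (X t ω) x ∂P

/-- The microscopic mechanical energy `(p̄_x(t)² + r̄_x(t)²) / 2`. -/
def mechEnergy {Ω : Type*} [MeasurableSpace Ω] (P : Measure Ω) {n : ℕ}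
    (X : ℝ≥0 → Ω → Config n) (t : ℝ≥0) (x : ℕ) : ℝ :=
  (meanMomentum P X t x ^ 2 + meanStretch P X t x ^ 2) / 2

/-! ### The macroscopic equation -/

/-- `m` is a weak measure-valued solution of `∂_t r = (1/2γ) ∂_{uu} r` on `(0,1)`, with
`r(t,0) = 0`, `r(t,1) = F̄` and `r(0,·) = r₀`: it is continuous in time for the weak topology of
finite signed measures on `[0,1]` and satisfies the weak formulation for all `C²` test functions
that vanish at `0` and `1`. -/
structure IsWeakSolution (γ Fbar : ℝ) (r₀ : ℝ → ℝ)
    (m : ℝ≥0 → SignedMeasure unitInterval) : Prop where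
  continuous : ∀ f : C(unitInterval, ℝ), Continuous fun t => ∫ᵛ u, f u ∂•(m t)
  weak : ∀ φ : ℝ → ℝ, ContDiffOn ℝ 2 φ (Set.Icc 0 1) → φ 0 = 0 → φ 1 = 0 → ∀ t : ℝ≥0,
    (∫ᵛ u, φ (u : ℝ) ∂•(m t)) - ∫ u in (0 : ℝ)..1, φ u * r₀ u =
      1 / (2 * γ) * (∫ s in (0 : ℝ)..t,
        ∫ᵛ u, iteratedDerivWithin 2 φ (Set.Icc 0 1) (u : ℝ) ∂•(m s.toNNReal)) -
      Fbar * t / (2 * γ) * derivWithin φ (Set.Icc 0 1) 1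

end HarmonicChain

end

/-! Taking expectations removes the randomness. A flip `p ↦ -p` at rate `γ` damps the mean momentum
at rate `2γ`, which is also the friction at site `0`, and the Wiener term has mean zero. The means
therefore solve a deterministic damped chain (`IsForcedChain`): `r_x' = p_x - p_{x-1}`, `p_x' =
r_{x+1} - r_x - 2γ p_x`, with `r_0 = 0` and `r_{n+1}` replaced by the force. At times of order `n²`
the momentum is slaved to the gradient, `p ≈ ∇r / (2γ)`, and the stretch diffuses with coefficient
`1/(2γ)`.

The delicate point in this reduction is the mean of the jump integral. Between jumps the paths obey
a Gronwall bound, and `k` simultaneous flips multiply a coordinate by at most `3^k` in absolute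
value (`norm_le_of_jump_equation`). The resulting bound is integrable because Poisson counts have
all exponential moments and are independent of the noise and of the initial configuration
(`integrable_pathBound`). The jump integral is a limit of left-point sums in which each Poisson
increment is independent of the past (`indep_pastSigma`), so dominated convergence yields the
compensator (`integral_jumpIntegral`).

For the deterministic chain the argument is a comparison by linearity. One subtracts the stationary
state and finitely many exact slow modes whose coefficients are the sine coefficients of `r₀ - F̄
u`. The remainder has small initial stretch in mean square, bounded initial energy per site, and is
driven only by the oscillation of size `n^{-1/2}`. With `s = ∫ p`, a Lyapunov functional bounds the
time integral of its energy (`energy_le`): the initial energy enters without a factor of time, hence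
is forgotten after times of order `n²`, and only the initial stretch has to be small. The bounded
primitive of the oscillation keeps the work of the force under control. Since `n²` times a mode rate
tends to `(π(j+1))² / (2γ)`, the modes converge to the heat flow and their momenta vanish. Hence the
chain converges to the profile in mean square (`tendsto_discrepancy`), which gives the limits of the
stretch and of the energy.

The macroscopic solution is a sine series, smooth for positive times because its exponential weights
beat every polynomial. For uniqueness, the difference of two solutions tested against a sine mode
solves `z = a ∫ z`, so it vanishes. Sine polynomials are uniformly dense among the functions that
vanish at the end points, and the weak equation itself, tested with a `φ` whose second derivative is
arbitrary, upgrades this to equality of measures, end points included (`IsWeakSolution.unique`). -/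

namespace HarmonicChain

/-! ### Counting paths -/

/-- Induction along the half-line. -/
theorem nnreal_induction {P : ℝ≥0 → Prop} (h0 : P 0)
    (hl : ∀ s, 0 < s → (∀ r < s, P r) → P s)
    (hr : ∀ a, (∀ r ≤ a, P r) → ∃ b > a, ∀ t ∈ Ioo a b, P t) : ∀ t, P t := by
  by_contra! hne
  -- The infimum of the failures satisfies `P` by `h0` or `hl`; then `hr` opens a gap free of
  -- failures to its right, a contradiction.
  set S : Set ℝ≥0 := {t | ¬ P t} with hS
  have hSne : S.Nonempty := hne
  have hlt : ∀ r < sInf S, P r := fun r hrS => by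
    by_contra h
    exact absurd (csInf_le' (show r ∈ S from h)) (not_le.2 hrS)
  have hτ : P (sInf S) := by
    rcases eq_or_lt_of_le (zero_le (a := sInf S)) with h | h
    · rwa [← h]
    · exact hl _ h hlt
  obtain ⟨b, hb, hP⟩ := hr (sInf S) fun r hrS =>
    (eq_or_lt_of_le hrS).elim (fun h => h ▸ hτ) (hlt r)
  obtain ⟨x, hx, hxb⟩ := exists_lt_of_csInf_lt hSne hb
  rcases eq_or_lt_of_le (csInf_le' hx) with h | h
  · exact hx (h ▸ hτ)
  · exact hx (hP x ⟨h, hxb⟩)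

theorem neBot_nhdsLT {s : ℝ≥0} (hs : 0 < s) : (𝓝[<] s).NeBot :=
  nhdsLT_neBot_of_exists_lt ⟨0, hs⟩

/-- The right-continuous counting paths. -/
structure IsCountingPath (c : ℝ≥0 → ℕ) : Prop where
  mono : Monotone c
  rightCont : ∀ t, ContinuousWithinAt c (Ici t) t

/-- The size of the jump of `c` at `s`. -/
noncomputable def jumpSize (c : ℝ≥0 → ℕ) (s : ℝ≥0) : ℝ :=
  (c s : ℝ) - Function.leftLim (fun u => (c u : ℝ)) s

namespace IsCountingPath

variable {c : ℝ≥0 → ℕ}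

theorem exists_const_right (hc : IsCountingPath c) (a : ℝ≥0) :
    ∃ b > a, ∀ t ∈ Ico a b, c t = c a := by
  have h := hc.rightCont a
  have h2 : ∀ᶠ t in 𝓝[≥] a, c t = c a := by
    have := h.eventually (show ∀ᶠ k in 𝓝 (c a), k = c a by simp)
    exact this
  obtain ⟨b, hb, hs⟩ := (mem_nhdsGE_iff_exists_Ico_subset).1 h2
  exact ⟨b, hb, fun t ht => hs ht⟩

/-- Among the times before `s`, one that minimises the natural number `c s - c t` leaves a monotone
path no room to move before `s`. -/
theorem exists_const_left (hc : IsCountingPath c) {s : ℝ≥0} (hs : 0 < s) :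
    ∃ r < s, ∀ t ∈ Ico r s, c t = c r := by
  obtain ⟨r, hr, hmin⟩ := WellFounded.has_min (measure fun t : ℝ≥0 => c s - c t).wf
    (Iio s) ⟨0, hs⟩
  refine ⟨r, hr, fun t ht => ?_⟩
  have h1 := hmin t ht.2
  have h2 := hc.mono ht.1
  have h3 := hc.mono ht.2.le
  change ¬ (c s - c t < c s - c r) at h1
  omega

theorem leftLim_eq {r s : ℝ≥0} (hrs : r < s) (h : ∀ t ∈ Ico r s, c t = c r) :
    Function.leftLim (fun u => (c u : ℝ)) s = c r := by
  have := neBot_nhdsLT (pos_of_gt hrs)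
  apply leftLim_eq_of_tendsto
  apply tendsto_const_nhds.congr'
  filter_upwards [Ico_mem_nhdsLT hrs] with t ht
  rw [h t ht]

theorem jumpSize_eq {r s : ℝ≥0} (hrs : r < s) (h : ∀ t ∈ Ico r s, c t = c r) :
    jumpSize c s = (c s : ℝ) - c r := by
  rw [jumpSize, leftLim_eq hrs h]

theorem jumpSize_eq_zero (hc : IsCountingPath c) {r s : ℝ≥0} (hrs : r < s) (h : c r = c s) :
    jumpSize c s = 0 := by
  rw [jumpSize_eq hrs, h, sub_self]
  intro t ht
  have h1 := hc.mono ht.1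
  have h2 := hc.mono ht.2.le
  omega

/-- The path is injective on its jump times, because a jump at the later of two times with the same
value would have size zero; and it takes finitely many values up to `t`. -/
theorem finite_jumps (hc : IsCountingPath c) (t : ℝ≥0) :
    (Ioc 0 t ∩ Function.support (jumpSize c)).Finite := by
  apply Set.Finite.of_finite_image (f := c)
  · apply (Set.finite_Iic (c t)).subset
    rintro _ ⟨s, hs, rfl⟩
    exact hc.mono hs.1.2
  · have key : ∀ a ∈ Ioc 0 t ∩ Function.support (jumpSize c),
        ∀ b ∈ Ioc 0 t ∩ Function.support (jumpSize c), c a = c b → ¬ a < b :=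
      fun a _ b hb hab hlt => hb.2 (hc.jumpSize_eq_zero hlt hab)
    intro a ha b hb hab
    rcases lt_trichotomy a b with h | h | h
    · exact absurd h (key a ha b hb hab)
    · exact h
    · exact absurd h (key b hb a ha hab.symm)

/-- The jump times in `(0, t]`. -/
noncomputable def jumps (hc : IsCountingPath c) (t : ℝ≥0) : Finset ℝ≥0 :=
  (hc.finite_jumps t).toFinset

theorem mem_jumps (hc : IsCountingPath c) {s t : ℝ≥0} :
    s ∈ hc.jumps t ↔ (0 < s ∧ s ≤ t) ∧ jumpSize c s ≠ 0 := by
  simp [jumps]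

/-- The `finsum` in `jumpIntegral` would be a default zero on infinite support, but only jump times
contribute. The horizon `T` is free so that integrals up to different times share one index set. -/
theorem jumpIntegral_eq_sum (hc : IsCountingPath c) (f : ℝ≥0 → ℝ) {t T : ℝ≥0} (h : t ≤ T) :
    jumpIntegral f c t =
      ∑ s ∈ (hc.jumps T).filter (· ≤ t), Function.leftLim f s * jumpSize c s := by
  rw [jumpIntegral]
  apply finsum_mem_eq_sum_of_inter_support_eq
  ext s
  simp only [Set.mem_inter_iff, Finset.coe_filter, mem_jumps, Function.mem_support, Set.mem_Ioc,
    Set.mem_ofPred_eq, jumpSize, ne_eq, mul_eq_zero, not_or]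
  constructor
  · rintro ⟨⟨h1, h2⟩, h3, h4⟩
    exact ⟨⟨⟨⟨h1, h2.trans h⟩, h4⟩, h2⟩, h3, h4⟩
  · rintro ⟨⟨⟨⟨h1, h2⟩, h4⟩, h5⟩, h3, -⟩
    exact ⟨⟨h1, h5⟩, h3, h4⟩

theorem jumpIntegral_sub (hc : IsCountingPath c) (f : ℝ≥0 → ℝ) {r t : ℝ≥0} (h : r ≤ t) :
    jumpIntegral f c t - jumpIntegral f c r =
      ∑ s ∈ (hc.jumps t).filter (r < ·), Function.leftLim f s * jumpSize c s := by
  rw [hc.jumpIntegral_eq_sum f le_rfl, hc.jumpIntegral_eq_sum f h, sub_eq_iff_eq_add,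
    Finset.filter_true_of_mem (fun s hs => (hc.mem_jumps.1 hs).1.2), add_comm,
    ← Finset.sum_filter_add_sum_filter_not (hc.jumps t) (· ≤ r)]
  simp only [not_le]

theorem jumpIntegral_eq_of_eq (hc : IsCountingPath c) (f : ℝ≥0 → ℝ) {r t : ℝ≥0} (h : r ≤ t)
    (hrt : c r = c t) : jumpIntegral f c t = jumpIntegral f c r := by
  rw [← sub_eq_zero, hc.jumpIntegral_sub f h]
  apply Finset.sum_eq_zero
  intro s hs
  simp only [Finset.mem_filter, mem_jumps] at hs
  have h1 := hc.mono hs.2.le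
  have h2 := hc.mono hs.1.1.2
  exact absurd (hc.jumpSize_eq_zero hs.2 (by omega)) hs.1.2

theorem jumpIntegral_eq_add (hc : IsCountingPath c) (f : ℝ≥0 → ℝ) {r s : ℝ≥0} (h : r < s)
    (hrs : ∀ t ∈ Ico r s, c t = c r) :
    jumpIntegral f c s = jumpIntegral f c r + Function.leftLim f s * ((c s : ℝ) - c r) := by
  rw [← sub_eq_iff_eq_add', hc.jumpIntegral_sub f h.le, Finset.sum_eq_single s]
  · rw [jumpSize_eq h hrs]
  · intro u hu hne
    simp only [Finset.mem_filter, mem_jumps] at hu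
    refine absurd (hc.jumpSize_eq_zero hu.2 ?_) hu.1.2
    exact (hrs u ⟨hu.2.le, lt_of_le_of_ne hu.1.1.2 hne⟩).symm
  · intro hs
    simp only [Finset.mem_filter, mem_jumps, not_and, h,
      not_not, le_refl, and_true] at hs
    rw [hs (pos_of_gt h), mul_zero]

/-- The integral of the constant `1` changes exactly as the count does, both across a left limit and
to the right of a point, so half-line induction identifies the two. -/
theorem sum_jumpSize (hc : IsCountingPath c) {a b : ℝ≥0} (hab : a ≤ b) :
    ∑ s ∈ (hc.jumps b).filter (a < ·), jumpSize c s = (c b : ℝ) - c a := by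
  have key : ∀ t, jumpIntegral (fun _ => 1) c t = (c t : ℝ) - c 0 := by
    apply nnreal_induction
    · rw [hc.jumpIntegral_eq_sum _ le_rfl, sub_self]
      apply Finset.sum_eq_zero
      intro s hs
      simp only [Finset.mem_filter, mem_jumps] at hs
      exact absurd hs.1.1.1 (not_lt.2 hs.2)
    · intro s hs h
      obtain ⟨r, hr, hconst⟩ := hc.exists_const_left hs
      have := neBot_nhdsLT hs
      rw [hc.jumpIntegral_eq_add _ hr hconst, h r hr,
        leftLim_eq_of_tendsto tendsto_const_nhds]
      ring
    · intro a ha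
      obtain ⟨b, hb, h⟩ := hc.exists_const_right a
      refine ⟨b, hb, fun t ht => ?_⟩
      have h1 := h t ⟨ht.1.le, ht.2⟩
      rw [hc.jumpIntegral_eq_of_eq _ ht.1.le h1.symm, ha a le_rfl, h1]
  have h := hc.jumpIntegral_sub (fun _ => 1) hab
  rw [key, key] at h
  rw [sub_sub_sub_cancel_right] at h
  rw [h]
  apply Finset.sum_congr rfl
  intro s hs
  simp only [Finset.mem_filter, mem_jumps] at hs
  have := neBot_nhdsLT hs.1.1.1
  rw [leftLim_eq_of_tendsto tendsto_const_nhds, one_mul]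

theorem comp_mul (hc : IsCountingPath c) (γ : ℝ≥0) : IsCountingPath fun t => c (γ * t) where
  mono _ _ h := hc.mono (by gcongr)
  rightCont t := by
    refine (hc.rightCont (γ * t)).comp (t := Ici (γ * t)) ?_ ?_
    · exact (continuous_const.mul continuous_id).continuousWithinAt
    · intro s hs
      exact mul_le_mul_right (show t ≤ s from hs) γ

end IsCountingPath

theorem exists_grid {t s : ℝ≥0} {m : ℕ} (hm : 0 < m) (hs : 0 < s) (hst : s ≤ t) :
    ∃ k < m, (k : ℝ≥0) * t / m < s ∧ s ≤ (k + 1 : ℕ) * t / m := by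
  have ht : 0 < t := hs.trans_le hst
  have hm' : (0 : ℝ≥0) < m := by exact_mod_cast hm
  -- The cell index is the ceiling minus one: cells are open on the left, so the left end point is
  -- strictly before `s`, as a left limit requires.
  have hpos : 0 < ⌈s * m / t⌉₊ := Nat.ceil_pos.2 (by positivity)
  obtain ⟨k, hk⟩ : ∃ k, ⌈s * m / t⌉₊ = k + 1 := ⟨_, (Nat.succ_pred_eq_of_pos hpos).symm⟩
  have h1 : s * m / t ≤ (k + 1 : ℕ) := hk ▸ Nat.le_ceil _
  have h2 : (k : ℝ≥0) < s * m / t := Nat.lt_ceil.1 (by omega)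
  refine ⟨k, ?_, ?_, ?_⟩
  · have : ⌈s * m / t⌉₊ ≤ m := by
      apply Nat.ceil_le.2
      rw [div_le_iff₀ ht, mul_comm]
      gcongr
    omega
  · rw [div_lt_iff₀ hm']
    rwa [lt_div_iff₀ ht] at h2
  · rw [le_div_iff₀ hm']
    rwa [div_le_iff₀ ht] at h1

/-- The left-point sums over the grid of mesh `t / m` converge to the pathwise integral. -/
theorem IsCountingPath.tendsto_grid_sum {c : ℝ≥0 → ℕ} (hc : IsCountingPath c) {f : ℝ≥0 → ℝ}
    (hf : ∀ s, 0 < s → ∃ y, Tendsto f (𝓝[<] s) (𝓝 y)) (t : ℝ≥0) :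
    Tendsto (fun m : ℕ => ∑ k ∈ Finset.range m,
      f (k * t / m) * ((c ((k + 1 : ℕ) * t / m) : ℝ) - c (k * t / m))) atTop
      (𝓝 (jumpIntegral f c t)) := by
  have hgrid : ∀ m : ℕ, Monotone fun k : ℕ => (k : ℝ≥0) * t / m := by
    intro m a b hab
    have : (a : ℝ≥0) ≤ b := by exact_mod_cast hab
    simp only
    gcongr
  -- Each increment of `c` is the sum of its jumps in the cell. After exchanging the sums, each jump
  -- `s` carries the value of `f` at the left end of the cell that contains `s`.
  have hsum : ∀ m : ℕ, 0 < m → ∑ k ∈ Finset.range m,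
      f (k * t / m) * ((c ((k + 1 : ℕ) * t / m) : ℝ) - c (k * t / m)) =
      ∑ s ∈ hc.jumps t, (∑ k ∈ Finset.range m,
        if (k : ℝ≥0) * t / m < s ∧ s ≤ (k + 1 : ℕ) * t / m then f (k * t / m) else 0) *
          jumpSize c s := by
    intro m hm
    have hm' : (0 : ℝ≥0) < m := by exact_mod_cast hm
    simp_rw [Finset.sum_mul]
    rw [Finset.sum_comm]
    apply Finset.sum_congr rfl
    intro k hk
    rw [← hc.sum_jumpSize (hgrid m (Nat.le_succ k)), Finset.mul_sum, Finset.sum_filter]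
    have hkt : (k + 1 : ℕ) * t / m ≤ t := by
      rw [div_le_iff₀ hm', mul_comm]
      gcongr
      exact_mod_cast Finset.mem_range.1 hk
    refine Finset.sum_subset_zero_on_sdiff ?_ ?_ ?_
    · intro s hs
      rw [hc.mem_jumps] at hs ⊢
      exact ⟨⟨hs.1.1, hs.1.2.trans hkt⟩, hs.2⟩
    · intro s hs
      rw [Finset.mem_sdiff, hc.mem_jumps, hc.mem_jumps] at hs
      rw [if_neg, zero_mul]
      exact fun h => hs.2 ⟨⟨hs.1.1.1, h.2⟩, hs.1.2⟩
    · intro s hs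
      have := (hc.mem_jumps.1 hs).1.2
      by_cases h : (k : ℝ≥0) * t / m < s
      · simp only [h, this, and_self, if_true]
      · simp only [h, false_and, if_false, zero_mul]
  rw [hc.jumpIntegral_eq_sum f le_rfl,
    Finset.filter_true_of_mem (fun s hs => (hc.mem_jumps.1 hs).1.2)]
  refine Tendsto.congr' (f₁ := fun m : ℕ => _)
    ((eventually_gt_atTop 0).mono fun m hm => (hsum m hm).symm) ?_
  refine tendsto_finsetSum _ fun s hs => Tendsto.mul_const _ ?_
  obtain ⟨⟨hs0, hst⟩, -⟩ := hc.mem_jumps.1 hs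
  have hne := neBot_nhdsLT hs0
  obtain ⟨y, hy⟩ := hf s hs0
  rw [leftLim_eq_of_tendsto hy]
  -- The point `u` is the left end of the cell of `s`; it lies strictly below `s` and within `t / m`
  -- of it, so `f` there tends to the left limit.
  have hchoose : ∀ m : ℕ, ∃ u, 0 < m → (u < s ∧ s ≤ u + t / m ∧
      (∑ k ∈ Finset.range m, if (k : ℝ≥0) * t / m < s ∧ s ≤ (k + 1 : ℕ) * t / m
        then f (k * t / m) else 0) = f u) := by
    intro m
    rcases Nat.eq_zero_or_pos m with h | hm
    · exact ⟨0, fun h' => absurd h' (by omega)⟩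
    obtain ⟨k, hk, h1, h2⟩ := exists_grid hm hs0 hst
    refine ⟨k * t / m, fun _ => ⟨h1, ?_, ?_⟩⟩
    · refine h2.trans (le_of_eq ?_)
      push_cast
      ring
    · rw [Finset.sum_eq_single k, if_pos ⟨h1, h2⟩]
      · intro j _ hjk
        rw [if_neg]
        rintro ⟨h3, h4⟩
        rcases lt_or_gt_of_ne hjk with h | h
        · exact absurd (h4.trans (hgrid m h)) (not_le.2 h1)
        · exact absurd (h2.trans (hgrid m h)) (not_le.2 h3)
      · intro h
        exact absurd (Finset.mem_range.2 hk) h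
  choose u hu using hchoose
  have hu' : Tendsto u atTop (𝓝[<] s) := by
    refine tendsto_nhdsWithin_iff.2 ⟨?_, (eventually_gt_atTop 0).mono fun m hm => (hu m hm).1⟩
    have h0 : Tendsto (fun m : ℕ => s - t / (m : ℝ≥0)) atTop (𝓝 s) := by
      have : Tendsto (fun m : ℕ => t / (m : ℝ≥0)) atTop (𝓝 0) := by
        rw [← NNReal.tendsto_coe]
        simpa using tendsto_const_div_atTop_nhds_zero_nat (t : ℝ)
      simpa using tendsto_const_nhds.sub this
    refine tendsto_of_tendsto_of_tendsto_of_le_of_le' h0 tendsto_const_nhds ?_ ?_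
    · filter_upwards [eventually_gt_atTop 0] with m hm
      exact tsub_le_iff_right.2 (hu m hm).2.1
    · filter_upwards [eventually_gt_atTop 0] with m hm
      exact (hu m hm).1.le
  refine (hy.comp hu').congr' ?_
  filter_upwards [eventually_gt_atTop 0] with m hm
  exact (hu m hm).2.2.symm

end HarmonicChain

namespace HarmonicChain

/-! ### Right-continuous paths with left limits -/

/-- A right-continuous path is the limit of its values at the next grid point. These depend on time
only through a floor, hence are measurable in time, and jointly in time and chance when the path is
random. -/
theorem tendsto_right_grid (t : ℝ≥0) :
    Tendsto (fun m : ℕ => ((⌊t * m⌋₊ + 1 : ℕ) : ℝ≥0) / m) atTop (𝓝[≥] t) := by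
  refine tendsto_nhdsWithin_iff.2 ⟨?_, (eventually_gt_atTop 0).mono fun m hm => ?_⟩
  · have h0 : Tendsto (fun m : ℕ => t + 1 / (m : ℝ≥0)) atTop (𝓝 t) := by
      have : Tendsto (fun m : ℕ => 1 / (m : ℝ≥0)) atTop (𝓝 0) := by
        rw [← NNReal.tendsto_coe]
        simpa using tendsto_const_div_atTop_nhds_zero_nat (1 : ℝ)
      simpa using tendsto_const_nhds.add this
    refine tendsto_of_tendsto_of_tendsto_of_le_of_le' tendsto_const_nhds h0 ?_ ?_
    · filter_upwards [eventually_gt_atTop 0] with m hm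
      rw [le_div_iff₀ (by exact_mod_cast hm)]
      exact_mod_cast (Nat.lt_floor_add_one (t * m)).le
    · filter_upwards [eventually_gt_atTop 0] with m hm
      have hm' : (0 : ℝ≥0) < m := by exact_mod_cast hm
      rw [div_le_iff₀ hm', add_mul, one_div, inv_mul_cancel₀ hm'.ne']
      push_cast
      gcongr
      exact Nat.floor_le (zero_le)
  · show t ≤ _
    rw [le_div_iff₀ (by exact_mod_cast hm)]
    exact_mod_cast (Nat.lt_floor_add_one (t * m)).le

theorem measurable_of_rightCont {f : ℝ≥0 → ℝ} (hf : ∀ t, ContinuousWithinAt f (Ici t) t) :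
    Measurable f := by
  refine measurable_of_tendsto_metrizable
    (f := fun m : ℕ => fun t : ℝ≥0 => f (((⌊t * m⌋₊ + 1 : ℕ) : ℝ≥0) / m)) (fun m => ?_) ?_
  · have : Measurable fun k : ℕ => f (((k + 1 : ℕ) : ℝ≥0) / m) := measurable_from_top
    exact this.comp (Nat.measurable_floor.comp (measurable_id.mul_const _))
  · exact tendsto_pi_nhds.2 fun t => (hf t).tendsto.comp (tendsto_right_grid t)

/-- Half-line induction in place of compactness: the left limit bounds the path just before a time,
right continuity just after it. -/
theorem exists_bound_of_cadlag {f : ℝ≥0 → ℝ} (hf : ∀ t, ContinuousWithinAt f (Ici t) t)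
    (hl : ∀ s, 0 < s → ∃ y, Tendsto f (𝓝[<] s) (𝓝 y)) (t : ℝ≥0) :
    ∃ K, ∀ s ≤ t, |f s| ≤ K := by
  revert t
  apply nnreal_induction
  · refine ⟨|f 0|, fun s hs => ?_⟩
    rw [le_antisymm hs (zero_le)]
  · intro s hs h
    obtain ⟨y, hy⟩ := hl s hs
    have h1 : ∀ᶠ u in 𝓝[<] s, |f u| < |y| + 1 := hy.abs.eventually_lt_const (by linarith)
    obtain ⟨r, hr, hr'⟩ := (mem_nhdsLT_iff_exists_Ioo_subset' hs).1 h1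
    obtain ⟨K, hK⟩ := h r hr
    refine ⟨max (max K (|y| + 1)) |f s|, fun u hu => ?_⟩
    rcases eq_or_lt_of_le hu with rfl | hu
    · exact le_max_right _ _
    rcases le_or_gt u r with h2 | h2
    · exact (hK u h2).trans ((le_max_left _ _).trans (le_max_left _ _))
    · exact (hr' ⟨h2, hu⟩).le.trans ((le_max_right _ _).trans (le_max_left _ _))
  · intro a ha
    obtain ⟨K, hK⟩ := ha a le_rfl
    have h1 : ∀ᶠ u in 𝓝[≥] a, |f u| < |f a| + 1 :=
      (hf a).tendsto.abs.eventually_lt_const (by linarith)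
    obtain ⟨b, hb, hb'⟩ := mem_nhdsGE_iff_exists_Ico_subset.1 h1
    refine ⟨b, hb, fun t ht => ⟨max K (|f a| + 1), fun u hu => ?_⟩⟩
    rcases le_or_gt u a with h2 | h2
    · exact (hK u h2).trans (le_max_left _ _)
    · exact (hb' ⟨h2.le, hu.trans_lt ht.2⟩).le.trans (le_max_right _ _)

theorem intervalIntegrable_of_cadlag {f : ℝ≥0 → ℝ} (hf : ∀ t, ContinuousWithinAt f (Ici t) t)
    (hl : ∀ s, 0 < s → ∃ y, Tendsto f (𝓝[<] s) (𝓝 y)) (t : ℝ≥0) :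
    IntervalIntegrable (fun s : ℝ => f s.toNNReal) volume 0 t := by
  obtain ⟨K, hK⟩ := exists_bound_of_cadlag hf hl t
  rw [intervalIntegrable_iff, uIoc_of_le t.coe_nonneg]
  refine Measure.integrableOn_of_bounded (M := K) (by simp) ?_ ?_
  · exact ((measurable_of_rightCont hf).comp measurable_real_toNNReal).aestronglyMeasurable
  · filter_upwards [ae_restrict_mem measurableSet_Ioc] with s hs
    exact hK _ (Real.toNNReal_le_iff_le_coe.2 hs.2)

/-! ### The growth of the solutions -/

section Growth

variable {ι : Type*} [Fintype ι] {Y : ℝ≥0 → ι → ℝ} {c : ι → ℝ≥0 → ℕ} {h : ι → ℝ → ℝ}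
  {β : ℝ → ℝ} {C : ℝ}

/-- A bound for the solutions of linear equations with jumps that at most triple the solution. -/
theorem norm_le_of_jump_equation (hc : ∀ i, IsCountingPath (c i))
    (hY : ∀ t, ContinuousWithinAt Y (Ici t) t)
    (hl : ∀ s, 0 < s → ∃ y, Tendsto Y (𝓝[<] s) (𝓝 y))
    (hC : 0 ≤ C) (hβ : ∀ s, 0 ≤ β s) (hβi : ∀ t : ℝ≥0, IntervalIntegrable β volume 0 t)
    (hhi : ∀ i, ∀ t : ℝ≥0, IntervalIntegrable (h i) volume 0 t)
    (hh : ∀ i, ∀ s : ℝ≥0, |h i s| ≤ C * ‖Y s‖ + β s)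
    (heq : ∀ i, ∀ t : ℝ≥0, Y t i = Y 0 i + (∫ s in (0 : ℝ)..t, h i s) -
      2 * jumpIntegral (fun s => Y s i) (c i) t) (t : ℝ≥0) :
    ‖Y t‖ ≤ Real.exp (C * t) * 3 ^ (∑ i, c i t) * (‖Y 0‖ + (∫ s in (0 : ℝ)..t, β s) + C * t) := by
  have hβm : ∀ a b : ℝ≥0, a ≤ b → (∫ s in (0 : ℝ)..a, β s) ≤ ∫ s in (0 : ℝ)..b, β s := by
    intro a b hab
    apply intervalIntegral.integral_mono_interval le_rfl a.2 (by exact_mod_cast hab)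
    · exact Eventually.of_forall hβ
    · exact hβi b
  have hβ0 : ∀ a : ℝ≥0, 0 ≤ ∫ s in (0 : ℝ)..a, β s := fun a => by
    simpa using hβm 0 a (zero_le)
  have hint : ∀ i, ∀ a b : ℝ≥0, (∫ s in (0 : ℝ)..b, h i s) - (∫ s in (0 : ℝ)..a, h i s) =
      ∫ s in (a : ℝ)..b, h i s := fun i a b =>
    intervalIntegral.integral_interval_sub_left (hhi i b) (hhi i a)
  revert t
  apply nnreal_induction
  · have : (1 : ℝ) ≤ 3 ^ (∑ i, c i 0) := one_le_pow₀ (by norm_num)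
    simp only [NNReal.coe_zero, mul_zero, Real.exp_zero, one_mul, intervalIntegral.integral_same,
      add_zero]
    exact le_mul_of_one_le_left (norm_nonneg _) this
  · intro s hs hr
    have hne := neBot_nhdsLT hs
    obtain ⟨L, hL⟩ := hl s hs
    have hconst : ∃ r < s, ∀ i, ∀ u ∈ Ico r s, c i u = c i r := by
      choose r hrs hrc using fun i => (hc i).exists_const_left hs
      refine ⟨Finset.univ.sup r, ?_, fun i u hu => ?_⟩
      · exact (Finset.sup_lt_iff hs).2 fun i _ => hrs i
      · have h1 : r i ≤ Finset.univ.sup r := Finset.le_sup (Finset.mem_univ i)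
        rw [hrc i u ⟨h1.trans hu.1, hu.2⟩, hrc i _ ⟨h1, hu.1.trans_lt hu.2⟩]
    obtain ⟨r, hrs, hrc⟩ := hconst
    -- The claimed bound at `s` with the counts still frozen at their values just before `s`; it
    -- bounds the left limit, and the jump at `s` then adds the missing powers of `3`.
    set D := Real.exp (C * s) * 3 ^ (∑ i, c i r) *
      (‖Y 0‖ + (∫ s in (0 : ℝ)..s, β s) + C * s) with hD
    have hD0 : 0 ≤ D := by
      have := hβ0 s
      positivity
    have hLD : ‖L‖ ≤ D := by
      refine le_of_tendsto hL.norm ?_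
      filter_upwards [Ico_mem_nhdsLT hrs] with u hu
      refine (hr u hu.2).trans ?_
      have h1 : ∑ i, c i u = ∑ i, c i r := Finset.sum_congr rfl fun i _ => hrc i u hu
      have h2 := hβm u s hu.2.le
      have h3 := hβ0 u
      have h4 : (u : ℝ) ≤ s := by exact_mod_cast hu.2.le
      rw [h1, hD]
      gcongr
    have hstep : ∀ i, Y s i = L i - 2 * (L i * ((c i s : ℝ) - c i r)) := by
      intro i
      have hLi : Tendsto (fun u => Y u i) (𝓝[<] s) (𝓝 (L i)) :=
        (continuous_apply i).continuousAt.tendsto.comp hL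
      have hprim : Tendsto (fun u : ℝ≥0 => ∫ x in (u : ℝ)..s, h i x) (𝓝[<] s) (𝓝 0) := by
        have h1 : ContinuousOn (fun b : ℝ => ∫ x in (0 : ℝ)..b, h i x) (uIcc 0 (s : ℝ)) :=
          intervalIntegral.continuousOn_primitive_interval' (hhi i s) left_mem_uIcc
        have h2 : Tendsto (fun b : ℝ => ∫ x in (0 : ℝ)..b, h i x) (𝓝[uIcc 0 (s : ℝ)] s)
          (𝓝 (∫ x in (0 : ℝ)..s, h i x)) := h1 _ right_mem_uIcc
        have h3 : Tendsto (fun u : ℝ≥0 => (u : ℝ)) (𝓝[<] s) (𝓝[uIcc 0 (s : ℝ)] s) := by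
          refine tendsto_nhdsWithin_iff.2 ⟨?_, ?_⟩
          · exact (NNReal.continuous_coe.tendsto s).mono_left nhdsWithin_le_nhds
          · filter_upwards [self_mem_nhdsWithin] with u hu
            rw [uIcc_of_le s.coe_nonneg]
            exact ⟨u.2, by exact_mod_cast (show u < s from hu).le⟩
        have h4 := (tendsto_const_nhds (x := ∫ x in (0 : ℝ)..s, h i x)).sub (h2.comp h3)
        rw [sub_self] at h4
        refine h4.congr fun u => ?_
        exact hint i u s
      have hlim : Tendsto (fun u : ℝ≥0 => Y u i + (∫ x in (u : ℝ)..s, h i x) -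
          2 * (L i * ((c i s : ℝ) - c i r))) (𝓝[<] s)
          (𝓝 (L i + 0 - 2 * (L i * ((c i s : ℝ) - c i r)))) :=
        (hLi.add hprim).sub tendsto_const_nhds
      rw [add_zero] at hlim
      refine tendsto_nhds_unique (tendsto_const_nhds.congr' ?_) hlim
      filter_upwards [Ico_mem_nhdsLT hrs] with u hu
      have h1 := (hc i).jumpIntegral_eq_add (fun s => Y s i) hu.2 (fun v hv => by
        rw [hrc i v ⟨hu.1.trans hv.1, hv.2⟩, hrc i u hu])
      rw [leftLim_eq_of_tendsto hLi, hrc i u hu] at h1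
      rw [heq i s, heq i u, h1, ← hint i u s]
      ring
    have hcmono : ∀ i, c i r ≤ c i s := fun i => (hc i).mono hrs.le
    have hYs : ‖Y s‖ ≤ D * 3 ^ (∑ i, (c i s - c i r)) := by
      refine (pi_norm_le_iff_of_nonneg (by positivity)).2 fun i => ?_
      rw [hstep i]
      have h1 : L i - 2 * (L i * ((c i s : ℝ) - c i r)) =
          L i * (1 - 2 * ((c i s - c i r : ℕ) : ℝ)) := by
        rw [Nat.cast_sub (hcmono i)]
        ring
      -- Bernoulli's inequality `1 + 2k ≤ 3^k`: a jump of size `k` multiplies the coordinate by `1 -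
      -- 2k`.
      have h2 : ‖1 - 2 * ((c i s - c i r : ℕ) : ℝ)‖ ≤ 3 ^ (c i s - c i r) := by
        have h3 := one_add_mul_le_pow (show (-2 : ℝ) ≤ 2 by norm_num) (c i s - c i r)
        have h4 : (0 : ℝ) ≤ ((c i s - c i r : ℕ) : ℝ) := Nat.cast_nonneg _
        rw [Real.norm_eq_abs, abs_le]
        norm_num at h3
        constructor <;> linarith
      rw [h1, norm_mul]
      have h3 : (3 : ℝ) ^ (c i s - c i r) ≤ 3 ^ (∑ i, (c i s - c i r)) :=
        pow_le_pow_right₀ (by norm_num)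
          (Finset.single_le_sum (f := fun i => c i s - c i r) (fun _ _ => zero_le)
            (Finset.mem_univ i))
      exact mul_le_mul ((norm_le_pi_norm L i).trans hLD) (h2.trans h3) (norm_nonneg _) hD0
    refine hYs.trans (le_of_eq ?_)
    have h5 : ∑ i, c i s = ∑ i, c i r + ∑ i, (c i s - c i r) := by
      rw [← Finset.sum_add_distrib]
      exact Finset.sum_congr rfl fun i _ => by have := hcmono i; omega
    rw [h5, pow_add, hD]
    ring
  · intro a ha
    have hconst : ∃ b > a, ∀ i, ∀ u ∈ Ico a b, c i u = c i a := by
      choose b hb hbc using fun i => (hc i).exists_const_right a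
      have : ∀ᶠ b' in 𝓝[>] a, ∀ i, b' < b i :=
        eventually_all.2 fun i => Filter.mem_of_superset (Ioo_mem_nhdsGT (hb i)) fun x hx => hx.2
      obtain ⟨b', hb', hb''⟩ := (this.and self_mem_nhdsWithin).exists
      exact ⟨b', hb'', fun i u hu => hbc i u ⟨hu.1, hu.2.trans (hb' i)⟩⟩
    obtain ⟨b₁, hb₁, hcb⟩ := hconst
    have h1 : ∀ᶠ u in 𝓝[≥] a, ‖Y u‖ < ‖Y a‖ + 1 :=
      (hY a).tendsto.norm.eventually_lt_const (by linarith)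
    obtain ⟨b₂, hb₂, hYb⟩ := mem_nhdsGE_iff_exists_Ico_subset.1 h1
    refine ⟨min b₁ b₂, lt_min hb₁ hb₂, fun t ht => ?_⟩
    have hta : (a : ℝ) ≤ t := by exact_mod_cast ht.1.le
    have hct : ∀ i, c i t = c i a := fun i => hcb i t ⟨ht.1.le, ht.2.trans_le (min_le_left _ _)⟩
    have hβa := hβ0 a
    have hβat : (∫ s in (a : ℝ)..t, β s) = (∫ s in (0 : ℝ)..t, β s) - ∫ s in (0 : ℝ)..a, β s :=
      (intervalIntegral.integral_interval_sub_left (hβi t) (hβi a)).symm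
    have hβat0 : 0 ≤ ∫ s in (a : ℝ)..t, β s := by
      rw [hβat, sub_nonneg]
      exact hβm _ _ ht.1.le
    have hβiat : IntervalIntegrable β volume a t := (hβi a).symm.trans (hβi t)
    -- Just after `a` there are no jumps and `‖Y‖` exceeds `‖Y a‖` by less than `1`. This `1` is
    -- what the summand `C * t` in the bound pays for.
    have hstep : ‖Y t‖ ≤ ‖Y a‖ + (C * (‖Y a‖ + 1) * (t - a) + ∫ s in (a : ℝ)..t, β s) := by
      refine (pi_norm_le_iff_of_nonneg ?_).2 fun i => ?_
      · have : 0 ≤ (t : ℝ) - a := sub_nonneg.2 hta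
        positivity
      have h2 : Y t i = Y a i + ∫ s in (a : ℝ)..t, h i s := by
        rw [heq i t, heq i a, ← hint i a t,
          (hc i).jumpIntegral_eq_of_eq _ ht.1.le (hct i).symm]
        ring
      rw [h2]
      refine (norm_add_le _ _).trans (add_le_add (norm_le_pi_norm _ i) ?_)
      have h3 : ‖∫ s in (a : ℝ)..t, h i s‖ ≤ ∫ s in (a : ℝ)..t, (C * (‖Y a‖ + 1) + β s) := by
        refine intervalIntegral.norm_integral_le_of_norm_le hta ?_ ?_
        · refine Eventually.of_forall fun s hs => ?_
          have hs0 : 0 ≤ s := a.2.trans hs.1.le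
          lift s to ℝ≥0 using hs0
          refine (hh i s).trans ?_
          gcongr
          refine (hYb ⟨?_, ?_⟩).le
          · exact_mod_cast hs.1.le
          · exact lt_of_le_of_lt (by exact_mod_cast hs.2) (ht.2.trans_le (min_le_right _ _))
        · exact intervalIntegrable_const.add hβiat
      refine h3.trans (le_of_eq ?_)
      rw [intervalIntegral.integral_add intervalIntegrable_const hβiat,
        intervalIntegral.integral_const, smul_eq_mul]
      ring
    have hIH := ha a le_rfl
    have hcs : ∑ i, c i t = ∑ i, c i a := Finset.sum_congr rfl fun i _ => hct i
    set A := ‖Y 0‖ + (∫ s in (0 : ℝ)..a, β s) + C * a with hA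
    set K := (3 : ℝ) ^ (∑ i, c i a) with hK
    have hK1 : 1 ≤ K := one_le_pow₀ (by norm_num)
    have hA0 : 0 ≤ A := by positivity
    have hx : 0 ≤ (t : ℝ) - a := sub_nonneg.2 hta
    have he : Real.exp (C * t) = Real.exp (C * a) * Real.exp (C * (t - a)) := by
      rw [← Real.exp_add]
      ring_nf
    have he1 : 1 + C * (t - a) ≤ Real.exp (C * (t - a)) := by
      have := Real.add_one_le_exp (C * ((t : ℝ) - a))
      linarith
    have het : 1 ≤ Real.exp (C * t) := Real.one_le_exp (by positivity)
    calc ‖Y t‖ ≤ ‖Y a‖ * (1 + C * (t - a)) + ((∫ s in (a : ℝ)..t, β s) + C * (t - a)) := by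
          linarith
      _ ≤ (Real.exp (C * a) * K * A) * Real.exp (C * (t - a)) +
          Real.exp (C * t) * K * ((∫ s in (a : ℝ)..t, β s) + C * (t - a)) := by
          refine add_le_add ?_ ?_
          · exact mul_le_mul hIH he1 (by positivity) (by positivity)
          · refine le_mul_of_one_le_left (by positivity) ?_
            exact one_le_mul_of_one_le_of_one_le het hK1
      _ = _ := by
          rw [hcs, hβat, he, hA]
          ring

end Growth

end HarmonicChain

namespace HarmonicChain

/-! ### Poisson processes -/

theorem summable_poisson_weights (r : ℝ≥0) (K : ℝ) :
    Summable fun k : ℕ => Real.exp (-r) * (r : ℝ) ^ k / (k.factorial : ℝ) * K ^ k := by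
  have h := (Real.summable_pow_div_factorial ((r : ℝ) * K)).mul_left (Real.exp (-r))
  refine h.congr fun k => ?_
  rw [mul_pow]
  ring

theorem integrable_pow_poissonMeasure (r : ℝ≥0) (K : ℝ) :
    Integrable (fun k : ℕ => K ^ k) (poissonMeasure r) := by
  rw [integrable_poissonMeasure_iff]
  simpa only [norm_pow] using summable_poisson_weights r ‖K‖

theorem integral_id_poissonMeasure (r : ℝ≥0) : ∫ k : ℕ, (k : ℝ) ∂(poissonMeasure r) = r := by
  rw [integral_poissonMeasure]
  have hS : HasSum (fun k : ℕ => (Real.exp (-r) * (r : ℝ) ^ k / (k.factorial : ℝ)) • (k : ℝ))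
      (r : ℝ) := by
    rw [← hasSum_nat_add_iff' 1]
    simp only [Finset.range_one, Finset.sum_singleton, Nat.cast_zero, smul_zero, sub_zero]
    have := (hasSum_one_poissonMeasure r).mul_left (r : ℝ)
    rw [mul_one] at this
    refine this.congr_fun fun k => ?_
    rw [Nat.factorial_succ, smul_eq_mul]
    push_cast
    field_simp
    ring
  exact hS.tsum_eq

section Poisson

variable {Ω : Type*} [MeasurableSpace Ω] {P : Measure Ω} {N : ℝ≥0 → Ω → ℕ}

theorem IsPoissonProcess.ae_isCountingPath (hN : IsPoissonProcess N P) :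
    ∀ᵐ ω ∂P, IsCountingPath fun t => N t ω := by
  filter_upwards [hN.mono, hN.rightCont] with ω h1 h2
  exact ⟨h1, h2⟩

theorem IsPoissonProcess.integrable_pow (hN : IsPoissonProcess N P) (t : ℝ≥0) (K : ℝ) :
    Integrable (fun ω => K ^ N t ω) P := by
  have h := hN.law 0 t (zero_le)
  have h1 : Integrable (fun ω => K ^ (N t ω - N 0 ω)) P := by
    have h2 := integrable_pow_poissonMeasure (t - 0) K
    rw [← h.map_eq] at h2
    exact h2.comp_aemeasurable h.aemeasurable
  refine h1.congr ?_
  filter_upwards [hN.zero] with ω hω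
  rw [hω, Nat.sub_zero]

theorem IsPoissonProcess.integrable (hN : IsPoissonProcess N P) (t : ℝ≥0) :
    Integrable (fun ω => (N t ω : ℝ)) P := by
  refine (hN.integrable_pow t 2).mono' ?_ (Eventually.of_forall fun ω => ?_)
  · exact (measurable_from_top.comp (hN.measurable t)).aestronglyMeasurable
  · rw [Real.norm_natCast]
    exact_mod_cast (Nat.lt_two_pow_self).le

theorem IsPoissonProcess.integral_sub (hN : IsPoissonProcess N P) {s t : ℝ≥0} (hst : s ≤ t) :
    ∫ ω, ((N t ω : ℝ) - N s ω) ∂P = t - s := by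
  have h := hN.law s t hst
  have h1 : ∫ ω, ((N t ω - N s ω : ℕ) : ℝ) ∂P = ((t - s : ℝ≥0) : ℝ) := by
    rw [← integral_id_poissonMeasure]
    exact h.integral_comp (f := fun k : ℕ => (k : ℝ)) (by fun_prop)
  rw [NNReal.coe_sub hst] at h1
  rw [← h1]
  apply integral_congr_ae
  filter_upwards [hN.mono] with ω hω
  rw [Nat.cast_sub (hω hst)]

/-- A Poisson process has almost surely no jump at a fixed time. -/
theorem IsPoissonProcess.ae_exists_lt_eq [IsFiniteMeasure P] (hN : IsPoissonProcess N P)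
    {t : ℝ≥0} (ht : 0 < t) : ∀ᵐ ω ∂P, ∃ r < t, N r ω = N t ω := by
  rw [ae_iff]
  -- Markov's inequality: a jump at `t` forces `N t - N r ≥ 1` for each `r < t`, which has
  -- probability at most the mean `t - r`.
  have key : ∀ r < t, P {ω | ¬ ∃ r < t, N r ω = N t ω} ≤ ENNReal.ofReal (t - r) := by
    intro r hr
    have hint : Integrable (fun ω => (N t ω : ℝ) - N r ω) P :=
      (hN.integrable t).sub (hN.integrable r)
    have h0 : 0 ≤ᵐ[P] fun ω => (N t ω : ℝ) - N r ω := by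
      filter_upwards [hN.mono] with ω hω
      have := hω hr.le
      simpa using this
    rw [← hN.integral_sub hr.le, ofReal_integral_eq_lintegral_ofReal hint h0]
    have h1 : P {ω | ¬ ∃ r < t, N r ω = N t ω} ≤
        P {ω | 1 ≤ ENNReal.ofReal ((N t ω : ℝ) - N r ω)} := by
      apply measure_mono_ae
      filter_upwards [hN.mono] with ω hω h
      have h2 : ¬ ∃ r < t, N r ω = N t ω := h
      have h3 := hω hr.le
      have h4 : N r ω ≠ N t ω := fun h5 => h2 ⟨r, hr, h5⟩
      show 1 ≤ ENNReal.ofReal ((N t ω : ℝ) - N r ω)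
      rw [ENNReal.one_le_ofReal, le_sub_iff_add_le]
      have h6 : N r ω + 1 ≤ N t ω := by
        simp only at h3
        omega
      rw [add_comm]
      exact_mod_cast h6
    refine h1.trans ?_
    have := mul_meas_ge_le_lintegral₀ (μ := P) (f := fun ω => ENNReal.ofReal ((N t ω : ℝ) - N r ω))
      (hint.aemeasurable.ennreal_ofReal) 1
    rwa [one_mul] at this
  have hlim : Tendsto (fun r : ℝ≥0 => ENNReal.ofReal ((t : ℝ) - r)) (𝓝[<] t) (𝓝 0) := by
    have : Tendsto (fun r : ℝ≥0 => ENNReal.ofReal ((t : ℝ) - r)) (𝓝 t)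
        (𝓝 (ENNReal.ofReal ((t : ℝ) - t))) := by
      exact (ENNReal.continuous_ofReal.comp
        (continuous_const.sub NNReal.continuous_coe)).tendsto t
    rw [sub_self, ENNReal.ofReal_zero] at this
    exact this.mono_left nhdsWithin_le_nhds
  have hne := neBot_nhdsLT ht
  refine le_antisymm (ge_of_tendsto hlim ?_) (zero_le)
  filter_upwards [self_mem_nhdsWithin] with r hr using key r hr

/-- The increments after time `a` are independent of the path up to time `a`. -/
theorem IsPoissonProcess.indep_past [IsProbabilityMeasure P] (hN : IsPoissonProcess N P)
    {a b : ℝ≥0} (hab : a ≤ b) :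
    IndepFun (fun ω (s : Iic a) => N s ω) (fun ω => N b ω - N a ω) P := by
  refine IndepFun.process_indepFun (fun s => hN.measurable s)
    ((hN.measurable b).sub (hN.measurable a)) fun I => ?_
  classical
  set J : Finset ℝ≥0 := insert 0 (I.image Subtype.val) with hJ
  have hJa : ∀ s ∈ J, s ≤ a := by
    intro s hs
    rcases Finset.mem_insert.1 hs with rfl | hs
    · exact zero_le
    · obtain ⟨u, -, rfl⟩ := Finset.mem_image.1 hs
      exact u.2
  have hJpos : 0 < J.card := Finset.card_pos.2 ⟨0, Finset.mem_insert_self _ _⟩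
  -- A monotone sequence of times: `0` and the finitely many past times in increasing order, then
  -- `a`, then `b` forever. Since the count starts at zero, past values are sums of increments of
  -- index below `J.card`, while `N b - N a` is the increment of index `J.card`.
  let τ : ℕ → ℝ≥0 := fun i =>
    if h : i < J.card then J.orderEmbOfFin rfl ⟨i, h⟩ else if i = J.card then a else b
  have hτJ : ∀ i : Fin J.card, τ i = J.orderEmbOfFin rfl i := fun i => dif_pos i.2
  have hτm : Monotone τ := by
    apply monotone_nat_of_le_succ
    intro i
    simp only [τ]
    by_cases h1 : i + 1 < J.card
    · rw [dif_pos h1, dif_pos (by omega)]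
      exact (J.orderEmbOfFin rfl).monotone (Nat.le_succ i)
    · by_cases h2 : i < J.card
      · rw [dif_pos h2, dif_neg h1, if_pos (by omega)]
        exact hJa _ (Finset.orderEmbOfFin_mem _ _ _)
      · rw [dif_neg h2, dif_neg h1, if_neg (by omega : ¬ i + 1 = J.card)]
        split_ifs
        · exact hab
        · exact le_rfl
  have hτ0 : τ 0 = 0 := by
    obtain ⟨i, hi⟩ : (0 : ℝ≥0) ∈ Set.range (J.orderEmbOfFin rfl) := by
      rw [Finset.range_orderEmbOfFin]
      exact Finset.mem_insert_self _ _
    refine le_antisymm ?_ (zero_le)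
    rw [← hi, ← hτJ]
    exact hτm (Nat.zero_le _)
  have hind := hN.indepIncrements.nat hτm
  have hmeas : ∀ i, Measurable fun ω => N (τ (i + 1)) ω - N (τ i) ω := fun i =>
    (hN.measurable _).sub (hN.measurable _)
  have h1 := hind.indepFun_finset (Finset.range J.card) {J.card} (by simp) hmeas
  have hidx : ∀ s : I, ∃ i : Fin J.card, τ i = (s : Iic a) := by
    intro s
    have : ((s : Iic a) : ℝ≥0) ∈ Set.range (J.orderEmbOfFin rfl) := by
      rw [Finset.range_orderEmbOfFin]
      exact Finset.mem_insert_of_mem (Finset.mem_image_of_mem _ s.2)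
    obtain ⟨i, hi⟩ := this
    exact ⟨i, (hτJ i).trans hi⟩
  choose idx hidx using hidx
  let φ : (Finset.range J.card → ℕ) → I → ℕ := fun v s =>
    ∑ i : Finset.range J.card, if (i : ℕ) < idx s then v i else 0
  let ψ : (({J.card} : Finset ℕ) → ℕ) → ℕ := fun v => v ⟨J.card, Finset.mem_singleton_self _⟩
  have hφ : Measurable φ := by
    refine measurable_pi_lambda _ fun s => Finset.measurable_sum _ fun i _ => ?_
    split_ifs
    · exact measurable_pi_apply i
    · exact measurable_const
  have hψ : Measurable ψ := measurable_pi_apply _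
  have h2 := h1.comp hφ hψ
  refine h2.congr ?_ ?_
  · filter_upwards [hN.zero, hN.mono] with ω h0 hm
    funext s
    simp only [Function.comp, φ]
    rw [Finset.sum_coe_sort (Finset.range J.card)
      (fun i => if i < (idx s : ℕ) then N (τ (i + 1)) ω - N (τ i) ω else 0),
      ← Finset.sum_filter]
    have h3 : (Finset.range J.card).filter (· < (idx s : ℕ)) = Finset.range (idx s) := by
      ext i
      have := (idx s).2
      simp only [Finset.mem_filter, Finset.mem_range]
      omega
    rw [h3, Finset.sum_range_tsub (f := fun i => N (τ i) ω) (hm.comp hτm), hidx, hτ0, h0,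
      Nat.sub_zero]
  · refine Eventually.of_forall fun ω => ?_
    simp only [Function.comp, ψ]
    have e1 : τ (J.card + 1) = b := by
      simp only [τ]
      rw [dif_neg (by omega), if_neg (by omega)]
    have e2 : τ J.card = a := by
      simp only [τ]
      rw [dif_neg (lt_irrefl _)]
      exact if_pos trivial
    rw [e1, e2]

end Poisson

/-! ### Independence of the increments of the past -/

/-- The intersections `a ∩ b` form a π-system that generates the join, and on it the probability
factorises twice: first `a` splits off from `b ∩ d`, then `b` from `d`. -/
theorem indep_sup_left_of_indep {Ω : Type*} {m₁ m₂ m₃ mΩ : MeasurableSpace Ω} {P : Measure Ω}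
    [IsProbabilityMeasure P] (h1 : m₁ ≤ mΩ) (h2 : m₂ ≤ mΩ) (h3 : m₃ ≤ mΩ)
    (h23 : Indep m₂ m₃ P) (h123 : Indep m₁ (m₂ ⊔ m₃) P) : Indep (m₁ ⊔ m₂) m₃ P := by
  refine IndepSets.indep
    (p1 := {s | ∃ a b, MeasurableSet[m₁] a ∧ MeasurableSet[m₂] b ∧ s = a ∩ b})
    (p2 := {s | MeasurableSet[m₃] s}) (sup_le h1 h2) h3 ?_
    (@MeasurableSpace.isPiSystem_measurableSet _ m₃) ?_
    (@MeasurableSpace.generateFrom_measurableSet _ m₃).symm ?_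
  · rintro _ ⟨a, b, ha, hb, rfl⟩ _ ⟨a', b', ha', hb', rfl⟩ -
    refine ⟨a ∩ a', b ∩ b', MeasurableSet.inter ha ha', MeasurableSet.inter hb hb', ?_⟩
    exact Set.inter_inter_inter_comm _ _ _ _
  · apply le_antisymm
    · refine sup_le ?_ ?_
      · intro a ha
        exact MeasurableSpace.measurableSet_generateFrom
          ⟨a, Set.univ, ha, MeasurableSet.univ, (Set.inter_univ a).symm⟩
      · intro b hb
        exact MeasurableSpace.measurableSet_generateFrom
          ⟨Set.univ, b, MeasurableSet.univ, hb, (Set.univ_inter b).symm⟩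
    · apply MeasurableSpace.generateFrom_le
      rintro _ ⟨a, b, ha, hb, rfl⟩
      exact MeasurableSet.inter ((le_sup_left : m₁ ≤ m₁ ⊔ m₂) _ ha)
        ((le_sup_right : m₂ ≤ m₁ ⊔ m₂) _ hb)
  · rw [IndepSets_iff]
    rintro _ d ⟨a, b, ha, hb, rfl⟩ hd
    rw [Indep_iff] at h123 h23
    have hb' : MeasurableSet[m₂ ⊔ m₃] b := (le_sup_left : m₂ ≤ m₂ ⊔ m₃) _ hb
    have hd' : MeasurableSet[m₂ ⊔ m₃] d := (le_sup_right : m₃ ≤ m₂ ⊔ m₃) _ hd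
    rw [Set.inter_assoc, h123 a (b ∩ d) ha (MeasurableSet.inter hb' hd'), h23 b d hb hd,
      h123 a b ha hb', mul_assoc]

/-- The `σ`-algebra generated by a map. -/
abbrev sigmaOf {Ω E : Type*} [MeasurableSpace E] (f : Ω → E) : MeasurableSpace Ω :=
  MeasurableSpace.comap f inferInstance

theorem measurable_sigmaOf_comp {Ω E F : Type*} [MeasurableSpace E] [MeasurableSpace F] (f : Ω → E)
    {g : E → F} (hg : Measurable g) : sigmaOf (fun ω => g (f ω)) ≤ sigmaOf f := by
  rintro _ ⟨s, hs, rfl⟩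
  exact ⟨g ⁻¹' s, hg hs, rfl⟩

/-- Independent sources are joined to `Q` one at a time; each must be independent of everything
collected before it together with `D`. In the application `Q` is the past of one clock, `C` the
other clocks, `B` the Wiener process and `A` the initial configuration. -/
theorem indep_sup_chain {Ω : Type*} {A B C Q D mΩ : MeasurableSpace Ω} {P : Measure Ω}
    [IsProbabilityMeasure P] (hA : A ≤ mΩ) (hB : B ≤ mΩ) (hC : C ≤ mΩ) (hQ : Q ≤ mΩ) (hD : D ≤ mΩ)
    (h1 : Indep Q D P) (h2 : Indep C (Q ⊔ D) P) (h3 : Indep B (C ⊔ Q ⊔ D) P)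
    (h4 : Indep A (B ⊔ (C ⊔ Q) ⊔ D) P) : Indep (A ⊔ (B ⊔ (C ⊔ Q))) D P :=
  indep_sup_left_of_indep hA (sup_le hB (sup_le hC hQ)) hD
    (indep_sup_left_of_indep hB (sup_le hC hQ) hD (indep_sup_left_of_indep hC hQ hD h1 h2) h3) h4

section Input

variable {Ω : Type*} [MeasurableSpace Ω] {P : Measure Ω} [IsProbabilityMeasure P] {n : ℕ}
  {N : ℕ → ℝ≥0 → Ω → ℕ} {w : ℝ≥0 → Ω → ℝ} {X₀ : Ω → Config n}

/-- The past is contained in the join of the initial configuration, the whole Wiener path, the whole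
paths of the other clocks, and the past of clock `x`. Only the last needs independent increments;
the rest is independence of the inputs. -/
theorem IsRandomInput.indep_pastSigma (h : IsRandomInput P n N w X₀) (γ : ℝ≥0) {x : ℕ}
    (hx : x ∈ Set.Icc 1 n) {s t : ℝ≥0} (hst : s ≤ t) :
    Indep (pastSigma γ n N w X₀ s) (sigmaOf fun ω => N x (γ * t) ω - N x (γ * s) ω) P := by
  have hN : ∀ y : Set.Icc 1 n, IsPoissonProcess (N y) P := fun y => h.poisson y y.2.1 y.2.2
  have hM : ∀ y : Set.Icc 1 n, sigmaOf (fun ω (t : ℝ≥0) => N y t ω) ≤ ‹MeasurableSpace Ω› :=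
    fun y => (measurable_pi_lambda _ fun t => (hN y).measurable t).comap_le
  have hMeval : ∀ (y : Set.Icc 1 n) (u : ℝ≥0),
      sigmaOf (N y u) ≤ sigmaOf fun ω (t : ℝ≥0) => N y t ω := fun y u =>
    measurable_sigmaOf_comp (fun ω (t : ℝ≥0) => N y t ω) (measurable_pi_apply u)
  have hDM : sigmaOf (fun ω => N x (γ * t) ω - N x (γ * s) ω) ≤
      sigmaOf fun ω (t : ℝ≥0) => N x t ω :=
    measurable_sigmaOf_comp (fun ω (t : ℝ≥0) => N x t ω)
      (g := fun p : ℝ≥0 → ℕ => p (γ * t) - p (γ * s))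
      ((measurable_pi_apply _).sub (measurable_pi_apply _))
  have hQM : sigmaOf (fun ω (u : Iic (γ * s)) => N x u ω) ≤
      sigmaOf fun ω (t : ℝ≥0) => N x t ω :=
    measurable_sigmaOf_comp (fun ω (t : ℝ≥0) => N x t ω)
      (g := fun (p : ℝ≥0 → ℕ) (u : Iic (γ * s)) => p u)
      (measurable_pi_lambda _ fun u => measurable_pi_apply _)
  have hMMN : ∀ y : Set.Icc 1 n, sigmaOf (fun ω (t : ℝ≥0) => N y t ω) ≤
      sigmaOf fun ω (x : Set.Icc 1 n) (t : ℝ≥0) => N x t ω := fun y =>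
    measurable_sigmaOf_comp (fun ω (x : Set.Icc 1 n) (t : ℝ≥0) => N x t ω) (measurable_pi_apply y)
  have hCMN : (⨆ y ∈ ({⟨x, hx⟩}ᶜ : Set (Set.Icc 1 n)), sigmaOf fun ω (t : ℝ≥0) => N y t ω) ≤
      sigmaOf fun ω (x : Set.Icc 1 n) (t : ℝ≥0) => N x t ω := iSup₂_le fun y _ => hMMN y
  have hle : (⨆ y ∈ ({⟨x, hx⟩}ᶜ : Set (Set.Icc 1 n)), sigmaOf fun ω (t : ℝ≥0) => N y t ω) ⊔
      sigmaOf (fun ω (u : Iic (γ * s)) => N x u ω) ⊔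
      sigmaOf (fun ω => N x (γ * t) ω - N x (γ * s) ω) ≤
      sigmaOf fun ω (x : Set.Icc 1 n) (t : ℝ≥0) => N x t ω :=
    sup_le (sup_le hCMN (hQM.trans (hMMN ⟨x, hx⟩))) (hDM.trans (hMMN ⟨x, hx⟩))
  have key := indep_sup_chain (P := P) (A := sigmaOf X₀)
    (B := sigmaOf fun ω (t : ℝ≥0) => w t ω)
    (C := ⨆ y ∈ ({⟨x, hx⟩}ᶜ : Set (Set.Icc 1 n)), sigmaOf fun ω (t : ℝ≥0) => N y t ω)
    (Q := sigmaOf fun ω (u : Iic (γ * s)) => N x u ω)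
    (D := sigmaOf fun ω => N x (γ * t) ω - N x (γ * s) ω)
    h.init_measurable.comap_le
    (measurable_pi_lambda _ fun t => h.wiener_measurable t).comap_le
    (iSup₂_le fun y _ => hM y) (hQM.trans (hM ⟨x, hx⟩)) (hDM.trans (hM ⟨x, hx⟩))
    ((hN ⟨x, hx⟩).indep_past (mul_le_mul_right hst γ)) ?_ ?_ ?_
  · refine indep_of_indep_of_le_left key ?_
    refine sup_le (sup_le le_sup_left ?_) ?_
    · refine iSup₂_le fun u _ => le_sup_of_le_right (le_sup_of_le_left ?_)
      exact measurable_sigmaOf_comp (fun ω (t : ℝ≥0) => w t ω) (measurable_pi_apply u)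
    · refine iSup₂_le fun y hy => iSup₂_le fun u hu =>
        le_sup_of_le_right (le_sup_of_le_right ?_)
      by_cases hyx : y = x
      · subst hyx
        refine le_sup_of_le_right ?_
        exact measurable_sigmaOf_comp (fun ω (u : Iic (γ * s)) => N y u ω)
          (measurable_pi_apply (⟨γ * u, mul_le_mul_right hu γ⟩ : Iic (γ * s)))
      · refine le_sup_of_le_left (le_trans (hMeval ⟨y, hy⟩ (γ * u)) ?_)
        refine le_iSup₂ (f := fun (y : Set.Icc 1 n) (_ : y ∈ ({⟨x, hx⟩}ᶜ : Set (Set.Icc 1 n))) =>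
          sigmaOf fun ω (t : ℝ≥0) => N y t ω) ⟨y, hy⟩ ?_
        simpa [Subtype.ext_iff] using hyx
  · have := indep_iSup_of_disjoint hM h.indep_poisson
      (disjoint_compl_left (a := ({⟨x, hx⟩} : Set (Set.Icc 1 n))))
    refine indep_of_indep_of_le_right this ?_
    refine le_trans (sup_le hQM hDM) ?_
    exact le_iSup₂ (f := fun (y : Set.Icc 1 n) (_ : y ∈ ({⟨x, hx⟩} : Set (Set.Icc 1 n))) =>
      sigmaOf fun ω (t : ℝ≥0) => N y t ω) ⟨x, hx⟩ (Set.mem_singleton _)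
  · exact indep_of_indep_of_le_right h.indep_wiener hle
  · refine indep_of_indep_of_le_right h.indep_init ?_
    rw [sup_assoc]
    refine sup_le ?_ (hle.trans ?_)
    · exact measurable_sigmaOf_comp (fun ω => ((fun t : ℝ≥0 => w t ω),
        fun (x : Set.Icc 1 n) (t : ℝ≥0) => N x t ω)) measurable_fst
    · exact measurable_sigmaOf_comp (fun ω => ((fun t : ℝ≥0 => w t ω),
        fun (x : Set.Icc 1 n) (t : ℝ≥0) => N x t ω)) measurable_snd

/-- The expectation of a variable of the past times an increment of a Poisson process. -/
theorem IsRandomInput.integral_mul_increment (h : IsRandomInput P n N w X₀) {γ : ℝ≥0} {x : ℕ}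
    (hx : x ∈ Set.Icc 1 n) {s t : ℝ≥0} (hst : s ≤ t) {f : Ω → ℝ}
    (hf : AEStronglyMeasurable[pastSigma γ n N w X₀ s] f P) :
    ∫ ω, f ω * ((N x (γ * t) ω : ℝ) - N x (γ * s) ω) ∂P = (∫ ω, f ω ∂P) * (γ * (t - s)) := by
  have hN := h.poisson x hx.1 hx.2
  obtain ⟨g, hg, hfg⟩ := hf
  have hle : pastSigma γ n N w X₀ s ≤ ‹MeasurableSpace Ω› := by
    refine sup_le (sup_le h.init_measurable.comap_le ?_) ?_
    · exact iSup₂_le fun u _ => (h.wiener_measurable u).comap_le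
    · exact iSup₂_le fun y hy => iSup₂_le fun u _ =>
        ((h.poisson y hy.1 hy.2).measurable _).comap_le
  have hind : IndepFun g (fun ω => N x (γ * t) ω - N x (γ * s) ω) P :=
    indep_of_indep_of_le_left (h.indep_pastSigma γ hx hst) hg.measurable.comap_le
  have hind2 : IndepFun g (fun ω => ((N x (γ * t) ω - N x (γ * s) ω : ℕ) : ℝ)) P :=
    hind.comp measurable_id (measurable_from_top (f := fun k : ℕ => (k : ℝ)))
  have hγ : γ * s ≤ γ * t := mul_le_mul_right hst γ
  have hincr : (fun ω => ((N x (γ * t) ω - N x (γ * s) ω : ℕ) : ℝ)) =ᵐ[P]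
      fun ω => (N x (γ * t) ω : ℝ) - N x (γ * s) ω := by
    filter_upwards [hN.mono] with ω hω
    rw [Nat.cast_sub (hω hγ)]
  have h1 := hind2.integral_mul_eq_mul_integral (hg.mono hle).aestronglyMeasurable
    (measurable_from_top.comp ((hN.measurable _).sub (hN.measurable _))).aestronglyMeasurable
  rw [integral_congr_ae hincr, hN.integral_sub hγ, integral_congr_ae hfg.symm] at h1
  rw [mul_sub]
  push_cast at h1
  rw [← h1]
  apply integral_congr_ae
  filter_upwards [hfg, hincr] with ω h2 h3
  rw [Pi.mul_apply, h2, h3]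

end Input

end HarmonicChain

namespace HarmonicChain

/-! ### Riemann sums -/

theorem tendsto_riemann_left {g : ℝ → ℝ} (hg : ContinuousOn g (Icc 0 1)) :
    Tendsto (fun m : ℕ => 1 / (m : ℝ) * ∑ k ∈ Finset.range m, g ((k : ℝ) / m)) atTop
      (𝓝 (∫ u in (0 : ℝ)..1, g u)) := by
  have huc := isCompact_Icc.uniformContinuousOn_of_continuous hg
  rw [Metric.uniformContinuousOn_iff] at huc
  rw [Metric.tendsto_atTop]
  intro ε hε
  obtain ⟨δ, hδ, hgδ⟩ := huc (ε / 2) (by positivity)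
  obtain ⟨m₀, hm₀⟩ := exists_nat_gt (1 / δ)
  refine ⟨max m₀ 1, fun m hm => ?_⟩
  have hm1 : 1 ≤ m := (le_max_right _ _).trans hm
  have hmpos : (0 : ℝ) < m := by exact_mod_cast hm1
  have hmδ : 1 / (m : ℝ) < δ := by
    rw [div_lt_comm₀ hmpos hδ]
    exact hm₀.trans_le (by exact_mod_cast (le_max_left _ _).trans hm)
  have hmem : ∀ k < m, ∀ u ∈ Icc ((k : ℝ) / m) ((k + 1 : ℕ) / m), u ∈ Icc (0 : ℝ) 1 := by
    intro k hk u hu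
    refine ⟨le_trans (by positivity) hu.1, hu.2.trans ?_⟩
    rw [div_le_one hmpos]
    exact_mod_cast hk
  have hle : ∀ k : ℕ, (k : ℝ) / m ≤ (k + 1 : ℕ) / m := fun k => by
    gcongr
    exact Nat.le_succ k
  have hii : ∀ k < m, IntervalIntegrable g volume ((k : ℝ) / m) ((k + 1 : ℕ) / m) := by
    intro k hk
    apply ContinuousOn.intervalIntegrable
    rw [uIcc_of_le (hle k)]
    exact hg.mono fun u hu => hmem k hk u hu
  have hsum := intervalIntegral.sum_integral_adjacent_intervals
    (μ := volume) (f := g) (a := fun k : ℕ => (k : ℝ) / m) (n := m) hii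
  simp only [Nat.cast_zero, zero_div, div_self hmpos.ne'] at hsum
  rw [← hsum, Finset.mul_sum, Real.dist_eq, ← Finset.sum_sub_distrib]
  calc |∑ k ∈ Finset.range m, (1 / (m : ℝ) * g ((k : ℝ) / m) -
        ∫ u in ((k : ℝ) / m)..((k + 1 : ℕ) / m), g u)|
      ≤ ∑ k ∈ Finset.range m, |1 / (m : ℝ) * g ((k : ℝ) / m) -
        ∫ u in ((k : ℝ) / m)..((k + 1 : ℕ) / m), g u| := Finset.abs_sum_le_sum_abs _ _
    _ ≤ ∑ k ∈ Finset.range m, ε / 2 * (1 / m) := by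
        refine Finset.sum_le_sum fun k hk => ?_
        have hk' := Finset.mem_range.1 hk
        have hlen : ((k + 1 : ℕ) : ℝ) / m - (k : ℝ) / m = 1 / m := by
          push_cast
          ring
        have h1 : 1 / (m : ℝ) * g ((k : ℝ) / m) =
            ∫ _ in ((k : ℝ) / m)..((k + 1 : ℕ) / m), g ((k : ℝ) / m) := by
          rw [intervalIntegral.integral_const, hlen, smul_eq_mul]
        rw [h1, ← intervalIntegral.integral_sub intervalIntegrable_const (hii k hk')]
        have h2 := intervalIntegral.norm_integral_le_of_norm_le_const (a := (k : ℝ) / m)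
          (b := ((k + 1 : ℕ) : ℝ) / m) (C := ε / 2) (f := fun u => g ((k : ℝ) / m) - g u) ?_
        · rwa [hlen, abs_of_pos (by positivity : (0 : ℝ) < 1 / m)] at h2
        · intro u hu
          rw [uIoc_of_le (hle k)] at hu
          refine (hgδ _ (hmem k hk' _ ⟨le_rfl, hle k⟩) u (hmem k hk' u ⟨hu.1.le, hu.2⟩) ?_).le
          rw [Real.dist_eq, abs_sub_comm, abs_of_nonneg (by linarith [hu.1])]
          linarith [hu.2]
    _ = ε / 2 := by
        rw [Finset.sum_const, Finset.card_range, nsmul_eq_mul]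
        field_simp
    _ < ε := by linarith

theorem tendsto_riemann_right {g : ℝ → ℝ} (hg : ContinuousOn g (Icc 0 1)) :
    Tendsto (fun n : ℕ => 1 / (n : ℝ) * ∑ x ∈ Finset.Icc 1 n, g ((x : ℝ) / n)) atTop
      (𝓝 (∫ u in (0 : ℝ)..1, g u)) := by
  have h1 := tendsto_riemann_left hg
  have h2 : Tendsto (fun n : ℕ => 1 / (n : ℝ) * (g 1 - g 0)) atTop (𝓝 0) := by
    simpa using tendsto_one_div_atTop_nhds_zero_nat.mul_const (g 1 - g 0)
  have h3 := h1.add h2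
  rw [add_zero] at h3
  refine h3.congr' ?_
  filter_upwards [eventually_gt_atTop 0] with n hn
  have hn' : (n : ℝ) ≠ 0 := by exact_mod_cast hn.ne'
  rw [← mul_add]
  congr 1
  have h4 := Finset.sum_range_succ (fun k : ℕ => g ((k : ℝ) / n)) n
  have h5 := Finset.sum_range_succ' (fun k : ℕ => g ((k : ℝ) / n)) n
  rw [div_self hn'] at h4
  rw [h4] at h5
  simp only [Nat.cast_zero, zero_div] at h5
  rw [Finset.range_eq_Ico, Finset.sum_Ico_add' (fun k : ℕ => g ((k : ℝ) / n)) 0 n 1] at h5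
  have h6 : Finset.Ico (0 + 1) (n + 1) = Finset.Icc 1 n := by
    ext
    simp only [Finset.mem_Ico, Finset.mem_Icc]
    omega
  rw [h6, ← Finset.range_eq_Ico] at h5
  linarith

theorem tendsto_riemann_nnreal {g : ℝ≥0 → ℝ} (hg : Continuous g) (t : ℝ≥0) :
    Tendsto (fun m : ℕ => ∑ k ∈ Finset.range m,
      g (k * t / m) * (((k + 1 : ℕ) * t / m : ℝ≥0) - (k * t / m : ℝ≥0) : ℝ)) atTop
      (𝓝 (∫ s in (0 : ℝ)..t, g s.toNNReal)) := by
  have hc : Continuous fun u : ℝ => g (t * u).toNNReal := by fun_prop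
  have h := (tendsto_riemann_left hc.continuousOn).const_mul (t : ℝ)
  have h1 := intervalIntegral.mul_integral_comp_mul_left (f := fun s : ℝ => g s.toNNReal)
    (a := 0) (b := 1) (t : ℝ)
  rw [h1, mul_zero, mul_one] at h
  refine h.congr fun m => ?_
  rw [Finset.mul_sum, Finset.mul_sum]
  refine Finset.sum_congr rfl fun k _ => ?_
  have h2 : ((t : ℝ) * ((k : ℝ) / m)).toNNReal = k * t / m := by
    rw [← NNReal.coe_inj, Real.coe_toNNReal _ (by positivity)]
    push_cast
    ring
  rw [h2]
  push_cast
  ring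

/-! ### Expectations of processes with right-continuous paths -/

section RandomPaths

variable {Ω : Type*} [MeasurableSpace Ω] {P : Measure Ω} {f g : ℝ≥0 → Ω → ℝ}

/-- The process is integrable on `Ω × (0, t]`. -/
def JointIntegrable (P : Measure Ω) (f : ℝ≥0 → Ω → ℝ) (t : ℝ≥0) : Prop :=
  Integrable (fun p : Ω × ℝ => f p.2.toNNReal p.1) (P.prod (volume.restrict (Ioc 0 (t : ℝ))))

/-- Freezing the process at the next grid point leaves a countable dependence on time, hence joint
measurability; right continuity passes to the limit. -/
theorem aestronglyMeasurable_prod_of_rightCont [SFinite P] (hf : ∀ t, Measurable (f t))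
    (hr : ∀ᵐ ω ∂P, ∀ t, ContinuousWithinAt (fun s => f s ω) (Ici t) t) (ν : Measure ℝ)
    [SFinite ν] : AEStronglyMeasurable (fun p : Ω × ℝ => f p.2.toNNReal p.1) (P.prod ν) := by
  refine aestronglyMeasurable_of_tendsto_ae atTop
    (f := fun m : ℕ => fun p : Ω × ℝ => f (((⌊p.2.toNNReal * m⌋₊ + 1 : ℕ) : ℝ≥0) / m) p.1)
    (fun m => ?_) ?_
  · apply Measurable.aestronglyMeasurable
    have h1 : Measurable fun q : Ω × ℕ => f (((q.2 + 1 : ℕ) : ℝ≥0) / m) q.1 :=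
      measurable_from_prod_countable_left fun k => hf (((k + 1 : ℕ) : ℝ≥0) / m)
    exact h1.comp (measurable_fst.prodMk (Nat.measurable_floor.comp
      (measurable_real_toNNReal.comp measurable_snd |>.mul_const _)))
  · filter_upwards [Measure.quasiMeasurePreserving_fst.ae hr] with p hp
    exact (hp p.2.toNNReal).tendsto.comp (tendsto_right_grid _)

theorem JointIntegrable.of_dominated [IsFiniteMeasure P] (hf : ∀ t, Measurable (f t))
    (hr : ∀ᵐ ω ∂P, ∀ t, ContinuousWithinAt (fun s => f s ω) (Ici t) t) {t : ℝ≥0} {M : Ω → ℝ}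
    (hM : Integrable M P) (hfM : ∀ᵐ ω ∂P, ∀ s ≤ t, |f s ω| ≤ M ω) : JointIntegrable P f t := by
  have hM' : Integrable (fun p : Ω × ℝ => M p.1) (P.prod (volume.restrict (Ioc 0 (t : ℝ)))) := by
    have := hM.mul_prod (integrable_const (1 : ℝ) (μ := volume.restrict (Ioc 0 (t : ℝ))))
    simpa using this
  refine hM'.mono' (aestronglyMeasurable_prod_of_rightCont hf hr _) ?_
  have h2 : ∀ᵐ p ∂(P.prod (volume.restrict (Ioc 0 (t : ℝ)))), p.2 ∈ Ioc 0 (t : ℝ) :=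
    Measure.quasiMeasurePreserving_snd.ae (ae_restrict_mem measurableSet_Ioc)
  filter_upwards [Measure.quasiMeasurePreserving_fst.ae hfM, h2] with p hp hp2
  exact hp _ (Real.toNNReal_le_iff_le_coe.2 hp2.2)

theorem JointIntegrable.add {t : ℝ≥0} (hf : JointIntegrable P f t) (hg : JointIntegrable P g t) :
    JointIntegrable P (fun s ω => f s ω + g s ω) t :=
  Integrable.add hf hg

theorem JointIntegrable.sub {t : ℝ≥0} (hf : JointIntegrable P f t) (hg : JointIntegrable P g t) :
    JointIntegrable P (fun s ω => f s ω - g s ω) t :=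
  Integrable.sub hf hg

theorem JointIntegrable.const_mul {t : ℝ≥0} (hf : JointIntegrable P f t) (a : ℝ) :
    JointIntegrable P (fun s ω => a * f s ω) t :=
  Integrable.const_mul hf a

theorem JointIntegrable.integral_integral [SFinite P] {t : ℝ≥0} (hf : JointIntegrable P f t) :
    Integrable (fun ω => ∫ s in (0 : ℝ)..t, f s.toNNReal ω) P ∧
    ∫ ω, (∫ s in (0 : ℝ)..t, f s.toNNReal ω) ∂P =
      ∫ s in (0 : ℝ)..t, (∫ ω, f s.toNNReal ω ∂P) := by
  simp_rw [intervalIntegral.integral_of_le t.coe_nonneg]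
  exact ⟨Integrable.integral_prod_left hf, integral_integral_swap hf⟩

end RandomPaths

end HarmonicChain

namespace HarmonicChain

/-! ### Coordinates -/

section Coordinates

variable {n : ℕ}

theorem continuous_stretch (x : ℕ) : Continuous fun z : Config n => stretch z x := by
  unfold stretch
  split_ifs <;> fun_prop

theorem continuous_momentum (x : ℕ) : Continuous fun z : Config n => momentum z x := by
  unfold momentum
  split_ifs <;> fun_prop

theorem abs_stretch_le (z : Config n) (x : ℕ) : |stretch z x| ≤ ‖z‖ := by
  unfold stretch
  split_ifs with h
  · exact (norm_le_pi_norm z.1 _).trans (norm_fst_le z)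
  · simp

theorem abs_momentum_le (z : Config n) (x : ℕ) : |momentum z x| ≤ ‖z‖ := by
  unfold momentum
  split_ifs with h
  · exact (norm_le_pi_norm z.2 _).trans (norm_snd_le z)
  · simp

theorem stretch_zero (z : Config n) : stretch z 0 = 0 := by simp [stretch]

theorem norm_le_sum_abs (z : Config n) :
    ‖z‖ ≤ ∑ x ∈ Finset.range (n + 1), (|stretch z x| + |momentum z x|) := by
  have h1 : ∀ x ≤ n, |stretch z x| + |momentum z x| ≤
      ∑ x ∈ Finset.range (n + 1), (|stretch z x| + |momentum z x|) := fun x hx =>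
    Finset.single_le_sum (f := fun x => |stretch z x| + |momentum z x|)
      (fun _ _ => by positivity) (Finset.mem_range.2 (by omega))
  have h0 : 0 ≤ ∑ x ∈ Finset.range (n + 1), (|stretch z x| + |momentum z x|) :=
    Finset.sum_nonneg fun _ _ => by positivity
  rw [Prod.norm_def]
  refine max_le ((pi_norm_le_iff_of_nonneg h0).2 fun i => ?_)
    ((pi_norm_le_iff_of_nonneg h0).2 fun i => ?_)
  · refine le_trans ?_ (h1 (i + 1) (by omega))
    have : stretch z (i + 1) = z.1 i := by
      rw [stretch, dif_pos (by omega)]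
      rfl
    rw [this, Real.norm_eq_abs]
    linarith [abs_nonneg (momentum z (i + 1))]
  · refine le_trans ?_ (h1 i (by omega))
    have : momentum z i = z.2 i := by
      rw [momentum, dif_pos (by omega)]
    rw [this, Real.norm_eq_abs]
    linarith [abs_nonneg (stretch z i)]

end Coordinates

theorem jumpIntegral_zero (f : ℝ≥0 → ℝ) (c : ℝ≥0 → ℕ) : jumpIntegral f c 0 = 0 := by
  simp [jumpIntegral]

theorem isCountingPath_zero : IsCountingPath fun _ => 0 :=
  ⟨monotone_const, fun _ => continuousWithinAt_const⟩

theorem jumpIntegral_zero_path (f : ℝ≥0 → ℝ) (t : ℝ≥0) : jumpIntegral f (fun _ => 0) t = 0 := by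
  rw [isCountingPath_zero.jumpIntegral_eq_of_eq f (zero_le (a := t)) rfl, jumpIntegral_zero]

/-- Near a time without a jump the counting path is constant on both sides, and so is the integral.
-/
theorem IsCountingPath.continuousAt_jumpIntegral {c : ℝ≥0 → ℕ} (hc : IsCountingPath c)
    (f : ℝ≥0 → ℝ) {t : ℝ≥0} (ht : 0 < t → ∃ r < t, c r = c t) :
    ContinuousAt (jumpIntegral f c) t := by
  have key : ∀ᶠ s in 𝓝 t, jumpIntegral f c s = jumpIntegral f c t := by
    obtain ⟨b, hb, hconst⟩ := hc.exists_const_right t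
    rcases eq_or_lt_of_le (zero_le (a := t)) with h | h
    · filter_upwards [Iio_mem_nhds hb] with s hs
      have h1 : t ≤ s := h ▸ zero_le
      exact hc.jumpIntegral_eq_of_eq f h1 (hconst s ⟨h1, hs⟩).symm
    · obtain ⟨r, hr, hrt⟩ := ht h
      filter_upwards [Ioo_mem_nhds hr hb] with s hs
      rcases le_total t s with h1 | h1
      · exact hc.jumpIntegral_eq_of_eq f h1 (hconst s ⟨h1, hs.2⟩).symm
      · refine (hc.jumpIntegral_eq_of_eq f h1 ?_).symm
        have h2 := hc.mono hs.1.le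
        have h3 := hc.mono h1
        omega
  exact continuousAt_const.congr (key.mono fun s hs => hs.symm)

/-! ### Bounds for the paths of the chain -/

/-- The growth bound for the paths of the chain. -/
noncomputable def pathBound (q : ℝ) (γ : ℝ≥0) (σ : ℝ) (n : ℕ) (F : ℝ → ℝ) (N : ℕ → ℝ≥0 → ℕ)
    (w : ℝ≥0 → ℝ) (ζ : ℝ) (t : ℝ≥0) : ℝ :=
  Real.exp ((2 + 2 * γ) * t) * q ^ (∑ x ∈ Finset.range n, N (x + 1) (γ * t)) *
    (ζ + (∫ s in (0 : ℝ)..t, ((2 + 2 * γ) * (σ * |w s.toNNReal|) + |F s|)) + (2 + 2 * γ) * t)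

section Path

variable {γ : ℝ≥0} {T : ℝ} {n : ℕ} {F : ℝ → ℝ} {N : ℕ → ℝ≥0 → ℕ} {w : ℝ≥0 → ℝ}
  {Z : ℝ≥0 → Config n}

theorem SolvesDynamics.rightCont_stretch (h : SolvesDynamics γ T n F N w Z) (x : ℕ) (t : ℝ≥0) :
    ContinuousWithinAt (fun s => stretch (Z s) x) (Ici t) t :=
  (continuous_stretch x).continuousAt.comp_continuousWithinAt (h.rightCont t)

theorem SolvesDynamics.rightCont_momentum (h : SolvesDynamics γ T n F N w Z) (x : ℕ) (t : ℝ≥0) :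
    ContinuousWithinAt (fun s => momentum (Z s) x) (Ici t) t :=
  (continuous_momentum x).continuousAt.comp_continuousWithinAt (h.rightCont t)

theorem SolvesDynamics.leftLimit_stretch (h : SolvesDynamics γ T n F N w Z) (x : ℕ) (t : ℝ≥0)
    (ht : 0 < t) : ∃ y, Tendsto (fun s => stretch (Z s) x) (𝓝[<] t) (𝓝 y) := by
  obtain ⟨z, hz⟩ := h.leftLimit t ht
  exact ⟨_, ((continuous_stretch x).tendsto z).comp hz⟩

theorem SolvesDynamics.leftLimit_momentum (h : SolvesDynamics γ T n F N w Z) (x : ℕ) (t : ℝ≥0)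
    (ht : 0 < t) : ∃ y, Tendsto (fun s => momentum (Z s) x) (𝓝[<] t) (𝓝 y) := by
  obtain ⟨z, hz⟩ := h.leftLimit t ht
  exact ⟨_, ((continuous_momentum x).tendsto z).comp hz⟩

theorem SolvesDynamics.intervalIntegrable_stretch (h : SolvesDynamics γ T n F N w Z) (x : ℕ)
    (t : ℝ≥0) : IntervalIntegrable (fun s : ℝ => stretch (Z s.toNNReal) x) volume 0 t :=
  intervalIntegrable_of_cadlag (h.rightCont_stretch x) (h.leftLimit_stretch x) t

theorem SolvesDynamics.intervalIntegrable_momentum (h : SolvesDynamics γ T n F N w Z) (x : ℕ)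
    (t : ℝ≥0) : IntervalIntegrable (fun s : ℝ => momentum (Z s.toNNReal) x) volume 0 t :=
  intervalIntegrable_of_cadlag (h.rightCont_momentum x) (h.leftLimit_momentum x) t

/-- The coordinates of the chain, with the Wiener noise subtracted. -/
noncomputable def denoised (σ : ℝ) (w : ℝ≥0 → ℝ) (Z : ℝ≥0 → Config n) (t : ℝ≥0) :
    Fin n ⊕ Fin (n + 1) → ℝ :=
  Sum.elim (fun i => stretch (Z t) (i + 1))
    (fun j => momentum (Z t) j - if (j : ℕ) = 0 then σ * w t else 0)

/-- Without `σ w` the momentum of particle `0` has no noise term, so the pathwise growth bound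
applies. The Wiener path comes back in the drift, where `β` absorbs it. -/
theorem SolvesDynamics.norm_denoised_le (h : SolvesDynamics γ T n F N w Z)
    (hw : Continuous w) (hw0 : w 0 = 0) (hF : Continuous F)
    (hN : ∀ x, 1 ≤ x → x ≤ n → IsCountingPath (N x)) (t : ℝ≥0) :
    ‖denoised √(4 * γ * T) w Z t‖ ≤ pathBound 3 γ √(4 * γ * T) n F N w ‖Z 0‖ t := by
  set σ := √(4 * γ * T) with hσ
  have hσ0 : 0 ≤ σ := Real.sqrt_nonneg _
  -- Stretches and particle `0` are not flipped: their clock is the zero path.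
  let c : Fin n ⊕ Fin (n + 1) → ℝ≥0 → ℕ := Sum.elim (fun _ _ => 0)
    (fun j => if (j : ℕ) = 0 then fun _ => 0 else fun s => N j (γ * s))
  let H : Fin n ⊕ Fin (n + 1) → ℝ → ℝ := Sum.elim
    (fun i s => momentum (Z s.toNNReal) (i + 1) - momentum (Z s.toNNReal) i)
    (fun j => if (j : ℕ) = 0 then
        fun s => stretch (Z s.toNNReal) 1 - 2 * γ * momentum (Z s.toNNReal) 0
      else if (j : ℕ) < n then
        fun s => stretch (Z s.toNNReal) (j + 1) - stretch (Z s.toNNReal) j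
      else fun s => F s - stretch (Z s.toNNReal) n)
  have hw' : Continuous fun s : ℝ => w s.toNNReal := hw.comp continuous_real_toNNReal
  have hstr : ∀ (x : ℕ) (s : ℝ≥0), |stretch (Z s) x| ≤ ‖denoised σ w Z s‖ := by
    intro x s
    by_cases hx : 1 ≤ x ∧ x ≤ n
    · have := norm_le_pi_norm (denoised σ w Z s) (Sum.inl ⟨x - 1, by omega⟩)
      simp only [denoised, Sum.elim_inl, Nat.sub_add_cancel hx.1, Real.norm_eq_abs] at this
      exact this
    · rw [stretch, dif_neg hx, abs_zero]
      exact norm_nonneg _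
  have hmom : ∀ (x : ℕ) (s : ℝ≥0), |momentum (Z s) x| ≤ ‖denoised σ w Z s‖ + σ * |w s| := by
    intro x s
    by_cases hx : x ≤ n
    · have h1 := norm_le_pi_norm (denoised σ w Z s) (Sum.inr ⟨x, by omega⟩)
      simp only [denoised, Sum.elim_inr, Real.norm_eq_abs] at h1
      by_cases hx0 : x = 0
      · simp only [hx0, if_true] at h1 ⊢
        have h2 : momentum (Z s) 0 = (momentum (Z s) 0 - σ * w s) + σ * w s := by ring
        rw [h2]
        refine (abs_add_le _ _).trans (add_le_add h1 ?_)
        rw [abs_mul, abs_of_nonneg hσ0]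
      · simp only [hx0, if_false, sub_zero] at h1
        have : 0 ≤ σ * |w s| := by positivity
        exact h1.trans (by linarith!)
    · rw [momentum, dif_neg hx, abs_zero]
      positivity
  -- `C = 2 + 2γ` covers every row of the drift: two coordinates at most, or one stretch and the
  -- friction `2γ p_0`.
  have key := norm_le_of_jump_equation (Y := denoised σ w Z) (c := c) (h := H)
    (β := fun s => (2 + 2 * γ) * (σ * |w s.toNNReal|) + |F s|) (C := 2 + 2 * γ)
    ?_ ?_ ?_ (by positivity) (fun s => by positivity) (fun t => ?_) ?_ ?_ ?_ t
  · refine key.trans ?_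
    rw [pathBound]
    have hcs : ∑ i, c i t = ∑ x ∈ Finset.range n, N (x + 1) (γ * t) := by
      rw [Fintype.sum_sum_type, Fin.sum_univ_succ]
      simp only [c, Sum.elim_inl, Finset.sum_const_zero, Sum.elim_inr, Fin.val_zero, ↓reduceIte,
        zero_add, Fin.val_succ, Nat.succ_ne_zero]
      exact Fin.sum_univ_eq_sum_range (fun i => N (i + 1) (γ * t)) n
    have h0 : ‖denoised σ w Z 0‖ ≤ ‖Z 0‖ := by
      refine (pi_norm_le_iff_of_nonneg (norm_nonneg _)).2 fun i => ?_
      rcases i with i | j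
      · exact abs_stretch_le _ _
      · simp only [denoised, Sum.elim_inr, hw0, mul_zero, ite_self, sub_zero]
        exact abs_momentum_le _ _
    rw [hcs]
    gcongr
  · rintro (i | j)
    · exact isCountingPath_zero
    · simp only [c, Sum.elim_inr]
      split_ifs with hj
      · exact isCountingPath_zero
      · exact (hN j (by omega) (by omega)).comp_mul γ
  · intro t
    refine continuousWithinAt_pi.2 ?_
    rintro (i | j)
    · exact h.rightCont_stretch _ t
    · refine (h.rightCont_momentum _ t).sub ?_
      split_ifs
      · exact (continuous_const.mul hw).continuousWithinAt
      · exact continuousWithinAt_const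
  · intro s hs
    obtain ⟨z, hz⟩ := h.leftLimit s hs
    refine ⟨Sum.elim (fun i => stretch z (i + 1))
      (fun j => momentum z j - if (j : ℕ) = 0 then σ * w s else 0), tendsto_pi_nhds.2 ?_⟩
    rintro (i | j)
    · exact ((continuous_stretch _).tendsto z).comp hz
    · refine (((continuous_momentum _).tendsto z).comp hz).sub ?_
      split_ifs
      · exact ((continuous_const.mul hw).tendsto s).mono_left nhdsWithin_le_nhds
      · exact tendsto_const_nhds
  · apply Continuous.intervalIntegrable
    fun_prop
  · rintro (i | j) t
    · exact (h.intervalIntegrable_momentum _ t).sub (h.intervalIntegrable_momentum _ t)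
    · simp only [H, Sum.elim_inr]
      split_ifs
      · exact (h.intervalIntegrable_stretch _ t).sub
          ((h.intervalIntegrable_momentum _ t).const_mul _)
      · exact (h.intervalIntegrable_stretch _ t).sub (h.intervalIntegrable_stretch _ t)
      · exact (hF.intervalIntegrable _ _).sub (h.intervalIntegrable_stretch _ t)
  · rintro i s
    have hFs := abs_nonneg (F s)
    have hY := norm_nonneg (denoised σ w Z s)
    have hγY : 0 ≤ γ * ‖denoised σ w Z s‖ := by positivity
    have hσw : 0 ≤ σ * |w s| := by positivity
    have hγσ : 0 ≤ γ * (σ * |w s|) := by positivity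
    rcases i with i | j
    · simp only [H, Sum.elim_inl, Real.toNNReal_coe]
      have h1 := hmom (i + 1) s
      have h2 := hmom i s
      refine (abs_sub _ _).trans ?_
      nlinarith
    · simp only [H, Sum.elim_inr]
      split_ifs
      · simp only [Real.toNNReal_coe]
        have h1 := hstr 1 s
        have h2 := hmom 0 s
        refine (abs_sub _ _).trans ?_
        rw [abs_mul, abs_of_nonneg (by positivity : (0 : ℝ) ≤ 2 * γ)]
        have h3 := mul_le_mul_of_nonneg_left h2 (by positivity : (0 : ℝ) ≤ 2 * γ)
        nlinarith
      · simp only [Real.toNNReal_coe]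
        have h1 := hstr (j + 1) s
        have h2 := hstr j s
        refine (abs_sub _ _).trans ?_
        nlinarith
      · simp only [Real.toNNReal_coe]
        have h2 := hstr n s
        refine (abs_sub _ _).trans ?_
        nlinarith
  · rintro (i | j) t
    · simp only [denoised, Sum.elim_inl, c, H, jumpIntegral_zero_path, mul_zero, sub_zero]
      have := h.stretch_eq (i + 1) (by omega) (by omega) t
      simpa only [Nat.add_sub_cancel] using this
    · simp only [denoised, Sum.elim_inr, c, H]
      by_cases hj : (j : ℕ) = 0
      · simp only [hj, if_true, jumpIntegral_zero_path, hw0]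
        rw [h.momentum_left t]
        ring
      · simp only [hj, if_false, sub_zero]
        by_cases hjn : (j : ℕ) < n
        · simp only [hjn, if_true]
          exact h.momentum_bulk j (by omega) hjn t
        · have hjn' : (j : ℕ) = n := by omega
          simp only [hjn', lt_irrefl, if_false]
          exact h.momentum_right t

end Path

end HarmonicChain

/-! ### Continuity properties of the paths and monotonicity of the growth bound -/

namespace HarmonicChain

theorem continuous_primitive_nnreal {h : ℝ → ℝ}
    (hh : ∀ t : ℝ≥0, IntervalIntegrable h volume 0 t) :
    Continuous fun t : ℝ≥0 => ∫ s in (0 : ℝ)..t, h s := by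
  refine continuous_iff_continuousAt.2 fun t => ?_
  have h1 : ContinuousOn (fun b : ℝ => ∫ x in (0 : ℝ)..b, h x) (uIcc 0 ((t + 1 : ℝ≥0) : ℝ)) :=
    intervalIntegral.continuousOn_primitive_interval' (hh (t + 1)) left_mem_uIcc
  have ht : (t : ℝ) ∈ uIcc 0 ((t + 1 : ℝ≥0) : ℝ) := by
    rw [uIcc_of_le (NNReal.coe_nonneg _)]
    exact ⟨t.coe_nonneg, by push_cast; linarith⟩
  refine (h1 _ ht).tendsto.comp (tendsto_nhdsWithin_iff.2
    ⟨NNReal.continuous_coe.tendsto t, ?_⟩)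
  filter_upwards [Iio_mem_nhds (show t < t + 1 from lt_add_one t)] with u hu
  rw [uIcc_of_le (NNReal.coe_nonneg _)]
  exact ⟨u.coe_nonneg, by exact_mod_cast (show u < t + 1 from hu).le⟩

section Path

variable {γ : ℝ≥0} {T : ℝ} {n : ℕ} {F : ℝ → ℝ} {N : ℕ → ℝ≥0 → ℕ} {w : ℝ≥0 → ℝ}
  {Z : ℝ≥0 → Config n}

theorem SolvesDynamics.continuous_stretch_path (h : SolvesDynamics γ T n F N w Z) (x : ℕ) :
    Continuous fun t => stretch (Z t) x := by
  by_cases hx : 1 ≤ x ∧ x ≤ n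
  · have h1 : (fun t => stretch (Z t) x) = _ := funext (h.stretch_eq x hx.1 hx.2)
    rw [h1]
    exact continuous_const.add (continuous_primitive_nnreal fun t =>
      (h.intervalIntegrable_momentum _ t).sub (h.intervalIntegrable_momentum _ t))
  · simp only [stretch, dif_neg hx]
    exact continuous_const

/-- Bulk sites and the right end in one formula: at site `n` the force stands in for the absent
stretch `r_{n+1}`. -/
theorem SolvesDynamics.momentum_eq (h : SolvesDynamics γ T n F N w Z) {x : ℕ} (hx : 1 ≤ x)
    (hxn : x ≤ n) (t : ℝ≥0) : momentum (Z t) x = momentum (Z 0) x +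
      (∫ s in (0 : ℝ)..t, ((if x = n then F s else stretch (Z s.toNNReal) (x + 1)) -
        stretch (Z s.toNNReal) x)) -
      2 * jumpIntegral (fun s => momentum (Z s) x) (fun s => N x (γ * s)) t := by
  rcases eq_or_lt_of_le hxn with rfl | hlt
  · simpa only [if_true] using h.momentum_right t
  · simpa only [hlt.ne, if_false] using h.momentum_bulk x hx hlt t

theorem SolvesDynamics.continuousAt_momentum (h : SolvesDynamics γ T n F N w Z) {x : ℕ}
    (hx : 1 ≤ x) (hxn : x ≤ n) (hF : Continuous F) (hN : IsCountingPath (N x)) {t : ℝ≥0}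
    (ht : 0 < t → ∃ r < γ * t, N x r = N x (γ * t)) (hγ : 0 < γ) :
    ContinuousAt (fun s => momentum (Z s) x) t := by
  have h1 : (fun s => momentum (Z s) x) = _ := funext (h.momentum_eq hx hxn)
  rw [h1]
  refine ContinuousAt.sub (continuous_const.add (continuous_primitive_nnreal fun t => ?_)).continuousAt
    (continuousAt_const.mul ((hN.comp_mul γ).continuousAt_jumpIntegral _ fun h0 => ?_))
  · refine IntervalIntegrable.sub ?_ (h.intervalIntegrable_stretch _ t)
    split_ifs
    · exact hF.intervalIntegrable _ _
    · exact h.intervalIntegrable_stretch _ t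
  · obtain ⟨r, hr, hrt⟩ := ht h0
    refine ⟨r / γ, ?_, ?_⟩
    · rwa [div_lt_iff₀' hγ]
    · rwa [mul_div_cancel₀ _ hγ.ne']

theorem SolvesDynamics.continuous_momentum_left (h : SolvesDynamics γ T n F N w Z) :
    Continuous fun t => momentum (Z t) 0 - √(4 * γ * T) * w t := by
  have h1 : (fun t => momentum (Z t) 0 - √(4 * γ * T) * w t) = fun t : ℝ≥0 =>
      momentum (Z 0) 0 + ∫ s in (0 : ℝ)..t,
        (stretch (Z s.toNNReal) 1 - 2 * γ * momentum (Z s.toNNReal) 0) := by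
    funext t
    rw [h.momentum_left t]
    ring
  rw [h1]
  exact continuous_const.add (continuous_primitive_nnreal fun t =>
    (h.intervalIntegrable_stretch _ t).sub ((h.intervalIntegrable_momentum _ t).const_mul _))

theorem pathBound_mono {q : ℝ} (hq : 1 ≤ q) {σ : ℝ} (hσ : 0 ≤ σ) {ζ : ℝ} (hζ : 0 ≤ ζ)
    (hw : Continuous w) (hF : Continuous F) (hN : ∀ x, 1 ≤ x → x ≤ n → IsCountingPath (N x))
    {s t : ℝ≥0} (hst : s ≤ t) :
    pathBound q γ σ n F N w ζ s ≤ pathBound q γ σ n F N w ζ t := by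
  unfold pathBound
  have h1 : (s : ℝ) ≤ t := by exact_mod_cast hst
  have h2 : ∑ x ∈ Finset.range n, N (x + 1) (γ * s) ≤ ∑ x ∈ Finset.range n, N (x + 1) (γ * t) :=
    Finset.sum_le_sum fun x hx =>
      (hN (x + 1) (by omega) (by have := Finset.mem_range.1 hx; omega)).mono (by gcongr)
  have h3 : ∀ u : ℝ, 0 ≤ (2 + 2 * γ) * (σ * |w u.toNNReal|) + |F u| := fun u => by positivity
  have h4 : (∫ u in (0 : ℝ)..s, ((2 + 2 * γ) * (σ * |w u.toNNReal|) + |F u|)) ≤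
      ∫ u in (0 : ℝ)..t, ((2 + 2 * γ) * (σ * |w u.toNNReal|) + |F u|) := by
    apply intervalIntegral.integral_mono_interval le_rfl s.coe_nonneg h1 (Eventually.of_forall h3)
    apply Continuous.intervalIntegrable
    have := hw.comp continuous_real_toNNReal
    fun_prop
  have h5 : 0 ≤ ∫ u in (0 : ℝ)..s, ((2 + 2 * γ) * (σ * |w u.toNNReal|) + |F u|) :=
    intervalIntegral.integral_nonneg s.coe_nonneg fun u _ => h3 u
  gcongr

end Path

/-! ### Integrability of the bounds -/

section Input

variable {Ω : Type*} [MeasurableSpace Ω] {P : Measure Ω} [IsProbabilityMeasure P] {n : ℕ}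
  {N : ℕ → ℝ≥0 → Ω → ℕ} {w : ℝ≥0 → Ω → ℝ} {X₀ : Ω → Config n}

/-- The number of jumps of the first `n` Poisson processes. -/
def jumpCount (n : ℕ) (N : ℕ → ℝ≥0 → ℕ) (t : ℝ≥0) : ℕ := ∑ x ∈ Finset.range n, N (x + 1) t

omit [IsProbabilityMeasure P] in
theorem IsRandomInput.measurable_jumpCount (h : IsRandomInput P n N w X₀) (t : ℝ≥0) :
    Measurable fun ω => jumpCount n (fun x s => N x s ω) t :=
  Finset.measurable_sum _ fun x hx =>
    (h.poisson (x + 1) (by omega) (by have := Finset.mem_range.1 hx; omega)).measurable t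

omit [IsProbabilityMeasure P] in
-- No joint law of the clocks is needed: if clock `y` has the largest count, the total is at most
-- `n` times that count, so the power is at most `(q^n)^{N_y}`, which the sum over all clocks
-- dominates.
theorem IsRandomInput.integrable_pow_jumpCount (h : IsRandomInput P n N w X₀) (hn : 1 ≤ n)
    {q : ℝ} (hq : 1 ≤ q) (t : ℝ≥0) :
    Integrable (fun ω => q ^ jumpCount n (fun x s => N x s ω) t) P := by
  have hsum : Integrable (fun ω => ∑ x ∈ Finset.range n, (q ^ n) ^ N (x + 1) t ω) P :=
    integrable_finsetSum _ fun x hx =>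
      (h.poisson (x + 1) (by omega) (by have := Finset.mem_range.1 hx; omega)).integrable_pow t _
  refine hsum.mono' ?_ (Eventually.of_forall fun ω => ?_)
  · exact (measurable_from_top.comp (h.measurable_jumpCount t)).aestronglyMeasurable
      (f := fun ω => q ^ jumpCount n (fun x s => N x s ω) t)
  · rw [Real.norm_of_nonneg (by positivity)]
    obtain ⟨y, hy, hmax⟩ := Finset.exists_max_image (Finset.range n)
      (fun x => N (x + 1) t ω) ⟨0, Finset.mem_range.2 hn⟩
    have h1 : jumpCount n (fun x s => N x s ω) t ≤ n * N (y + 1) t ω := by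
      have := Finset.sum_le_card_nsmul (Finset.range n) (fun x => N (x + 1) t ω)
        (N (y + 1) t ω) hmax
      rwa [Finset.card_range, smul_eq_mul] at this
    calc q ^ jumpCount n (fun x s => N x s ω) t ≤ q ^ (n * N (y + 1) t ω) :=
          pow_le_pow_right₀ hq h1
      _ = (q ^ n) ^ N (y + 1) t ω := pow_mul _ _ _
      _ ≤ _ := Finset.single_le_sum (f := fun x => (q ^ n) ^ N (x + 1) t ω)
          (fun _ _ => by positivity) hy

/-- The number of jumps as a measurable function of the paths of the Poisson processes. -/
theorem exists_jumpCount_eq (n : ℕ) (t : ℝ≥0) : ∃ g : (Set.Icc 1 n → ℝ≥0 → ℕ) → ℕ,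
    Measurable g ∧ ∀ N : ℕ → ℝ≥0 → ℕ, g (fun x s => N x s) = jumpCount n N t := by
  refine ⟨fun p => ∑ x : Finset.range n,
    p ⟨x + 1, by omega, by have := Finset.mem_range.1 x.2; omega⟩ t, ?_, fun N => ?_⟩
  · exact Finset.measurable_sum _ fun x _ =>
      (measurable_pi_apply t).comp (measurable_pi_apply _)
  · exact Finset.sum_coe_sort (Finset.range n) fun x => N (x + 1) t

omit [IsProbabilityMeasure P] in
theorem IsRandomInput.indepFun_init_jumpCount (h : IsRandomInput P n N w X₀) (t : ℝ≥0) :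
    IndepFun X₀ (fun ω => jumpCount n (fun x s => N x s ω) t) P := by
  obtain ⟨g, hg, hgN⟩ := exists_jumpCount_eq n t
  have := h.indep_init.comp measurable_id (hg.comp measurable_snd)
  refine this.congr .rfl (Eventually.of_forall fun ω => ?_)
  exact hgN fun x s => N x s ω

omit [IsProbabilityMeasure P] in
theorem IsRandomInput.indepFun_wiener_jumpCount (h : IsRandomInput P n N w X₀) (s t : ℝ≥0) :
    IndepFun (w s) (fun ω => jumpCount n (fun x s => N x s ω) t) P := by
  obtain ⟨g, hg, hgN⟩ := exists_jumpCount_eq n t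
  have := h.indep_wiener.comp (measurable_pi_apply s) hg
  refine this.congr .rfl (Eventually.of_forall fun ω => ?_)
  exact hgN fun x s => N x s ω

theorem integral_abs_brownian_le {w : ℝ≥0 → Ω → ℝ} (hw : IsBrownianReal w P) (s : ℝ≥0) :
    ∫ ω, |w s ω| ∂P ≤ 1 + s := by
  have hlaw := hw.toIsPreBrownianReal.hasLaw_eval s
  have hL2 : MemLp (w s) 2 P := hlaw.hasGaussianLaw.memLp_two
  have h1 : ∫ ω, w s ω ^ 2 ∂P = s := by
    rw [← variance_of_integral_eq_zero hlaw.aemeasurable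
      (hw.toIsPreBrownianReal.integral_eval s), hlaw.variance_eq, variance_id_gaussianReal]
  have hsq : Integrable (fun ω => w s ω ^ 2) P := hL2.integrable_sq
  calc ∫ ω, |w s ω| ∂P ≤ ∫ ω, (1 + w s ω ^ 2) ∂P := by
        refine integral_mono (hw.toIsPreBrownianReal.integrable_eval s).abs
          ((integrable_const 1).add hsq) fun ω => ?_
        show |w s ω| ≤ 1 + w s ω ^ 2
        nlinarith [sq_nonneg (|w s ω| - 1), sq_abs (w s ω), abs_nonneg (w s ω)]
    _ = 1 + s := by
        rw [integral_add (integrable_const 1) hsq, h1]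
        simp

omit [IsProbabilityMeasure P] in
theorem ae_continuous_wiener {w : ℝ≥0 → Ω → ℝ} (hw : IsBrownianReal w P) :
    ∀ᵐ ω ∂P, Continuous (fun t => w t ω) := hw.cont

/-- The noise, weighted by an exponential of the number of jumps, is integrable. -/
theorem IsRandomInput.jointIntegrable_wiener (h : IsRandomInput P n N w X₀) (hn : 1 ≤ n)
    {q : ℝ} (hq : 1 ≤ q) (u t : ℝ≥0) :
    JointIntegrable P (fun s ω => q ^ jumpCount n (fun x s => N x s ω) u * w s ω) t := by
  have hmq : Measurable fun ω => q ^ jumpCount n (fun x s => N x s ω) u :=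
    measurable_from_top.comp (h.measurable_jumpCount u)
  have hm := aestronglyMeasurable_prod_of_rightCont (P := P)
    (f := fun s ω => q ^ jumpCount n (fun x s => N x s ω) u * w s ω)
    (fun t => hmq.mul (h.wiener_measurable t))
    (by
      filter_upwards [ae_continuous_wiener h.wiener] with ω hω t
      exact (continuous_const.mul hω).continuousWithinAt) (volume.restrict (Ioc 0 (t : ℝ)))
  have hind : ∀ s, IndepFun (fun ω => q ^ jumpCount n (fun x s => N x s ω) u) (w s) P := fun s =>
    ((h.indepFun_wiener_jumpCount s u).comp measurable_id
      (measurable_from_top (f := fun k : ℕ => q ^ k))).symm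
  have hqi := h.integrable_pow_jumpCount hn hq u
  have hwi : ∀ s, Integrable (w s) P := h.wiener.toIsPreBrownianReal.integrable_eval
  rw [JointIntegrable, integrable_prod_iff' hm]
  refine ⟨Eventually.of_forall fun s => (hind s.toNNReal).integrable_mul hqi (hwi _), ?_⟩
  -- At a fixed time, independence of `w s` and the jump count factorises the mean, and `E|w s| ≤ 1
  -- + s` keeps it bounded on the interval.
  have hb : ∀ s ∈ Ioc 0 (t : ℝ), ‖∫ ω, ‖q ^ jumpCount n (fun x s => N x s ω) u *
      w s.toNNReal ω‖ ∂P‖ ≤ (∫ ω, q ^ jumpCount n (fun x s => N x s ω) u ∂P) * (1 + t) := by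
    intro s hs
    rw [Real.norm_of_nonneg (integral_nonneg fun _ => norm_nonneg _)]
    have h1 := ((hind s.toNNReal).comp measurable_id measurable_norm).integral_mul_eq_mul_integral
      hmq.aestronglyMeasurable (hwi s.toNNReal).norm.aestronglyMeasurable
    have h2 : ∫ ω, ‖q ^ jumpCount n (fun x s => N x s ω) u * w s.toNNReal ω‖ ∂P =
        (∫ ω, q ^ jumpCount n (fun x s => N x s ω) u ∂P) * ∫ ω, |w s.toNNReal ω| ∂P := by
      refine Eq.trans (integral_congr_ae (Eventually.of_forall fun ω => ?_)) h1
      simp only [Pi.mul_apply, Function.comp, id, norm_mul]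
      rw [Real.norm_of_nonneg (by positivity : 0 ≤ q ^ jumpCount n (fun x s => N x s ω) u)]
    rw [h2]
    refine mul_le_mul_of_nonneg_left ((integral_abs_brownian_le h.wiener _).trans ?_)
      (integral_nonneg fun ω => by positivity)
    rw [Real.coe_toNNReal _ hs.1.le]
    linarith [hs.2]
  refine (integrable_const ((∫ ω, q ^ jumpCount n (fun x s => N x s ω) u ∂P) * (1 + t))).mono'
    (hm.norm.prod_swap.integral_prod_right') ?_
  filter_upwards [ae_restrict_mem measurableSet_Ioc] with s hs
  exact hb s hs

/-- Expanded, the bound is a power of the jump count times a constant, `‖X₀‖` or `∫ |w|`; the count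
is independent of the last two. -/
theorem IsRandomInput.integrable_pathBound (h : IsRandomInput P n N w X₀) (hn : 1 ≤ n)
    (hX₀ : Integrable X₀ P) {F : ℝ → ℝ} (hF : Continuous F) {q : ℝ} (hq : 1 ≤ q) (γ : ℝ≥0) (σ : ℝ)
    (t : ℝ≥0) : Integrable (fun ω =>
      pathBound q γ σ n F (fun x s => N x s ω) (fun s => w s ω) ‖X₀ ω‖ t) P := by
  have hqi := h.integrable_pow_jumpCount hn hq (γ * t)
  have h1 : Integrable (fun ω => q ^ jumpCount n (fun x s => N x s ω) (γ * t) * ‖X₀ ω‖) P :=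
    ((h.indepFun_init_jumpCount (γ * t)).comp measurable_norm
      (measurable_from_top (f := fun k : ℕ => q ^ k))).symm.integrable_mul hqi hX₀.norm
  have h2 : Integrable (fun ω => ∫ s in (0 : ℝ)..t,
      |q ^ jumpCount n (fun x s => N x s ω) (γ * t) * w s.toNNReal ω|) P := by
    simp_rw [intervalIntegral.integral_of_le t.coe_nonneg]
    exact Integrable.integral_prod_left (h.jointIntegrable_wiener hn hq (γ * t) t).abs
  refine (((h1.add ((h2.const_mul ((2 + 2 * γ) * σ)).add
    (hqi.mul_const (∫ s in (0 : ℝ)..t, |F s|)))).add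
    (hqi.mul_const ((2 + 2 * γ) * t))).const_mul (Real.exp ((2 + 2 * γ) * t))).congr ?_
  filter_upwards [ae_continuous_wiener h.wiener] with ω hω
  have hω' : Continuous fun s : ℝ => w s.toNNReal ω := hω.comp continuous_real_toNNReal
  have h3 : (∫ s in (0 : ℝ)..t, ((2 + 2 * γ) * (σ * |w s.toNNReal ω|) + |F s|)) =
      (2 + 2 * γ) * σ * (∫ s in (0 : ℝ)..t, |w s.toNNReal ω|) + ∫ s in (0 : ℝ)..t, |F s| := by
    rw [intervalIntegral.integral_add (Continuous.intervalIntegrable (by fun_prop) _ _)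
      (Continuous.intervalIntegrable (by fun_prop) _ _), ← intervalIntegral.integral_const_mul]
    simp_rw [mul_assoc]
  have h4 : (∫ s in (0 : ℝ)..t,
      |q ^ jumpCount n (fun x s => N x s ω) (γ * t) * w s.toNNReal ω|) =
      q ^ jumpCount n (fun x s => N x s ω) (γ * t) * ∫ s in (0 : ℝ)..t, |w s.toNNReal ω| := by
    rw [← intervalIntegral.integral_const_mul]
    simp_rw [abs_mul]
    rw [abs_of_nonneg (by positivity : 0 ≤ q ^ jumpCount n (fun x s => N x s ω) (γ * t))]
  simp only [Pi.add_apply]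
  rw [pathBound, h3, h4]
  simp only [jumpCount]
  ring

end Input

end HarmonicChain

namespace HarmonicChain

/-! ### The equations for the averages -/

section Chain

variable {Ω : Type*} [MeasurableSpace Ω] {P : Measure Ω} [IsProbabilityMeasure P]
  {γ : ℝ≥0} {T : ℝ} {n : ℕ} {F : ℝ → ℝ} {N : ℕ → ℝ≥0 → Ω → ℕ} {w : ℝ≥0 → Ω → ℝ}
  {X : ℝ≥0 → Ω → Config n}

/-- The random bound for the paths of the chain. -/
noncomputable def chainBound (q : ℝ) (γ : ℝ≥0) (T : ℝ) (F : ℝ → ℝ) (N : ℕ → ℝ≥0 → Ω → ℕ)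
    (w : ℝ≥0 → Ω → ℝ) (X : ℝ≥0 → Ω → Config n) (t : ℝ≥0) (ω : Ω) : ℝ :=
  pathBound q γ √(4 * γ * T) n F (fun x s => N x s ω) (fun s => w s ω) ‖X 0 ω‖ t

/-- The momenta of the chain, with the Wiener noise subtracted from the one of particle `0`. -/
noncomputable def pureMomentum (γ : ℝ≥0) (T : ℝ) (w : ℝ≥0 → Ω → ℝ) (X : ℝ≥0 → Ω → Config n)
    (x : ℕ) (t : ℝ≥0) (ω : Ω) : ℝ :=
  momentum (X t ω) x - if x = 0 then √(4 * γ * T) * w t ω else 0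

namespace IsChainProcess

section

variable (h : IsChainProcess P γ T n F N w X)
include h

omit [IsProbabilityMeasure P] in
theorem ae_path : ∀ᵐ ω ∂P,
    SolvesDynamics γ T n F (fun x t => N x t ω) (fun t => w t ω) (fun t => X t ω) ∧
    Continuous (fun t => w t ω) ∧ w 0 ω = 0 ∧
    ∀ x, 1 ≤ x → x ≤ n → IsCountingPath (fun t => N x t ω) := by
  have h1 : ∀ᵐ ω ∂P, ∀ x, 1 ≤ x → x ≤ n → IsCountingPath (fun t => N x t ω) := by
    refine ae_all_iff.2 fun x => ?_
    by_cases hx : 1 ≤ x ∧ x ≤ n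
    · filter_upwards [(h.input.poisson x hx.1 hx.2).ae_isCountingPath] with ω hω _ _ using hω
    · exact Eventually.of_forall fun ω h1 h2 => absurd ⟨h1, h2⟩ hx
  filter_upwards [h.dynamics, ae_continuous_wiener h.input.wiener,
    h.input.wiener.toIsPreBrownianReal.eval_zero_ae_eq_zero, h1] with ω h2 h3 h4 h5
  exact ⟨h2, h3, h4, h5⟩

omit [IsProbabilityMeasure P] in
theorem ae_bound (hF : Continuous F) : ∀ᵐ ω ∂P, ∀ t, ∀ s ≤ t, ∀ x,
    |stretch (X s ω) x| ≤ chainBound 3 γ T F N w X t ω ∧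
    |pureMomentum γ T w X x s ω| ≤ chainBound 3 γ T F N w X t ω := by
  filter_upwards [h.ae_path] with ω ⟨hd, hw, hw0, hN⟩ t s hst x
  have hb := (hd.norm_denoised_le hw hw0 hF hN s).trans
    (pathBound_mono (by norm_num) (Real.sqrt_nonneg _) (norm_nonneg _) hw hF hN hst)
  have h0 := (norm_nonneg _).trans hb
  constructor
  · by_cases hx : 1 ≤ x ∧ x ≤ n
    · have h1 := norm_le_pi_norm (denoised √(4 * γ * T) (fun t => w t ω) (fun t => X t ω) s)
        (Sum.inl ⟨x - 1, by omega⟩)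
      simp only [denoised, Sum.elim_inl, Nat.sub_add_cancel hx.1, Real.norm_eq_abs] at h1
      exact h1.trans hb
    · rw [stretch, dif_neg hx, abs_zero]
      exact h0
  · by_cases hx : x ≤ n
    · have h1 := norm_le_pi_norm (denoised √(4 * γ * T) (fun t => w t ω) (fun t => X t ω) s)
        (Sum.inr ⟨x, by omega⟩)
      exact h1.trans hb
    · rw [pureMomentum, momentum, dif_neg hx, if_neg (by omega), sub_zero, abs_zero]
      exact h0

omit [IsProbabilityMeasure P] in
theorem measurable_stretch (x : ℕ) (t : ℝ≥0) : Measurable fun ω => stretch (X t ω) x :=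
  (continuous_stretch x).measurable.comp (h.measurable t)

omit [IsProbabilityMeasure P] in
theorem measurable_momentum (x : ℕ) (t : ℝ≥0) : Measurable fun ω => momentum (X t ω) x :=
  (continuous_momentum x).measurable.comp (h.measurable t)

omit [IsProbabilityMeasure P] in
theorem measurable_pureMomentum (x : ℕ) (t : ℝ≥0) : Measurable (pureMomentum γ T w X x t) := by
  refine (h.measurable_momentum x t).sub ?_
  split_ifs
  · exact measurable_const.mul (h.input.wiener_measurable t)
  · exact measurable_const

theorem integrable_chainBound (hn : 1 ≤ n) (hF : Continuous F) (hInt : Integrable (X 0) P) {q : ℝ}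
    (hq : 1 ≤ q) (t : ℝ≥0) : Integrable (chainBound q γ T F N w X t) P :=
  h.input.integrable_pathBound hn hInt hF hq γ _ t

theorem integrable_stretch (hn : 1 ≤ n) (hF : Continuous F) (hInt : Integrable (X 0) P) (x : ℕ)
    (t : ℝ≥0) : Integrable (fun ω => stretch (X t ω) x) P := by
  refine (h.integrable_chainBound hn hF hInt (by norm_num : (1 : ℝ) ≤ 3) t).mono'
    (h.measurable_stretch x t).aestronglyMeasurable ?_
  filter_upwards [h.ae_bound hF] with ω hω using (hω t t le_rfl x).1

theorem integrable_pureMomentum (hn : 1 ≤ n) (hF : Continuous F) (hInt : Integrable (X 0) P)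
    (x : ℕ) (t : ℝ≥0) : Integrable (pureMomentum γ T w X x t) P := by
  refine (h.integrable_chainBound hn hF hInt (by norm_num : (1 : ℝ) ≤ 3) t).mono'
    (h.measurable_pureMomentum x t).aestronglyMeasurable ?_
  filter_upwards [h.ae_bound hF] with ω hω using (hω t t le_rfl x).2

omit [IsProbabilityMeasure P] in
theorem integrable_noise (x : ℕ) (t : ℝ≥0) :
    Integrable (fun ω => if x = 0 then √(4 * γ * T) * w t ω else 0) P := by
  split_ifs
  · exact (h.input.wiener.toIsPreBrownianReal.integrable_eval t).const_mul _
  · exact integrable_zero _ _ _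

omit [IsProbabilityMeasure P] in
theorem integral_noise (x : ℕ) (t : ℝ≥0) :
    ∫ ω, (if x = 0 then √(4 * γ * T) * w t ω else 0) ∂P = 0 := by
  split_ifs
  · rw [integral_const_mul, h.input.wiener.toIsPreBrownianReal.integral_eval, mul_zero]
  · exact integral_zero _ _

theorem integrable_momentum (hn : 1 ≤ n) (hF : Continuous F) (hInt : Integrable (X 0) P) (x : ℕ)
    (t : ℝ≥0) : Integrable (fun ω => momentum (X t ω) x) P := by
  refine ((h.integrable_pureMomentum hn hF hInt x t).add (h.integrable_noise x t)).congr
    (Eventually.of_forall fun ω => ?_)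
  simp [pureMomentum]

theorem integrable (hn : 1 ≤ n) (hF : Continuous F) (hInt : Integrable (X 0) P) (t : ℝ≥0) :
    Integrable (X t) P := by
  refine (integrable_finsetSum (Finset.range (n + 1)) (f := fun x ω =>
    |stretch (X t ω) x| + |momentum (X t ω) x|) fun x _ =>
    (h.integrable_stretch hn hF hInt x t).abs.add (h.integrable_momentum hn hF hInt x t).abs).mono'
    (h.measurable t).aestronglyMeasurable (Eventually.of_forall fun ω => norm_le_sum_abs _)

theorem meanMomentum_eq (hn : 1 ≤ n) (hF : Continuous F) (hInt : Integrable (X 0) P) (x : ℕ)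
    (t : ℝ≥0) : meanMomentum P X t x = ∫ ω, pureMomentum γ T w X x t ω ∂P := by
  simp only [pureMomentum]
  rw [integral_sub (h.integrable_momentum hn hF hInt x t) (h.integrable_noise x t),
    h.integral_noise, sub_zero]
  rfl

theorem continuous_meanStretch (hn : 1 ≤ n) (hF : Continuous F) (hInt : Integrable (X 0) P)
    (x : ℕ) : Continuous fun t => meanStretch P X t x := by
  refine continuous_iff_continuousAt.2 fun t => ?_
  refine continuousAt_of_dominated (bound := chainBound 3 γ T F N w X (t + 1))
    (Eventually.of_forall fun s => (h.measurable_stretch x s).aestronglyMeasurable) ?_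
    (h.integrable_chainBound hn hF hInt (by norm_num) _) ?_
  · filter_upwards [Iio_mem_nhds (show t < t + 1 from lt_add_one t)] with s hs
    filter_upwards [h.ae_bound hF] with ω hω using (hω (t + 1) s (show s < t + 1 from hs).le x).1
  · filter_upwards [h.ae_path] with ω hω
    exact (hω.1.continuous_stretch_path x).continuousAt

/-- The paths jump, but almost surely not at a given time, so dominated convergence applies at each
time. For particle `0` the noise is first subtracted, which does not change the mean. -/
theorem continuous_meanMomentum (hγ : 0 < γ) (hn : 1 ≤ n) (hF : Continuous F)
    (hInt : Integrable (X 0) P) (x : ℕ) : Continuous fun t => meanMomentum P X t x := by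
  refine continuous_iff_continuousAt.2 fun t => ?_
  simp_rw [h.meanMomentum_eq hn hF hInt]
  refine continuousAt_of_dominated (bound := chainBound 3 γ T F N w X (t + 1))
    (Eventually.of_forall fun s => (h.measurable_pureMomentum x s).aestronglyMeasurable) ?_
    (h.integrable_chainBound hn hF hInt (by norm_num) _) ?_
  · filter_upwards [Iio_mem_nhds (show t < t + 1 from lt_add_one t)] with s hs
    filter_upwards [h.ae_bound hF] with ω hω using (hω (t + 1) s (show s < t + 1 from hs).le x).2
  · by_cases hx0 : x = 0
    · filter_upwards [h.ae_path] with ω hω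
      simp only [pureMomentum, hx0, if_true]
      exact hω.1.continuous_momentum_left.continuousAt
    by_cases hxn : x ≤ n
    · have hx1 : 1 ≤ x := by omega
      have hjump : ∀ᵐ ω ∂P, 0 < t → ∃ r < γ * t, N x r ω = N x (γ * t) ω := by
        by_cases ht : 0 < t
        · filter_upwards [(h.input.poisson x hx1 hxn).ae_exists_lt_eq (mul_pos hγ ht)] with ω hω _
            using hω
        · exact Eventually.of_forall fun ω h0 => absurd h0 ht
      filter_upwards [h.ae_path, hjump] with ω hω hj
      simp only [pureMomentum, hx0, if_false, sub_zero]
      exact hω.1.continuousAt_momentum hx1 hxn hF (hω.2.2.2 x hx1 hxn) hj hγ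
    · refine Eventually.of_forall fun ω => ?_
      simp only [pureMomentum, hx0, if_false, sub_zero, momentum, dif_neg hxn]
      exact continuousAt_const

theorem jointIntegrable_stretch (hn : 1 ≤ n) (hF : Continuous F) (hInt : Integrable (X 0) P)
    (x : ℕ) (t : ℝ≥0) : JointIntegrable P (fun s ω => stretch (X s ω) x) t := by
  refine JointIntegrable.of_dominated (h.measurable_stretch x) ?_
    (h.integrable_chainBound hn hF hInt (by norm_num : (1 : ℝ) ≤ 3) t) ?_
  · filter_upwards [h.ae_path] with ω hω using hω.1.rightCont_stretch x
  · filter_upwards [h.ae_bound hF] with ω hω s hs using (hω t s hs x).1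

theorem jointIntegrable_momentum (hn : 1 ≤ n) (hF : Continuous F) (hInt : Integrable (X 0) P)
    (x : ℕ) (t : ℝ≥0) : JointIntegrable P (fun s ω => momentum (X s ω) x) t := by
  have h1 : JointIntegrable P (pureMomentum γ T w X x) t := by
    refine JointIntegrable.of_dominated (h.measurable_pureMomentum x) ?_
      (h.integrable_chainBound hn hF hInt (by norm_num : (1 : ℝ) ≤ 3) t) ?_
    · filter_upwards [h.ae_path] with ω hω s
      refine (hω.1.rightCont_momentum x s).sub ?_
      split_ifs
      · exact (continuous_const.mul hω.2.1).continuousWithinAt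
      · exact continuousWithinAt_const
    · filter_upwards [h.ae_bound hF] with ω hω s hs using (hω t s hs x).2
  by_cases hx : x = 0
  · have h2 := (h.input.jointIntegrable_wiener hn le_rfl 0 t).const_mul √(4 * γ * T)
    have h3 := h1.add h2
    simp only [one_pow, one_mul, pureMomentum, hx, if_true, sub_add_cancel] at h3
    rw [hx]
    exact h3
  · have e : pureMomentum γ T w X x = fun s ω => momentum (X s ω) x := by
      funext s ω
      simp only [pureMomentum, hx, if_false, sub_zero]
    rwa [e] at h1

/-- The compensation formula for the jumps. -/
theorem integral_jumpIntegral (hγ : 0 < γ) (hn : 1 ≤ n) (hF : Continuous F)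
    (hInt : Integrable (X 0) P) {x : ℕ} (hx : 1 ≤ x) (hxn : x ≤ n) (t : ℝ≥0) :
    ∫ ω, jumpIntegral (fun s => momentum (X s ω) x) (fun s => N x (γ * s) ω) t ∂P =
      γ * ∫ s in (0 : ℝ)..t, meanMomentum P X s.toNNReal x := by
  have hx0 : x ≠ 0 := by omega
  have hPois := h.input.poisson x hx hxn
  have hgridle : ∀ m k : ℕ, (k : ℝ≥0) * t / m ≤ (k + 1 : ℕ) * t / m := fun m k => by
    gcongr
    exact Nat.le_succ k
  have hgridt : ∀ m k : ℕ, k < m → ((k + 1 : ℕ) : ℝ≥0) * t / m ≤ t := fun m k hk => by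
    have hm : (0 : ℝ≥0) < m := by exact_mod_cast (by omega : 0 < m)
    rw [div_le_iff₀ hm, mul_comm]
    gcongr
    exact_mod_cast hk
  set S : ℕ → Ω → ℝ := fun m ω => ∑ k ∈ Finset.range m, momentum (X (k * t / m) ω) x *
    ((N x (γ * ((k + 1 : ℕ) * t / m)) ω : ℝ) - N x (γ * (k * t / m)) ω) with hS
  have hmeasN : ∀ s, Measurable fun ω => (N x s ω : ℝ) := fun s =>
    measurable_from_top.comp (hPois.measurable s)
  have hNle : ∀ᵐ ω ∂P, ∀ m k : ℕ,
      0 ≤ (N x (γ * ((k + 1 : ℕ) * t / m)) ω : ℝ) - N x (γ * (k * t / m)) ω := by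
    filter_upwards [hPois.mono] with ω hω m k
    rw [sub_nonneg, Nat.cast_le]
    exact hω (mul_le_mul_right (hgridle m k) γ)
  have hpb : ∀ᵐ ω ∂P, ∀ s ≤ t, |momentum (X s ω) x| ≤ chainBound 3 γ T F N w X t ω := by
    filter_upwards [h.ae_bound hF] with ω hω s hs
    simpa only [pureMomentum, hx0, if_false, sub_zero] using (hω t s hs x).2
  -- The grid sums are bounded by the path bound times the number of jumps of the clock. A number is
  -- at most `3` to its power, so raising the base from `3` to `9` gives one integrable bound for
  -- all meshes.
  have hB9 : ∀ᵐ ω ∂P, chainBound 3 γ T F N w X t ω * N x (γ * t) ω ≤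
      chainBound 9 γ T F N w X t ω := by
    filter_upwards [h.ae_path] with ω hω
    have hq : (N x (γ * t) ω : ℝ) ≤ 3 ^ (∑ y ∈ Finset.range n, N (y + 1) (γ * t) ω) := by
      have h1 : N x (γ * t) ω ≤ ∑ y ∈ Finset.range n, N (y + 1) (γ * t) ω := by
        have := Finset.single_le_sum (f := fun y => N (y + 1) (γ * t) ω) (fun _ _ => zero_le)
          (Finset.mem_range.2 (by omega : x - 1 < n))
        simpa only [Nat.sub_add_cancel hx] using this
      have h2 : N x (γ * t) ω ≤ 3 ^ (∑ y ∈ Finset.range n, N (y + 1) (γ * t) ω) :=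
        h1.trans (Nat.lt_pow_self (by norm_num)).le
      exact_mod_cast h2
    have hint : 0 ≤ ∫ s in (0 : ℝ)..t,
        ((2 + 2 * γ) * (√(4 * γ * T) * |w s.toNNReal ω|) + |F s|) :=
      intervalIntegral.integral_nonneg t.coe_nonneg fun u _ => by positivity
    rw [chainBound, chainBound, pathBound, pathBound]
    have h9 : (9 : ℝ) ^ (∑ y ∈ Finset.range n, N (y + 1) (γ * t) ω) =
        3 ^ (∑ y ∈ Finset.range n, N (y + 1) (γ * t) ω) *
        3 ^ (∑ y ∈ Finset.range n, N (y + 1) (γ * t) ω) := by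
      rw [← mul_pow]
      norm_num
    rw [h9]
    refine le_trans (mul_le_mul_of_nonneg_left hq (by positivity)) (le_of_eq ?_)
    ring
  have hterm : ∀ᵐ ω ∂P, ∀ m : ℕ, ∀ k < m, |momentum (X (k * t / m) ω) x *
      ((N x (γ * ((k + 1 : ℕ) * t / m)) ω : ℝ) - N x (γ * (k * t / m)) ω)| ≤
      chainBound 3 γ T F N w X t ω *
        ((N x (γ * ((k + 1 : ℕ) * t / m)) ω : ℝ) - N x (γ * (k * t / m)) ω) := by
    filter_upwards [hNle, hpb] with ω h1 h2 m k hk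
    rw [abs_mul, abs_of_nonneg (h1 m k)]
    exact mul_le_mul_of_nonneg_right (h2 _ ((hgridle m k).trans (hgridt m k hk))) (h1 m k)
  have hsumle : ∀ᵐ ω ∂P, ∀ m : ℕ, ∑ k ∈ Finset.range m, chainBound 3 γ T F N w X t ω *
      ((N x (γ * ((k + 1 : ℕ) * t / m)) ω : ℝ) - N x (γ * (k * t / m)) ω) ≤
      chainBound 9 γ T F N w X t ω := by
    filter_upwards [hB9, hpb, hPois.mono] with ω h1 h2 h3 m
    have h0 : 0 ≤ chainBound 3 γ T F N w X t ω := (abs_nonneg _).trans (h2 t le_rfl)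
    refine le_trans ?_ h1
    rw [← Finset.mul_sum, Finset.sum_range_sub (fun k => (N x (γ * (k * t / m)) ω : ℝ))]
    refine mul_le_mul_of_nonneg_left ?_ h0
    have h4 : (N x (γ * ((m : ℕ) * t / m)) ω : ℝ) ≤ N x (γ * t) ω := by
      rw [Nat.cast_le]
      refine h3 (mul_le_mul_right ?_ γ)
      rcases Nat.eq_zero_or_pos m with rfl | hm
      · simp
      · rw [mul_div_cancel_left₀]
        exact_mod_cast hm.ne'
    have h5 : (0 : ℝ) ≤ (N x (γ * ((0 : ℕ) * t / m)) ω : ℝ) := Nat.cast_nonneg _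
    linarith
  have hSmeas : ∀ m k : ℕ, Measurable fun ω => momentum (X (k * t / m) ω) x *
      ((N x (γ * ((k + 1 : ℕ) * t / m)) ω : ℝ) - N x (γ * (k * t / m)) ω) := fun m k =>
    (h.measurable_momentum x _).mul ((hmeasN _).sub (hmeasN _))
  have hI9 := h.integrable_chainBound hn hF hInt (by norm_num : (1 : ℝ) ≤ 9) t
  have hlim : Tendsto (fun m => ∫ ω, S m ω ∂P) atTop (𝓝 (∫ ω, jumpIntegral
      (fun s => momentum (X s ω) x) (fun s => N x (γ * s) ω) t ∂P)) := by
    refine tendsto_integral_of_dominated_convergence (chainBound 9 γ T F N w X t)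
      (fun m => ?_) hI9 (fun m => ?_) ?_
    · exact (Finset.measurable_sum _ fun k _ => hSmeas m k).aestronglyMeasurable
    · filter_upwards [hterm, hsumle] with ω h1 h2
      exact ((Finset.abs_sum_le_sum_abs _ _).trans (Finset.sum_le_sum fun k hk =>
        h1 m k (Finset.mem_range.1 hk))).trans (h2 m)
    · filter_upwards [h.ae_path] with ω hω
      exact ((hω.2.2.2 x hx hxn).comp_mul γ).tendsto_grid_sum (hω.1.leftLimit_momentum x) t
  -- Adaptedness enters here: the momentum at the left grid point belongs to the past, so the
  -- Poisson increment contributes its mean `γ` times the mesh.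
  have hES : ∀ m, ∫ ω, S m ω ∂P = γ * ∑ k ∈ Finset.range m, meanMomentum P X (k * t / m) x *
      (((k + 1 : ℕ) * t / m : ℝ≥0) - (k * t / m : ℝ≥0) : ℝ) := by
    intro m
    rw [hS, integral_finsetSum, Finset.mul_sum]
    · refine Finset.sum_congr rfl fun k _ => ?_
      rw [h.input.integral_mul_increment ⟨hx, hxn⟩ (hgridle m k)
        ((continuous_momentum x).comp_aestronglyMeasurable (h.adapted _))]
      rw [meanMomentum]
      ring
    · intro k hk
      refine hI9.mono' (hSmeas m k).aestronglyMeasurable ?_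
      filter_upwards [hterm, hsumle, hNle, hpb] with ω h1 h2 h3 h4
      refine (h1 m k (Finset.mem_range.1 hk)).trans (le_trans ?_ (h2 m))
      have h0 : 0 ≤ chainBound 3 γ T F N w X t ω := (abs_nonneg _).trans (h4 t le_rfl)
      exact Finset.single_le_sum (f := fun k : ℕ => chainBound 3 γ T F N w X t ω *
        ((N x (γ * ((k + 1 : ℕ) * t / m)) ω : ℝ) - N x (γ * (k * t / m)) ω))
        (fun j _ => mul_nonneg h0 (h3 m j)) hk
  simp_rw [hES] at hlim
  exact tendsto_nhds_unique hlim ((tendsto_riemann_nnreal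
    (h.continuous_meanMomentum hγ hn hF hInt x) t).const_mul _)

theorem meanStretch_eq (hn : 1 ≤ n) (hF : Continuous F) (hInt : Integrable (X 0) P) {x : ℕ}
    (hx : 1 ≤ x) (hxn : x ≤ n) (t : ℝ≥0) : meanStretch P X t x = meanStretch P X 0 x +
      ∫ s in (0 : ℝ)..t, (meanMomentum P X s.toNNReal x - meanMomentum P X s.toNNReal (x - 1)) := by
  obtain ⟨h1, h2⟩ := ((h.jointIntegrable_momentum hn hF hInt x t).sub
    (h.jointIntegrable_momentum hn hF hInt (x - 1) t)).integral_integral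
  simp_rw [integral_sub (h.integrable_momentum hn hF hInt x _)
    (h.integrable_momentum hn hF hInt (x - 1) _)] at h2
  simp only [meanMomentum]
  rw [← h2, meanStretch, meanStretch, ← integral_add (h.integrable_stretch hn hF hInt x 0) h1]
  apply integral_congr_ae
  filter_upwards [h.dynamics] with ω hω
  exact hω.stretch_eq x hx hxn t

/-- The damping `2γ` comes from the friction at site `0` and from the compensated flips elsewhere,
so one equation covers all sites; at `x = 0` the stretch vanishes by convention. -/
theorem meanMomentum_eq_add (hγ : 0 < γ) (hn : 1 ≤ n) (hF : Continuous F)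
    (hInt : Integrable (X 0) P) {x : ℕ} (hxn : x ≤ n) (t : ℝ≥0) :
    meanMomentum P X t x = meanMomentum P X 0 x + ∫ s in (0 : ℝ)..t,
      ((if x = n then F s else meanStretch P X s.toNNReal (x + 1)) -
        meanStretch P X s.toNNReal x - 2 * γ * meanMomentum P X s.toNNReal x) := by
  have hiM := h.integrable_momentum hn hF hInt
  have hiS := h.integrable_stretch hn hF hInt
  have hcM := h.continuous_meanMomentum hγ hn hF hInt
  have hcS := h.continuous_meanStretch hn hF hInt
  rcases Nat.eq_zero_or_pos x with rfl | hx
  · obtain ⟨h1, h2⟩ := ((h.jointIntegrable_stretch hn hF hInt 1 t).sub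
      ((h.jointIntegrable_momentum hn hF hInt 0 t).const_mul (2 * γ))).integral_integral
    simp_rw [integral_sub (hiS 1 _) ((hiM 0 _).const_mul (2 * γ)), integral_const_mul] at h2
    have h3 : ∀ s, meanStretch P X s 0 = 0 := fun s => by simp [meanStretch, stretch_zero]
    have hn0 : (0 : ℕ) ≠ n := by omega
    simp only [h3, sub_zero, hn0, if_false, zero_add]
    simp only [meanMomentum, meanStretch]
    rw [← h2, ← integral_add (hiM 0 0) h1]
    have h12 : Integrable (fun ω => momentum (X 0 ω) 0 + ∫ s in (0 : ℝ)..t,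
        (stretch (X s.toNNReal ω) 1 - 2 * γ * momentum (X s.toNNReal ω) 0)) P := (hiM 0 0).add h1
    have h4 := h.input.wiener.toIsPreBrownianReal.integrable_eval t
    have h5 : ∫ ω, √(4 * γ * T) * w t ω ∂P = 0 := by
      rw [integral_const_mul, h.input.wiener.toIsPreBrownianReal.integral_eval, mul_zero]
    have h6 := integral_add h12 (h4.const_mul √(4 * γ * T))
    rw [h5, add_zero] at h6
    rw [← h6]
    apply integral_congr_ae
    filter_upwards [h.dynamics] with ω hω
    exact hω.momentum_left t
  · set A : ℝ≥0 → Ω → ℝ := fun s ω =>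
      (if x = n then F s else stretch (X s ω) (x + 1)) - stretch (X s ω) x with hA
    have hJA : JointIntegrable P A t := by
      refine JointIntegrable.sub ?_ (h.jointIntegrable_stretch hn hF hInt x t)
      split_ifs
      · obtain ⟨K, hK⟩ := isCompact_Icc.exists_bound_of_continuousOn
          (s := Icc 0 (t : ℝ)) hF.continuousOn
        refine JointIntegrable.of_dominated (fun _ => measurable_const)
          (Eventually.of_forall fun ω s =>
            (hF.comp NNReal.continuous_coe).continuousWithinAt) (M := fun _ => K)
          (integrable_const _) (Eventually.of_forall fun ω s hs => ?_)
        exact hK s ⟨s.coe_nonneg, by exact_mod_cast hs⟩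
      · exact h.jointIntegrable_stretch hn hF hInt (x + 1) t
    obtain ⟨h1, h2⟩ := hJA.integral_integral
    have hEA : ∀ s : ℝ≥0, ∫ ω, A s ω ∂P =
        (if x = n then F s else meanStretch P X s (x + 1)) - meanStretch P X s x := by
      intro s
      simp only [hA]
      split_ifs
      · rw [integral_sub (integrable_const _) (hiS x s)]
        simp [meanStretch]
      · rw [integral_sub (hiS (x + 1) s) (hiS x s)]
        rfl
    simp_rw [hEA] at h2
    -- Solving the path equation for the jump term expresses it through integrable quantities, so
    -- its own integrability is not needed.
    have hpath : ∀ᵐ ω ∂P, 2 * jumpIntegral (fun s => momentum (X s ω) x)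
        (fun s => N x (γ * s) ω) t = momentum (X 0 ω) x +
          (∫ s in (0 : ℝ)..t, A s.toNNReal ω) - momentum (X t ω) x := by
      filter_upwards [h.dynamics] with ω hω
      have h3 : (∫ s in (0 : ℝ)..t, A s.toNNReal ω) = ∫ s in (0 : ℝ)..t,
          ((if x = n then F s else stretch (X s.toNNReal ω) (x + 1)) -
            stretch (X s.toNNReal ω) x) := by
        apply intervalIntegral.integral_congr
        intro s hs
        rw [uIcc_of_le t.coe_nonneg] at hs
        simp only [hA, Real.coe_toNNReal _ hs.1]
      rw [h3, hω.momentum_eq hx hxn t]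
      ring
    have h4 := integral_congr_ae hpath
    have h12 : Integrable (fun ω => momentum (X 0 ω) x +
        ∫ s in (0 : ℝ)..t, A s.toNNReal ω) P := (hiM x 0).add h1
    rw [integral_const_mul, h.integral_jumpIntegral hγ hn hF hInt hx hxn,
      integral_sub h12 (hiM x t), integral_add (hiM x 0) h1, h2] at h4
    have h5 : (∫ s in (0 : ℝ)..t, ((if x = n then F s.toNNReal else
        meanStretch P X s.toNNReal (x + 1)) - meanStretch P X s.toNNReal x)) =
        ∫ s in (0 : ℝ)..t, ((if x = n then F s else
        meanStretch P X s.toNNReal (x + 1)) - meanStretch P X s.toNNReal x) := by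
      apply intervalIntegral.integral_congr
      intro s hs
      rw [uIcc_of_le t.coe_nonneg] at hs
      simp only [Real.coe_toNNReal _ hs.1]
    rw [h5] at h4
    have hc1 : Continuous fun s : ℝ => (if x = n then F s else
        meanStretch P X s.toNNReal (x + 1)) - meanStretch P X s.toNNReal x := by
      refine Continuous.sub ?_ ((hcS x).comp continuous_real_toNNReal)
      split_ifs
      · exact hF
      · exact (hcS _).comp continuous_real_toNNReal
    have hc2 : Continuous fun s : ℝ => 2 * (γ : ℝ) * meanMomentum P X s.toNNReal x :=
      continuous_const.mul ((hcM x).comp continuous_real_toNNReal)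
    rw [intervalIntegral.integral_sub (hc1.intervalIntegrable _ _) (hc2.intervalIntegrable _ _),
      intervalIntegral.integral_const_mul]
    simp only [meanMomentum] at h4 ⊢
    linarith

end

end IsChainProcess

end Chain

end HarmonicChain

namespace HarmonicChain

/-! ### The damped chain -/

/-- The paths `r`, `p` solve the equations of motion of the damped chain of length `n`, with the
left end at rest and the force `f` at the right end. -/
structure IsForcedChain (γ : ℝ) (n : ℕ) (f : ℝ → ℝ) (r p : ℝ → ℕ → ℝ) : Prop where
  left : ∀ t, r t 0 = 0
  right : ∀ t, r t (n + 1) = f t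
  continuous_stretch : ∀ x ≤ n, Continuous fun t => r t x
  continuous_momentum : ∀ x ≤ n, Continuous fun t => p t x
  deriv_stretch : ∀ x < n, ∀ t, 0 < t →
    HasDerivAt (fun t => r t (x + 1)) (p t (x + 1) - p t x) t
  deriv_momentum : ∀ x ≤ n, ∀ t, 0 < t →
    HasDerivAt (fun t => p t x) (r t (x + 1) - r t x - 2 * γ * p t x) t

namespace IsForcedChain

variable {γ : ℝ} {n : ℕ} {f g : ℝ → ℝ} {r p r' p' : ℝ → ℕ → ℝ}

theorem zero (γ : ℝ) (n : ℕ) : IsForcedChain γ n (fun _ => 0) (fun _ _ => 0) (fun _ _ => 0) where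
  left _ := rfl
  right _ := rfl
  continuous_stretch _ _ := continuous_const
  continuous_momentum _ _ := continuous_const
  deriv_stretch _ _ t _ := by simpa using hasDerivAt_const t (0 : ℝ)
  deriv_momentum _ _ t _ := by simpa using hasDerivAt_const t (0 : ℝ)

theorem add (h : IsForcedChain γ n f r p) (h' : IsForcedChain γ n g r' p') :
    IsForcedChain γ n (fun t => f t + g t) (fun t x => r t x + r' t x)
      (fun t x => p t x + p' t x) where
  left t := by rw [h.left, h'.left, add_zero]
  right t := by rw [h.right, h'.right]
  continuous_stretch x hx := (h.continuous_stretch x hx).add (h'.continuous_stretch x hx)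
  continuous_momentum x hx := (h.continuous_momentum x hx).add (h'.continuous_momentum x hx)
  deriv_stretch x hx t ht := by
    refine HasDerivAt.congr_deriv ((h.deriv_stretch x hx t ht).add (h'.deriv_stretch x hx t ht)) ?_
    ring
  deriv_momentum x hx t ht := by
    refine HasDerivAt.congr_deriv ((h.deriv_momentum x hx t ht).add (h'.deriv_momentum x hx t ht)) ?_
    ring

theorem const_mul (h : IsForcedChain γ n f r p) (c : ℝ) :
    IsForcedChain γ n (fun t => c * f t) (fun t x => c * r t x) (fun t x => c * p t x) where
  left t := by rw [h.left, mul_zero]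
  right t := by rw [h.right]
  continuous_stretch x hx := (h.continuous_stretch x hx).const_mul c
  continuous_momentum x hx := (h.continuous_momentum x hx).const_mul c
  deriv_stretch x hx t ht := by
    refine HasDerivAt.congr_deriv ((h.deriv_stretch x hx t ht).const_mul c) ?_
    ring
  deriv_momentum x hx t ht := by
    refine HasDerivAt.congr_deriv ((h.deriv_momentum x hx t ht).const_mul c) ?_
    ring

theorem sub (h : IsForcedChain γ n f r p) (h' : IsForcedChain γ n g r' p') :
    IsForcedChain γ n (fun t => f t - g t) (fun t x => r t x - r' t x)
      (fun t x => p t x - p' t x) := by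
  simpa only [neg_one_mul, ← sub_eq_add_neg] using h.add (h'.const_mul (-1))

theorem sum {ι : Type*} (s : Finset ι) {r p : ι → ℝ → ℕ → ℝ}
    (h : ∀ i ∈ s, IsForcedChain γ n (fun _ => 0) (r i) (p i)) :
    IsForcedChain γ n (fun _ => 0) (fun t x => ∑ i ∈ s, r i t x) (fun t x => ∑ i ∈ s, p i t x) := by
  classical
  induction s using Finset.induction_on with
  | empty => simpa using zero γ n
  | insert i s hi ih =>
    simp_rw [Finset.sum_insert hi]
    simpa using (h i (Finset.mem_insert_self i s)).add
      (ih fun j hj => h j (Finset.mem_insert_of_mem hj))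

/-- The stationary solution for a constant force. -/
theorem stationary (hγ : γ ≠ 0) (n : ℕ) (c : ℝ) :
    IsForcedChain γ n (fun _ => c) (fun _ x => c * x / (n + 1))
      (fun _ _ => c / (2 * γ * (n + 1))) where
  left _ := by simp
  right _ := by
    have : (n : ℝ) + 1 ≠ 0 := by positivity
    push_cast
    field_simp
  continuous_stretch _ _ := continuous_const
  continuous_momentum _ _ := continuous_const
  deriv_stretch _ _ t _ := by
    rw [sub_self]
    exact hasDerivAt_const _ _
  deriv_momentum x _ t _ := by
    refine HasDerivAt.congr_deriv (hasDerivAt_const t _) ?_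
    have : (n : ℝ) + 1 ≠ 0 := by positivity
    push_cast
    field_simp
    ring

/-- The exponentially decaying solutions of the unforced chain. -/
theorem mode {α κ : ℝ} (n : ℕ) (hα : Real.sin (α * (n + 1)) = 0) (hα' : Real.sin (α / 2) ≠ 0)
    (hκ : κ ^ 2 - 2 * γ * κ + (2 * Real.sin (α / 2)) ^ 2 = 0) :
    IsForcedChain γ n (fun _ => 0) (fun t x => Real.exp (-(κ * t)) * Real.sin (α * x))
      (fun t x => κ / (2 * Real.sin (α / 2)) * Real.exp (-(κ * t)) *
        Real.cos (α * x + α / 2)) where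
  left t := by simp
  right t := by
    push_cast
    rw [hα, mul_zero]
  continuous_stretch x _ := by fun_prop
  continuous_momentum x _ := by fun_prop
  deriv_stretch x _ t _ := by
    have h1 : HasDerivAt (fun t : ℝ => Real.exp (-(κ * t))) (Real.exp (-(κ * t)) * -κ) t := by
      simpa using (((hasDerivAt_id t).const_mul κ).neg).exp
    refine HasDerivAt.congr_deriv (h1.mul_const (Real.sin (α * (x + 1 : ℕ)))) ?_
    have e1 : α * (x + 1 : ℕ) + α / 2 = α * (x + 1) + α / 2 := by push_cast; ring
    have e2 : α * x + α / 2 = α * (x + 1) - α / 2 := by ring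
    rw [e1, e2, Real.cos_add, Real.cos_sub]
    push_cast
    field_simp
    ring
  deriv_momentum x _ t _ := by
    have h1 : HasDerivAt (fun t : ℝ => Real.exp (-(κ * t))) (Real.exp (-(κ * t)) * -κ) t := by
      simpa using (((hasDerivAt_id t).const_mul κ).neg).exp
    refine HasDerivAt.congr_deriv ((h1.const_mul (κ / (2 * Real.sin (α / 2)))).mul_const (Real.cos (α * x + α / 2))) ?_
    have e1 : α * (x + 1 : ℕ) = (α * x + α / 2) + α / 2 := by push_cast; ring
    have e2 : Real.sin (α * x) = Real.sin ((α * x + α / 2) - α / 2) := by ring_nf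
    rw [e1, e2, Real.sin_add, Real.sin_sub]
    generalize α * (x : ℝ) + α / 2 = β
    field_simp
    -- What remains of the momentum equation is the dispersion relation times a cosine.
    linear_combination (-Real.cos β) * hκ

end IsForcedChain

/-! ### The energy balance and decay of the damped chain -/

/-- The forward gradients are negative adjoints up to boundary terms. It serves with the momenta for
the energy balance, and with their time integrals for the Lyapunov functional. -/
theorem sum_by_parts (r q : ℕ → ℝ) (n : ℕ) :
    ∑ x ∈ Finset.range n, r (x + 1) * (q (x + 1) - q x) +
      ∑ x ∈ Finset.range (n + 1), q x * (r (x + 1) - r x) = r (n + 1) * q n - r 0 * q 0 := by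
  induction n with
  | zero => simp; ring
  | succ n ih =>
    rw [Finset.sum_range_succ, Finset.sum_range_succ _ (n + 1)]
    linear_combination ih

/-- The mechanical energy of the chain. -/
noncomputable def chainEnergy (n : ℕ) (r p : ℕ → ℝ) : ℝ :=
  (∑ x ∈ Finset.range n, r (x + 1) ^ 2 + ∑ x ∈ Finset.range (n + 1), p x ^ 2) / 2

theorem chainEnergy_nonneg (n : ℕ) (r p : ℕ → ℝ) : 0 ≤ chainEnergy n r p := by
  rw [chainEnergy]
  positivity

theorem antitoneOn_of_hasDerivAt_nonpos {φ φ' : ℝ → ℝ} (hc : Continuous φ)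
    (hd : ∀ t, 0 < t → HasDerivAt φ (φ' t) t) {a b : ℝ} (ha : 0 ≤ a)
    (hn : ∀ t, 0 < t → a < t → t < b → φ' t ≤ 0) (hab : a ≤ b) : φ b ≤ φ a := by
  have h := antitoneOn_of_deriv_nonpos (convex_Icc a b) hc.continuousOn
    (fun t ht => ?_) (fun t ht => ?_)
  · exact h (left_mem_Icc.2 hab) (right_mem_Icc.2 hab) hab
  · rw [interior_Icc] at ht
    exact (hd t (ha.trans_lt ht.1)).differentiableAt.differentiableWithinAt
  · rw [interior_Icc] at ht
    rw [(hd t (ha.trans_lt ht.1)).deriv]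
    exact hn t (ha.trans_lt ht.1) ht.1 ht.2

namespace IsForcedChain

variable {γ : ℝ} {n : ℕ} {f : ℝ → ℝ} {r p : ℝ → ℕ → ℝ}

/-- The exchange between sites telescopes; what survives is the work of the force at the right end
and the damping, as the left end is at rest. -/
theorem hasDerivAt_energy (h : IsForcedChain γ n f r p) {t : ℝ} (ht : 0 < t) :
    HasDerivAt (fun t => chainEnergy n (r t) (p t))
      (f t * p t n - 2 * γ * ∑ x ∈ Finset.range (n + 1), p t x ^ 2) t := by
  have h1 := HasDerivAt.fun_sum (u := Finset.range n) fun x hx =>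
    (h.deriv_stretch x (Finset.mem_range.1 hx) t ht).fun_pow 2
  have h2 := HasDerivAt.fun_sum (u := Finset.range (n + 1)) fun x hx =>
    (h.deriv_momentum x (Nat.lt_succ_iff.1 (Finset.mem_range.1 hx)) t ht).fun_pow 2
  refine HasDerivAt.congr_deriv ((h1.add h2).div_const 2) ?_
  have h3 := sum_by_parts (r t) (p t) n
  rw [h.left, h.right] at h3
  have h4 : ∑ x ∈ Finset.range (n + 1), p t x * (r t (x + 1) - r t x - 2 * γ * p t x) =
      ∑ x ∈ Finset.range (n + 1), p t x * (r t (x + 1) - r t x) -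
        2 * γ * ∑ x ∈ Finset.range (n + 1), p t x ^ 2 := by
    rw [Finset.mul_sum, ← Finset.sum_sub_distrib]
    exact Finset.sum_congr rfl fun x _ => by ring
  have h5 : ∑ x ∈ Finset.range n, (2 : ℕ) * r t (x + 1) ^ (2 - 1) * (p t (x + 1) - p t x) =
      2 * ∑ x ∈ Finset.range n, r t (x + 1) * (p t (x + 1) - p t x) := by
    rw [Finset.mul_sum]
    exact Finset.sum_congr rfl fun x _ => by push_cast; ring
  have h6 : ∑ x ∈ Finset.range (n + 1), (2 : ℕ) * p t x ^ (2 - 1) *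
      (r t (x + 1) - r t x - 2 * γ * p t x) =
      2 * ∑ x ∈ Finset.range (n + 1), p t x * (r t (x + 1) - r t x - 2 * γ * p t x) := by
    rw [Finset.mul_sum]
    exact Finset.sum_congr rfl fun x _ => by push_cast; ring
  rw [h5, h6, h4]
  linarith

theorem continuous_energy (h : IsForcedChain γ n f r p) :
    Continuous fun t => chainEnergy n (r t) (p t) := by
  unfold chainEnergy
  refine Continuous.div_const (Continuous.add ?_ ?_) 2
  · exact continuous_finsetSum _ fun x hx =>
      (h.continuous_stretch (x + 1) (Finset.mem_range.1 hx)).pow 2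
  · exact continuous_finsetSum _ fun x hx =>
      (h.continuous_momentum x (Nat.lt_succ_iff.1 (Finset.mem_range.1 hx))).pow 2

theorem sq_le_sum_sq (n : ℕ) (q : ℕ → ℝ) : q n ^ 2 ≤ ∑ x ∈ Finset.range (n + 1), q x ^ 2 :=
  Finset.single_le_sum (f := fun x => q x ^ 2) (fun _ _ => sq_nonneg _)
    (Finset.self_mem_range_succ n)

/-- The energy of the chain becomes small on the diffusive time scale, up to the `L²` norm of the
initial stretch, for an oscillating force with a bounded primitive. -/
theorem energy_le (h : IsForcedChain γ n f r p) (hγ : 0 < γ) {H : ℝ → ℝ} {a b : ℝ}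
    (hH : ∀ t, HasDerivAt H (f t) t) (ha : ∀ t, |f t| ≤ a) (hb : ∀ t, |H t| ≤ b)
    {τ t : ℝ} (hτ : 0 ≤ τ) (hτt : τ ≤ t) :
    τ * chainEnergy n (r t) (p t) ≤ 2 / γ * chainEnergy n (r 0) (p 0) +
      ((∑ x ∈ Finset.range n, r 0 (x + 1) ^ 2) / 2 + b ^ 2 / 2 + a ^ 2 / (2 * γ ^ 2)) * t +
      a ^ 2 / (4 * γ) * τ ^ 2 + b ^ 2 / (2 * γ) := by
  have ht : 0 ≤ t := hτ.trans hτt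
  -- The displacements: the gradient of `s` is the change of stretch since time `0`, so pairing the
  -- momentum equation with `s` produces `∑ r (r - r(0))`, hence the potential energy up to the
  -- initial stretch.
  set s : ℝ → ℕ → ℝ := fun t x => ∫ u in (0 : ℝ)..t, p u x with hs
  have hsd : ∀ x ≤ n, ∀ t, HasDerivAt (fun t => s t x) (p t x) t := fun x hx t =>
    ((h.continuous_momentum x hx).integral_hasStrictDerivAt 0 t).hasDerivAt
  have hsc : ∀ x ≤ n, Continuous fun t => s t x := fun x hx =>
    continuous_iff_continuousAt.2 fun t => (hsd x hx t).continuousAt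
  have hs0 : ∀ x, s 0 x = 0 := fun x => intervalIntegral.integral_same
  have hsr : ∀ x < n, ∀ t, 0 ≤ t → s t (x + 1) - s t x = r t (x + 1) - r 0 (x + 1) := by
    intro x hx t ht
    have hc1 := h.continuous_momentum (x + 1) hx
    have hc2 := h.continuous_momentum x hx.le
    rw [hs]
    simp only
    rw [← intervalIntegral.integral_sub (hc1.intervalIntegrable _ _) (hc2.intervalIntegrable _ _)]
    exact intervalIntegral.integral_eq_sub_of_hasDerivAt_of_le ht
      (h.continuous_stretch (x + 1) hx).continuousOn
      (fun u hu => h.deriv_stretch x hx u hu.1) ((hc1.sub hc2).intervalIntegrable _ _)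
  set E : ℝ → ℝ := fun t => chainEnergy n (r t) (p t) with hE
  set c : ℝ := (∑ x ∈ Finset.range n, r 0 (x + 1) ^ 2) / 2 + b ^ 2 / 2 + a ^ 2 / (2 * γ ^ 2) with hc
  have hf2 : ∀ t, f t ^ 2 ≤ a ^ 2 := fun t => sq_le_sq' (neg_le_of_abs_le (ha t)) (le_of_abs_le (ha t))
  have hH2 : ∀ t, H t ^ 2 ≤ b ^ 2 := fun t => sq_le_sq' (neg_le_of_abs_le (hb t)) (le_of_abs_le (hb t))
  set Ep : ℝ → ℝ := fun t => f t * p t n - 2 * γ * ∑ x ∈ Finset.range (n + 1), p t x ^ 2 with hEp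
  have hEd : ∀ t, 0 < t → HasDerivAt E (Ep t) t := fun t ht => h.hasDerivAt_energy ht
  -- Young's inequality spends half of the damping of `p_n` on the work of the force and keeps at
  -- least `γ ∑ p²`.
  have hEp1 : ∀ t, Ep t ≤ -γ * (∑ x ∈ Finset.range (n + 1), p t x ^ 2) + a ^ 2 / (4 * γ) := by
    intro t
    have h1 := sq_le_sum_sq n (p t)
    have h2 : f t * p t n ≤ γ * p t n ^ 2 + f t ^ 2 / (4 * γ) := by
      have : γ * p t n ^ 2 + f t ^ 2 / (4 * γ) - f t * p t n =
          (2 * γ * p t n - f t) ^ 2 / (4 * γ) := by field_simp; ring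
      have h3 : 0 ≤ (2 * γ * p t n - f t) ^ 2 / (4 * γ) := by positivity
      linarith
    have h3 : f t ^ 2 / (4 * γ) ≤ a ^ 2 / (4 * γ) :=
      div_le_div_of_nonneg_right (hf2 t) (by positivity)
    have h4 := mul_le_mul_of_nonneg_left h1 hγ.le
    simp only [hEp]
    linarith
  -- Built so that `Φ' ≤ -E + c`. The term `γ s²` cancels the friction in `(p s)'`; `-H s_n` cancels
  -- the boundary work `f s_n`, leaving only the bounded factor `H` times `p_n`; and `(2/γ) E`
  -- provides `-2 ∑ p²`, enough to turn the positive kinetic terms into minus the kinetic energy.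
  set Φ : ℝ → ℝ := fun t => (∑ x ∈ Finset.range (n + 1), (p t x * s t x + γ * s t x ^ 2)) -
    H t * s t n + 2 / γ * E t with hΦ
  have hHc : Continuous H := continuous_iff_continuousAt.2 fun t => (hH t).continuousAt
  have hΦc : Continuous Φ := by
    refine ((continuous_finsetSum _ fun x hx => ?_).sub (hHc.mul (hsc n le_rfl))).add
      (h.continuous_energy.const_mul _)
    have hx' := Nat.lt_succ_iff.1 (Finset.mem_range.1 hx)
    exact ((h.continuous_momentum x hx').mul (hsc x hx')).add (((hsc x hx').pow 2).const_mul γ)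
  have hΦd : ∀ t, 0 < t → HasDerivAt Φ (∑ x ∈ Finset.range (n + 1),
      ((r t (x + 1) - r t x - 2 * γ * p t x) * s t x + p t x * p t x +
        γ * ((2 : ℕ) * s t x ^ (2 - 1) * p t x)) - (f t * s t n + H t * p t n) +
      2 / γ * Ep t) t := by
    intro t ht
    refine ((HasDerivAt.fun_sum fun x hx => ?_).sub ((hH t).mul (hsd n le_rfl t))).add
      ((hEd t ht).const_mul _)
    have hx' := Nat.lt_succ_iff.1 (Finset.mem_range.1 hx)
    exact ((h.deriv_momentum x hx' t ht).mul (hsd x hx' t)).add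
      (((hsd x hx' t).fun_pow 2).const_mul γ)
  have hΦ' : ∀ t, 0 < t → ∑ x ∈ Finset.range (n + 1),
      ((r t (x + 1) - r t x - 2 * γ * p t x) * s t x + p t x * p t x +
        γ * ((2 : ℕ) * s t x ^ (2 - 1) * p t x)) - (f t * s t n + H t * p t n) +
      2 / γ * Ep t ≤ -E t + c := by
    intro t ht
    have h1 := sum_by_parts (r t) (s t) n
    rw [h.left, h.right] at h1
    have h2 : ∑ x ∈ Finset.range (n + 1),
        ((r t (x + 1) - r t x - 2 * γ * p t x) * s t x + p t x * p t x +
          γ * ((2 : ℕ) * s t x ^ (2 - 1) * p t x)) =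
        ∑ x ∈ Finset.range (n + 1), s t x * (r t (x + 1) - r t x) +
          ∑ x ∈ Finset.range (n + 1), p t x ^ 2 := by
      rw [← Finset.sum_add_distrib]
      exact Finset.sum_congr rfl fun x _ => by push_cast; ring
    have h3 : -∑ x ∈ Finset.range n, r t (x + 1) * (s t (x + 1) - s t x) ≤
        -(∑ x ∈ Finset.range n, r t (x + 1) ^ 2) / 2 +
          (∑ x ∈ Finset.range n, r 0 (x + 1) ^ 2) / 2 := by
      have : ∑ x ∈ Finset.range n, (r t (x + 1) ^ 2 / 2 - r 0 (x + 1) ^ 2 / 2) ≤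
          ∑ x ∈ Finset.range n, r t (x + 1) * (s t (x + 1) - s t x) := by
        refine Finset.sum_le_sum fun x hx => ?_
        rw [hsr x (Finset.mem_range.1 hx) t ht.le]
        nlinarith [sq_nonneg (r t (x + 1) - r 0 (x + 1))]
      rw [Finset.sum_sub_distrib, ← Finset.sum_div, ← Finset.sum_div] at this
      linarith
    have h4 := sq_le_sum_sq n (p t)
    have h5 : -(H t * p t n) ≤ p t n ^ 2 / 2 + b ^ 2 / 2 := by
      nlinarith [sq_nonneg (H t + p t n), hH2 t]
    have h6 : 2 / γ * Ep t ≤ -2 * (∑ x ∈ Finset.range (n + 1), p t x ^ 2) +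
        a ^ 2 / (2 * γ ^ 2) := by
      calc 2 / γ * Ep t ≤ 2 / γ * (-γ * (∑ x ∈ Finset.range (n + 1), p t x ^ 2) +
            a ^ 2 / (4 * γ)) := mul_le_mul_of_nonneg_left (hEp1 t) (by positivity)
        _ = _ := by field_simp; ring
    rw [h2]
    simp only [hE, chainEnergy, hc]
    linarith
  -- Completing squares: `γ s²` absorbs `p s` and `H s_n`, at the cost of kinetic energy, covered by
  -- `(2/γ) E`, and of a constant.
  have hΦlow : -(b ^ 2 / (2 * γ)) ≤ Φ t := by
    have h1 : ∑ x ∈ Finset.range (n + 1), (-(1 / (2 * γ)) * p t x ^ 2 + γ / 2 * s t x ^ 2) ≤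
        ∑ x ∈ Finset.range (n + 1), (p t x * s t x + γ * s t x ^ 2) := by
      refine Finset.sum_le_sum fun x _ => ?_
      have : p t x * s t x + γ * s t x ^ 2 - (-(1 / (2 * γ)) * p t x ^ 2 + γ / 2 * s t x ^ 2) =
        (p t x + γ * s t x) ^ 2 / (2 * γ) := by field_simp; ring
      have h3 : 0 ≤ (p t x + γ * s t x) ^ 2 / (2 * γ) := by positivity
      linarith
    rw [Finset.sum_add_distrib, ← Finset.mul_sum, ← Finset.mul_sum] at h1
    have h2 := mul_le_mul_of_nonneg_left (sq_le_sum_sq n (s t)) (by positivity : 0 ≤ γ / 2)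
    have h3 : H t * s t n ≤ γ / 2 * s t n ^ 2 + b ^ 2 / (2 * γ) := by
      have h4 : γ / 2 * s t n ^ 2 + H t ^ 2 / (2 * γ) - H t * s t n =
          (γ * s t n - H t) ^ 2 / (2 * γ) := by field_simp; ring
      have h5 : 0 ≤ (γ * s t n - H t) ^ 2 / (2 * γ) := by positivity
      have h6 : H t ^ 2 / (2 * γ) ≤ b ^ 2 / (2 * γ) :=
        div_le_div_of_nonneg_right (hH2 t) (by positivity)
      linarith
    have h4 : 1 / (2 * γ) * ∑ x ∈ Finset.range (n + 1), p t x ^ 2 ≤ 2 / γ * E t := by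
      have h5 : 2 / γ * E t - 1 / (2 * γ) * ∑ x ∈ Finset.range (n + 1), p t x ^ 2 =
          (∑ x ∈ Finset.range n, r t (x + 1) ^ 2) / γ +
            (∑ x ∈ Finset.range (n + 1), p t x ^ 2) / (2 * γ) := by
        simp only [hE, chainEnergy]
        field_simp
        ring
      have h6 : 0 ≤ (∑ x ∈ Finset.range n, r t (x + 1) ^ 2) / γ +
            (∑ x ∈ Finset.range (n + 1), p t x ^ 2) / (2 * γ) := by positivity
      linarith
    simp only [hΦ]
    linarith
  have hΦ0 : Φ 0 = 2 / γ * E 0 := by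
    simp [hΦ, hs0]
  -- The energy grows at most at the rate `a²/(4γ)`, so earlier energies are bounded below in terms
  -- of the final one.
  have hEt : ∀ u, 0 ≤ u → u ≤ t → E t - a ^ 2 / (4 * γ) * t ≤ E u - a ^ 2 / (4 * γ) * u := by
    intro u hu hut
    refine antitoneOn_of_hasDerivAt_nonpos (φ := fun u => E u - a ^ 2 / (4 * γ) * u)
      (φ' := fun u => Ep u - a ^ 2 / (4 * γ) * 1)
      (h.continuous_energy.sub (continuous_id.const_mul _))
      (fun v hv => (hEd v hv).sub ((hasDerivAt_id v).const_mul _)) hu (fun v _ _ _ => ?_) hut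
    have h1 := hEp1 v
    have h2 : 0 ≤ γ * ∑ x ∈ Finset.range (n + 1), p v x ^ 2 := by positivity
    linarith
  -- Up to `t - τ` the gain `-E` is discarded; only on the last window, of length `τ`, is `E`
  -- compared with `E t`. This keeps `τ` free, to be chosen so that the growth over the window is
  -- small.
  have hΦ1 : Φ (t - τ) - c * (t - τ) ≤ Φ 0 - c * 0 := by
    refine antitoneOn_of_hasDerivAt_nonpos (φ := fun u => Φ u - c * u)
      (hΦc.sub (continuous_id.const_mul _))
      (fun v hv => (hΦd v hv).sub ((hasDerivAt_id v).const_mul c)) le_rfl (fun v hv _ _ => ?_)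
      (sub_nonneg.2 hτt)
    have h1 := hΦ' v hv
    have h2 : 0 ≤ E v := chainEnergy_nonneg _ _ _
    linarith
  set K := c + a ^ 2 / (4 * γ) * τ - E t with hK
  have hΦ2 : Φ t - K * t ≤ Φ (t - τ) - K * (t - τ) := by
    refine antitoneOn_of_hasDerivAt_nonpos (φ := fun u => Φ u - K * u)
      (hΦc.sub (continuous_id.const_mul _))
      (fun v hv => (hΦd v hv).sub ((hasDerivAt_id v).const_mul K)) (sub_nonneg.2 hτt)
      (fun v hv hv1 hv2 => ?_) (by linarith)
    have h1 := hΦ' v hv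
    have h2 := hEt v hv.le hv2.le
    have h3 : a ^ 2 / (4 * γ) * (t - v) ≤ a ^ 2 / (4 * γ) * τ := by
      gcongr
      linarith
    rw [hK]
    linarith
  have h9 : E t = chainEnergy n (r t) (p t) := rfl
  have h10 : E 0 = chainEnergy n (r 0) (p 0) := rfl
  rw [← h9, ← h10]
  rw [hK] at hΦ2
  nlinarith

end IsForcedChain

end HarmonicChain

namespace HarmonicChain

/-! ### Integrals against signed measures -/

section SignedMeasure

variable {α : Type*} [TopologicalSpace α] [CompactSpace α] [MeasurableSpace α] [BorelSpace α]

theorem integrable_of_continuous {f : α → ℝ} (hf : Continuous f)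
    (μ : Measure α) [IsFiniteMeasure μ] : Integrable f μ :=
  (BoundedContinuousFunction.mkOfCompact ⟨f, hf⟩).integrable μ

theorem signedIntegral_sub_toSignedMeasure {f : α → ℝ} (hf : Continuous f) (μ ν : Measure α)
    [IsFiniteMeasure μ] [IsFiniteMeasure ν] :
    ∫ᵛ u, f u ∂•(μ.toSignedMeasure - ν.toSignedMeasure) = ∫ u, f u ∂μ - ∫ u, f u ∂ν := by
  have hflip : (ContinuousLinearMap.lsmul ℝ ℝ : ℝ →L[ℝ] ℝ →L[ℝ] ℝ).flip =
      ContinuousLinearMap.lsmul ℝ ℝ := by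
    ext
    simp
  rw [VectorMeasure.integral_sub_vectorMeasure, ← VectorMeasure.integral_toSignedMeasure (μ := μ),
    ← VectorMeasure.integral_toSignedMeasure (μ := ν), hflip]
  · rw [VectorMeasure.Integrable, Measure.variation_toSignedMeasure]
    exact integrable_of_continuous hf μ
  · rw [VectorMeasure.Integrable, Measure.variation_toSignedMeasure]
    exact integrable_of_continuous hf ν

theorem signedIntegral_eq {f : α → ℝ} (hf : Continuous f) (m : SignedMeasure α) :
    ∫ᵛ u, f u ∂•m = ∫ u, f u ∂m.toJordanDecomposition.posPart -
      ∫ u, f u ∂m.toJordanDecomposition.negPart := by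
  rw [← signedIntegral_sub_toSignedMeasure hf]
  congr 1
  exact (SignedMeasure.toSignedMeasure_toJordanDecomposition m).symm

theorem signedIntegral_withDensity {f ρ : α → ℝ} (hf : Continuous f) (hρ : Continuous ρ)
    (μ : Measure α) [IsFiniteMeasure μ] :
    ∫ᵛ u, f u ∂•(μ.withDensityᵥ ρ) = ∫ u, f u * ρ u ∂μ := by
  have hi := integrable_of_continuous hρ μ
  have := isFiniteMeasure_withDensity_ofReal hi.2
  have := isFiniteMeasure_withDensity_ofReal hi.neg.2
  rw [withDensityᵥ_eq_withDensity_pos_part_sub_withDensity_neg_part hi]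
  have h1 := signedIntegral_sub_toSignedMeasure hf (μ.withDensity fun x => ENNReal.ofReal (ρ x))
    (μ.withDensity fun x => ENNReal.ofReal ((-ρ) x))
  simp only [Pi.neg_apply] at h1
  rw [h1, integral_withDensity_eq_integral_toReal_smul (by fun_prop) (by simp),
    integral_withDensity_eq_integral_toReal_smul (by fun_prop) (by simp), ← integral_sub]
  · congr 1 with u
    simp only [ENNReal.toReal_ofReal', smul_eq_mul, ← sub_mul]
    rw [mul_comm]
    congr 1
    rcases le_total 0 (ρ u) with h | h
    · rw [max_eq_left h, max_eq_right (by linarith), sub_zero]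
    · rw [max_eq_right h, max_eq_left (by linarith)]
      ring
  · refine integrable_of_continuous ?_ μ
    simp only [ENNReal.toReal_ofReal']
    fun_prop
  · refine integrable_of_continuous ?_ μ
    simp only [ENNReal.toReal_ofReal']
    fun_prop

theorem signedIntegral_add {f g : α → ℝ} (hf : Continuous f) (hg : Continuous g)
    (m : SignedMeasure α) :
    ∫ᵛ u, (f u + g u) ∂•m = ∫ᵛ u, f u ∂•m + ∫ᵛ u, g u ∂•m := by
  rw [signedIntegral_eq hf, signedIntegral_eq hg, signedIntegral_eq (f := fun u => f u + g u) (hf.add hg),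
    integral_add (integrable_of_continuous hf _) (integrable_of_continuous hg _),
    integral_add (integrable_of_continuous hf _) (integrable_of_continuous hg _)]
  ring

theorem signedIntegral_const_mul {f : α → ℝ} (hf : Continuous f) (c : ℝ)
    (m : SignedMeasure α) : ∫ᵛ u, c * f u ∂•m = c * ∫ᵛ u, f u ∂•m := by
  rw [signedIntegral_eq hf, signedIntegral_eq (hf.const_mul c), integral_const_mul,
    integral_const_mul]
  ring

theorem abs_signedIntegral_le {f : α → ℝ} (hf : Continuous f) {ε : ℝ}
    (hε : ∀ u, |f u| ≤ ε) (m : SignedMeasure α) : |∫ᵛ u, f u ∂•m| ≤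
      ε * (m.toJordanDecomposition.posPart.real univ +
        m.toJordanDecomposition.negPart.real univ) := by
  rw [signedIntegral_eq hf, mul_add]
  refine (abs_sub _ _).trans (add_le_add ?_ ?_)
  · exact norm_integral_le_of_norm_le_const (Eventually.of_forall fun u =>
      (Real.norm_eq_abs _).le.trans (hε u))
  · exact norm_integral_le_of_norm_le_const (Eventually.of_forall fun u =>
      (Real.norm_eq_abs _).le.trans (hε u))

/-- Moving the negative Jordan parts to the other side reduces the claim to finite positive
measures, which their integrals of continuous functions determine. -/
theorem signedMeasure_ext_of_integral [HasOuterApproxClosed α] {m m' : SignedMeasure α}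
    (h : ∀ f : α → ℝ, Continuous f → ∫ᵛ u, f u ∂•m = ∫ᵛ u, f u ∂•m') : m = m' := by
  have hm := SignedMeasure.toSignedMeasure_toJordanDecomposition m
  have hm' := SignedMeasure.toSignedMeasure_toJordanDecomposition m'
  have h1 : m.toJordanDecomposition.posPart + m'.toJordanDecomposition.negPart =
      m'.toJordanDecomposition.posPart + m.toJordanDecomposition.negPart := by
    refine ext_of_forall_integral_eq_of_IsFiniteMeasure fun f => ?_
    have h2 := h f f.continuous
    rw [signedIntegral_eq f.continuous, signedIntegral_eq f.continuous] at h2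
    rw [integral_add_measure (f.integrable _) (f.integrable _),
      integral_add_measure (f.integrable _) (f.integrable _)]
    linarith
  rw [← hm, ← hm']
  ext s hs
  have h3 : (m.toJordanDecomposition.posPart + m'.toJordanDecomposition.negPart).real s =
      (m'.toJordanDecomposition.posPart + m.toJordanDecomposition.negPart).real s := by rw [h1]
  rw [measureReal_add_apply, measureReal_add_apply] at h3
  simp only [JordanDecomposition.toSignedMeasure, sub_apply, Measure.toSignedMeasure_apply_measurable hs]
  linarith

theorem integral_unitInterval (f : ℝ → ℝ) :
    ∫ u : unitInterval, f u = ∫ u in (0 : ℝ)..1, f u := by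
  rw [intervalIntegral.integral_of_le zero_le_one, ← integral_Icc_eq_integral_Ioc]
  exact integral_subtype_comap measurableSet_Icc f

end SignedMeasure

end HarmonicChain

namespace HarmonicChain

/-! ### Sine series -/

/-- The Dirichlet eigenfunctions `sin (π (j + 1) u)` of the unit interval. -/
noncomputable def sineMode (j : ℕ) (u : ℝ) : ℝ := Real.sin (Real.pi * (j + 1) * u)

@[fun_prop]
theorem continuous_sineMode (j : ℕ) : Continuous (sineMode j) := by
  unfold sineMode
  fun_prop

theorem abs_sineMode_le (j : ℕ) (u : ℝ) : |sineMode j u| ≤ 1 := Real.abs_sin_le_one _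

theorem continuous_of_mem_span {F : ℝ → ℝ} (hF : F ∈ Submodule.span ℝ (range sineMode)) :
    Continuous F := by
  induction hF using Submodule.span_induction with
  | mem x hx =>
    obtain ⟨j, rfl⟩ := hx
    exact continuous_sineMode j
  | zero => exact continuous_const
  | add x y _ _ hx hy => exact hx.add hy
  | smul a x _ hx => exact hx.const_smul a

/-- Product-to-sum; for the lowest mode the difference term is the zero function, hence the separate
case. Iterated, this places `sin · q(cos)` in the span for every polynomial `q`. -/
theorem cos_mul_mem_span {F : ℝ → ℝ} (hF : F ∈ Submodule.span ℝ (range sineMode)) :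
    (fun u => Real.cos (Real.pi * u) * F u) ∈ Submodule.span ℝ (range sineMode) := by
  induction hF using Submodule.span_induction with
  | mem x hx =>
    obtain ⟨j, rfl⟩ := hx
    have hm : ∀ j, sineMode j ∈ Submodule.span ℝ (range sineMode) := fun j =>
      Submodule.subset_span ⟨j, rfl⟩
    rcases j with _ | j
    · convert Submodule.smul_mem _ (1 / 2 : ℝ) (hm 1) using 1
      ext u
      simp only [sineMode, Pi.smul_apply, smul_eq_mul]
      have : Real.pi * ((1 : ℕ) + 1) * u = 2 * (Real.pi * u) := by push_cast; ring
      rw [this, Real.sin_two_mul]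
      push_cast
      ring_nf
    · convert Submodule.add_mem _ (Submodule.smul_mem _ (1 / 2 : ℝ) (hm (j + 2)))
        (Submodule.smul_mem _ (1 / 2 : ℝ) (hm j)) using 1
      ext u
      simp only [sineMode, Pi.smul_apply, Pi.add_apply, smul_eq_mul]
      have h1 : Real.pi * ((j + 2 : ℕ) + 1) * u = Real.pi * ((j + 1 : ℕ) + 1) * u + Real.pi * u := by
        push_cast; ring
      have h2 : Real.pi * (j + 1) * u = Real.pi * ((j + 1 : ℕ) + 1) * u - Real.pi * u := by
        push_cast; ring
      rw [h1, h2, Real.sin_add, Real.sin_sub]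
      ring
  | zero =>
    simp only [Pi.zero_apply, mul_zero]
    exact Submodule.zero_mem _
  | add x y _ _ hx hy =>
    convert Submodule.add_mem _ hx hy using 1
    ext u
    simp only [Pi.add_apply]
    ring
  | smul a x _ hx =>
    convert Submodule.smul_mem _ a hx using 1
    ext u
    simp only [Pi.smul_apply, smul_eq_mul]
    ring

theorem sin_mul_polynomial_mem_span (q : Polynomial ℝ) :
    (fun u => Real.sin (Real.pi * u) * q.eval (Real.cos (Real.pi * u))) ∈
      Submodule.span ℝ (range sineMode) := by
  have hpow : ∀ k : ℕ, (fun u => Real.sin (Real.pi * u) * Real.cos (Real.pi * u) ^ k) ∈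
      Submodule.span ℝ (range sineMode) := by
    intro k
    induction k with
    | zero =>
      have h : sineMode 0 ∈ Submodule.span ℝ (range sineMode) := Submodule.subset_span ⟨0, rfl⟩
      convert h using 1
      ext u
      simp [sineMode]
    | succ k ih =>
      convert cos_mul_mem_span ih using 1
      ext u
      ring
  have h := Submodule.sum_mem (Submodule.span ℝ (range sineMode))
    (t := Finset.range (q.natDegree + 1)) fun k _ => Submodule.smul_mem _ (q.coeff k) (hpow k)
  convert h using 1
  ext u
  rw [Polynomial.eval_eq_sum_range, Finset.mul_sum, Finset.sum_apply]
  refine Finset.sum_congr rfl fun k _ => ?_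
  simp only [Pi.smul_apply, smul_eq_mul]
  ring

/-- Continuous functions that vanish at the end points are uniform limits of sine polynomials. -/
theorem exists_mem_span_abs_sub_le {φ : ℝ → ℝ} (hφ : Continuous φ) (h0 : φ 0 = 0) (h1 : φ 1 = 0)
    {ε : ℝ} (hε : 0 < ε) : ∃ F ∈ Submodule.span ℝ (range sineMode),
      ∀ u ∈ Icc (0 : ℝ) 1, |φ u - F u| ≤ ε := by
  obtain ⟨M, hM⟩ := isCompact_Icc.exists_bound_of_continuousOn (s := Icc (0 : ℝ) 1) hφ.continuousOn
  have hM0 : 0 ≤ M := (norm_nonneg _).trans (hM 0 (left_mem_Icc.2 zero_le_one))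
  -- Where `|φ|` is not small one is away from the end points, and there `sin²` has a positive lower
  -- bound `m`.
  set K : Set ℝ := Icc (0 : ℝ) 1 ∩ {u | ε / 2 ≤ |φ u|} with hK
  have hKc : IsCompact K := isCompact_Icc.inter_right (isClosed_le continuous_const hφ.abs)
  obtain ⟨m, hm, hmK⟩ : ∃ m : ℝ, 0 < m ∧ ∀ u ∈ K, m ≤ Real.sin (Real.pi * u) ^ 2 := by
    rcases K.eq_empty_or_nonempty with hKe | hKn
    · exact ⟨1, one_pos, fun u hu => by simp [hKe] at hu⟩
    · obtain ⟨v, hv, hvm⟩ := hKc.exists_isMinOn hKn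
        (f := fun u => Real.sin (Real.pi * u) ^ 2) (by fun_prop)
      refine ⟨_, ?_, fun u hu => hvm hu⟩
      have hv0 : v ≠ 0 := fun h => by
        have h3 := hv.2
        simp only [h, mem_ofPred_eq, h0, abs_zero] at h3
        linarith
      have hv1 : v ≠ 1 := fun h => by
        have h3 := hv.2
        simp only [h, mem_ofPred_eq, h1, abs_zero] at h3
        linarith
      have h2 : 0 < v := lt_of_le_of_ne hv.1.1 hv0.symm
      have h3 : v < 1 := lt_of_le_of_ne hv.1.2 hv1
      have := Real.sin_pos_of_pos_of_lt_pi (mul_pos Real.pi_pos h2)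
        (by nlinarith [Real.pi_pos])
      positivity
  obtain ⟨δ, hδ, hδM⟩ : ∃ δ : ℝ, 0 < δ ∧ M * δ ≤ ε / 2 * m := by
    refine ⟨ε / 2 * m / (M + 1), by positivity, ?_⟩
    rw [mul_div_assoc', div_le_iff₀ (by positivity)]
    nlinarith [mul_pos (half_pos hε) hm]
  -- A regularised quotient of `φ` by `sin(πu)`. The product `sin · q` misses `φ` by the factor
  -- `δ/(sin² + δ)`, which is small on `K` and at most `1` elsewhere, where `φ` itself is small.
  set q : ℝ → ℝ := fun u => φ u * Real.sin (Real.pi * u) / (Real.sin (Real.pi * u) ^ 2 + δ) with hq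
  have hpos : ∀ u, 0 < Real.sin (Real.pi * u) ^ 2 + δ := fun u => by positivity
  have hqc : Continuous q :=
    Continuous.div (by fun_prop) (by fun_prop) fun u => (hpos u).ne'
  have hqa : ∀ u ∈ Icc (0 : ℝ) 1, |φ u - Real.sin (Real.pi * u) * q u| ≤ ε / 2 := by
    intro u hu
    have h2 : φ u - Real.sin (Real.pi * u) * q u = φ u * (δ / (Real.sin (Real.pi * u) ^ 2 + δ)) := by
      have := (hpos u).ne'
      simp only [hq]
      field_simp
      ring
    have h3 : 0 ≤ δ / (Real.sin (Real.pi * u) ^ 2 + δ) := by positivity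
    rw [h2, abs_mul, abs_of_nonneg h3]
    by_cases hu2 : ε / 2 ≤ |φ u|
    · have h4 := hmK u ⟨hu, hu2⟩
      calc |φ u| * (δ / (Real.sin (Real.pi * u) ^ 2 + δ)) ≤ M * (δ / m) := by
            refine mul_le_mul (hM u hu) ?_ h3 hM0
            exact div_le_div_of_nonneg_left hδ.le hm (by linarith)
        _ ≤ ε / 2 := by
            rw [mul_div_assoc', div_le_iff₀ hm]
            exact hδM
    · have h5 : δ / (Real.sin (Real.pi * u) ^ 2 + δ) ≤ 1 := by
        rw [div_le_one (hpos u)]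
        have := sq_nonneg (Real.sin (Real.pi * u))
        linarith
      calc |φ u| * (δ / (Real.sin (Real.pi * u) ^ 2 + δ)) ≤ |φ u| * 1 :=
            mul_le_mul_of_nonneg_left h5 (abs_nonneg _)
        _ ≤ ε / 2 := by linarith [not_le.1 hu2]
  -- On the unit interval `q` is a continuous function of `cos(πu)`, so the Weierstrass theorem
  -- approximates it by a polynomial in the cosine.
  obtain ⟨P, hP⟩ := exists_polynomial_near_of_continuousOn (-1) 1
    (fun x => q (Real.arccos x / Real.pi))
    (hqc.comp (Real.continuous_arccos.div_const _)).continuousOn (ε / 2) (half_pos hε)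
  refine ⟨_, sin_mul_polynomial_mem_span P, fun u hu => ?_⟩
  have h2 := hP (Real.cos (Real.pi * u)) ⟨Real.neg_one_le_cos _, Real.cos_le_one _⟩
  rw [Real.arccos_cos (mul_nonneg Real.pi_pos.le hu.1)
    (mul_le_of_le_one_right Real.pi_pos.le hu.2), mul_div_cancel_left₀ _ Real.pi_ne_zero] at h2
  have h3 : φ u - Real.sin (Real.pi * u) * P.eval (Real.cos (Real.pi * u)) =
      (φ u - Real.sin (Real.pi * u) * q u) -
        Real.sin (Real.pi * u) * (P.eval (Real.cos (Real.pi * u)) - q u) := by ring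
  have h4 : |Real.sin (Real.pi * u) * (P.eval (Real.cos (Real.pi * u)) - q u)| ≤ ε / 2 := by
    rw [abs_mul]
    calc _ ≤ 1 * (ε / 2) := mul_le_mul (Real.abs_sin_le_one _) h2.le (abs_nonneg _) zero_le_one
      _ = ε / 2 := one_mul _
  rw [h3]
  refine (abs_sub _ _).trans ?_
  linarith [hqa u hu]

/-! ### Orthogonality, completeness and Parseval's identity for the sine modes -/

theorem integral_cos_pi_mul_int (k : ℤ) :
    ∫ u in (0 : ℝ)..1, Real.cos (Real.pi * k * u) = if k = 0 then 1 else 0 := by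
  split_ifs with hk
  · simp [hk]
  · have hk' : Real.pi * k ≠ 0 := mul_ne_zero Real.pi_ne_zero (by exact_mod_cast hk)
    rw [intervalIntegral.integral_comp_mul_left (fun u => Real.cos u) hk', integral_cos,
      mul_one, mul_zero, Real.sin_zero, mul_comm, Real.sin_int_mul_pi, sub_zero, smul_zero]

theorem integral_sineMode_mul (i j : ℕ) :
    ∫ u in (0 : ℝ)..1, sineMode i u * sineMode j u = if i = j then 1 / 2 else 0 := by
  have h : ∀ u : ℝ, sineMode i u * sineMode j u =
      (1 / 2) * Real.cos (Real.pi * ((i : ℤ) - j : ℤ) * u) -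
        (1 / 2) * Real.cos (Real.pi * ((i : ℤ) + j + 2 : ℤ) * u) := by
    intro u
    have h1 : Real.pi * ((i : ℤ) - j : ℤ) * u = Real.pi * (i + 1) * u - Real.pi * (j + 1) * u := by
      push_cast; ring
    have h2 : Real.pi * ((i : ℤ) + j + 2 : ℤ) * u =
      Real.pi * (i + 1) * u + Real.pi * (j + 1) * u := by push_cast; ring
    rw [h1, h2, Real.cos_add, Real.cos_sub, sineMode, sineMode]
    ring
  simp_rw [h]
  rw [intervalIntegral.integral_sub, intervalIntegral.integral_const_mul,
    intervalIntegral.integral_const_mul, integral_cos_pi_mul_int, integral_cos_pi_mul_int,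
    if_neg (by omega : (i : ℤ) + j + 2 ≠ 0)]
  · by_cases hij : i = j
    · simp [hij]
    · rw [if_neg hij, if_neg (by omega)]
      simp
  · exact Continuous.intervalIntegrable (by fun_prop) _ _
  · exact Continuous.intervalIntegrable (by fun_prop) _ _

/-- The sine coefficients of a function. -/
noncomputable def sineCoeff (h : ℝ → ℝ) (j : ℕ) : ℝ := 2 * ∫ u in (0 : ℝ)..1, h u * sineMode j u

/-- Orthogonality decouples the coefficients. They are kept arbitrary so that any sine polynomial
can be compared with the Fourier sum, which minimises each summand. -/
theorem integral_sq_sub_sum {h : ℝ → ℝ} (hh : Continuous h) (a : ℕ → ℝ) (J : ℕ) :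
    ∫ u in (0 : ℝ)..1, (h u - ∑ j ∈ Finset.range J, a j * sineMode j u) ^ 2 =
      (∫ u in (0 : ℝ)..1, h u ^ 2) +
        ∑ j ∈ Finset.range J, (a j ^ 2 / 2 - a j * sineCoeff h j) := by
  have hSc : ∀ J, Continuous fun u => ∑ j ∈ Finset.range J, a j * sineMode j u := fun J =>
    continuous_finsetSum _ fun j _ => (continuous_sineMode j).const_mul _
  induction J with
  | zero => simp
  | succ J ih =>
    have h1 : ∫ u in (0 : ℝ)..1, (h u - ∑ j ∈ Finset.range J, a j * sineMode j u) * sineMode J u =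
        sineCoeff h J / 2 := by
      simp_rw [sub_mul, Finset.sum_mul]
      rw [intervalIntegral.integral_sub, intervalIntegral.integral_finsetSum]
      · simp_rw [mul_assoc, intervalIntegral.integral_const_mul, integral_sineMode_mul]
        rw [Finset.sum_eq_zero, sineCoeff]
        · ring
        · intro j hj
          rw [if_neg (Finset.mem_range.1 hj).ne, mul_zero]
      · exact fun j _ => Continuous.intervalIntegrable (by fun_prop) _ _
      · exact Continuous.intervalIntegrable (by fun_prop) _ _
      · exact Continuous.intervalIntegrable (by fun_prop) _ _
    have h2 : ∀ u, (h u - ∑ j ∈ Finset.range (J + 1), a j * sineMode j u) ^ 2 =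
        (h u - ∑ j ∈ Finset.range J, a j * sineMode j u) ^ 2 -
        2 * a J * ((h u - ∑ j ∈ Finset.range J, a j * sineMode j u) * sineMode J u) +
        a J ^ 2 * (sineMode J u * sineMode J u) := by
      intro u
      rw [Finset.sum_range_succ]
      ring
    simp_rw [h2]
    have hR := hh.sub (hSc J)
    rw [intervalIntegral.integral_add, intervalIntegral.integral_sub,
      intervalIntegral.integral_const_mul, intervalIntegral.integral_const_mul, h1, ih,
      integral_sineMode_mul, if_pos rfl, Finset.sum_range_succ]
    · ring
    · exact (hR.pow 2).intervalIntegrable _ _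
    · exact ((hR.mul (continuous_sineMode J)).const_mul _).intervalIntegrable _ _
    · exact ((hR.pow 2).sub ((hR.mul (continuous_sineMode J)).const_mul _)).intervalIntegrable _ _
    · exact Continuous.intervalIntegrable (by fun_prop) _ _

theorem exists_eq_sum_of_mem_span {F : ℝ → ℝ} (hF : F ∈ Submodule.span ℝ (range sineMode)) :
    ∃ (J : ℕ) (a : ℕ → ℝ), ∀ u, F u = ∑ j ∈ Finset.range J, a j * sineMode j u := by
  obtain ⟨c, rfl⟩ := Finsupp.mem_span_range_iff_exists_finsupp.1 hF
  obtain ⟨J, hJ⟩ := c.support.exists_nat_subset_range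
  refine ⟨J, c, fun u => ?_⟩
  rw [Finsupp.sum_of_support_subset c hJ _ (by simp), Finset.sum_apply]
  rfl

/-- A function that does not vanish at the end points is multiplied by the cut-off `s/(s +
1/(k+1))`, with `s = |sin(πu)|`. By dominated convergence this costs little in `L²`, and the result
is a uniform limit of sine polynomials. -/
theorem exists_integral_sq_sub_sum_le {h : ℝ → ℝ} (hh : Continuous h) {ε : ℝ} (hε : 0 < ε) :
    ∃ (J : ℕ) (a : ℕ → ℝ),
      ∫ u in (0 : ℝ)..1, (h u - ∑ j ∈ Finset.range J, a j * sineMode j u) ^ 2 ≤ ε := by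
  obtain ⟨M, hM⟩ := isCompact_Icc.exists_bound_of_continuousOn (s := Icc (0 : ℝ) 1) hh.continuousOn
  have hM0 : 0 ≤ M := (norm_nonneg _).trans (hM 0 (left_mem_Icc.2 zero_le_one))
  set s : ℝ → ℝ := fun u => |Real.sin (Real.pi * u)| with hs
  have hsc : Continuous s := by fun_prop
  have hpos : ∀ (k : ℕ) u, 0 < s u + 1 / ((k : ℝ) + 1) := fun k u =>
    add_pos_of_nonneg_of_pos (abs_nonneg _) (by positivity)
  set φ : ℕ → ℝ → ℝ := fun k u => h u * s u / (s u + 1 / ((k : ℝ) + 1)) with hφ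
  have hφc : ∀ k, Continuous (φ k) := fun k =>
    Continuous.div (hh.mul hsc) (hsc.add continuous_const) fun u => (hpos k u).ne'
  have hlim : Tendsto (fun k => ∫ u in (0 : ℝ)..1, (h u - φ k u) ^ 2) atTop
      (𝓝 (∫ u in (0 : ℝ)..1, (0 : ℝ))) := by
    refine intervalIntegral.tendsto_integral_filter_of_dominated_convergence (fun _ => M ^ 2)
      (Eventually.of_forall fun k => ((hh.sub (hφc k)).pow 2).aestronglyMeasurable)
      (Eventually.of_forall fun k => Eventually.of_forall fun u hu => ?_)
      intervalIntegrable_const ?_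
    · rw [uIoc_of_le zero_le_one] at hu
      have h1 := hM u ⟨hu.1.le, hu.2⟩
      have h2 : h u - φ k u = h u * ((1 / ((k : ℝ) + 1)) / (s u + 1 / ((k : ℝ) + 1))) := by
        have := (hpos k u).ne'
        simp only [hφ]
        rw [← sub_eq_zero]
        generalize 1 / ((k : ℝ) + 1) = δ at *
        field_simp
        ring
      have h4 : 0 ≤ (1 / ((k : ℝ) + 1)) / (s u + 1 / ((k : ℝ) + 1)) :=
        div_nonneg (by positivity) (hpos k u).le
      have h3 : (1 / ((k : ℝ) + 1)) / (s u + 1 / ((k : ℝ) + 1)) ≤ 1 := by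
        rw [div_le_one (hpos k u)]
        have : 0 ≤ s u := abs_nonneg _
        linarith
      rw [norm_pow]
      refine pow_le_pow_left₀ (norm_nonneg _) ?_ 2
      rw [h2, norm_mul, Real.norm_of_nonneg h4]
      nlinarith [norm_nonneg (h u)]
    · have hne : ∀ᵐ u : ℝ, u ≠ 1 := by simp [ae_iff]
      filter_upwards [hne] with u hu1 hu
      rw [uIoc_of_le zero_le_one] at hu
      have hlt : u < 1 := lt_of_le_of_ne hu.2 hu1
      have hsu : 0 < s u := abs_pos.2 (Real.sin_pos_of_pos_of_lt_pi (mul_pos Real.pi_pos hu.1)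
        (by nlinarith [Real.pi_pos])).ne'
      have h1 : Tendsto (fun k : ℕ => φ k u) atTop (𝓝 (h u * s u / (s u + 0))) :=
        (tendsto_const_nhds).div (tendsto_const_nhds.add tendsto_one_div_add_atTop_nhds_zero_nat)
          (by simpa using hsu.ne')
      rw [add_zero, mul_div_cancel_right₀ _ hsu.ne'] at h1
      simpa using (tendsto_const_nhds (x := h u)).sub h1 |>.pow 2
  rw [intervalIntegral.integral_zero] at hlim
  obtain ⟨k, hk⟩ := (hlim.eventually_lt_const (by positivity : 0 < ε / 4)).exists
  have hs0 : s 0 = 0 := by simp [hs]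
  have hs1 : s 1 = 0 := by simp [hs]
  obtain ⟨F, hF, hFφ⟩ := exists_mem_span_abs_sub_le (hφc k) (by simp [hφ, hs0]) (by simp [hφ, hs1])
    (ε := √(ε / 4)) (Real.sqrt_pos.2 (by positivity))
  obtain ⟨J, a, ha⟩ := exists_eq_sum_of_mem_span hF
  refine ⟨J, a, ?_⟩
  simp_rw [← ha]
  have hFc := continuous_of_mem_span hF
  calc ∫ u in (0 : ℝ)..1, (h u - F u) ^ 2
      ≤ ∫ u in (0 : ℝ)..1, (2 * (h u - φ k u) ^ 2 + 2 * (ε / 4)) := by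
        refine intervalIntegral.integral_mono_on zero_le_one
          (((hh.sub hFc).pow 2).intervalIntegrable _ _)
          (((((hh.sub (hφc k)).pow 2).const_mul 2).add continuous_const).intervalIntegrable _ _)
          fun u hu => ?_
        have h1 : (φ k u - F u) ^ 2 ≤ ε / 4 := by
          rw [← sq_abs, ← Real.sq_sqrt (by positivity : 0 ≤ ε / 4)]
          exact pow_le_pow_left₀ (abs_nonneg _) (hFφ u hu) 2
        nlinarith [sq_nonneg ((h u - φ k u) - (φ k u - F u))]
    _ = 2 * (∫ u in (0 : ℝ)..1, (h u - φ k u) ^ 2) + 2 * (ε / 4) := by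
        rw [intervalIntegral.integral_add, intervalIntegral.integral_const_mul]
        · simp
        · exact (((hh.sub (hφc k)).pow 2).const_mul 2).intervalIntegrable _ _
        · exact intervalIntegrable_const
    _ ≤ ε := by linarith

theorem integral_sq_sub_partial {h : ℝ → ℝ} (hh : Continuous h) (J : ℕ) :
    ∫ u in (0 : ℝ)..1, (h u - ∑ j ∈ Finset.range J, sineCoeff h j * sineMode j u) ^ 2 =
      (∫ u in (0 : ℝ)..1, h u ^ 2) - ∑ j ∈ Finset.range J, sineCoeff h j ^ 2 / 2 := by
  rw [integral_sq_sub_sum hh, sub_eq_add_neg, ← Finset.sum_neg_distrib]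
  congr 1
  exact Finset.sum_congr rfl fun j _ => by ring

/-- The partial sums of the sine series converge in `L²`. -/
theorem tendsto_integral_sq_sub_partial {h : ℝ → ℝ} (hh : Continuous h) :
    Tendsto (fun J => ∫ u in (0 : ℝ)..1,
      (h u - ∑ j ∈ Finset.range J, sineCoeff h j * sineMode j u) ^ 2) atTop (𝓝 0) := by
  have hnn : ∀ J, 0 ≤ ∫ u in (0 : ℝ)..1,
      (h u - ∑ j ∈ Finset.range J, sineCoeff h j * sineMode j u) ^ 2 := fun J =>
    intervalIntegral.integral_nonneg zero_le_one fun u _ => sq_nonneg _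
  rw [Metric.tendsto_atTop]
  intro ε hε
  obtain ⟨J, a, ha⟩ := exists_integral_sq_sub_sum_le hh (half_pos hε)
  refine ⟨J, fun K hK => ?_⟩
  rw [Real.dist_0_eq_abs, abs_of_nonneg (hnn K)]
  refine lt_of_le_of_lt ?_ (half_lt_self hε)
  refine le_trans ?_ ha
  rw [integral_sq_sub_partial hh, integral_sq_sub_sum hh, sub_eq_add_neg]
  gcongr
  have h1 : ∑ j ∈ Finset.range J, sineCoeff h j ^ 2 / 2 ≤
      ∑ j ∈ Finset.range K, sineCoeff h j ^ 2 / 2 :=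
    Finset.sum_le_sum_of_subset_of_nonneg (Finset.range_mono hK) fun _ _ _ => by positivity
  -- The Fourier coefficient minimises `a²/2 - a c`, with minimum `-c²/2`; hence no other sine
  -- polynomial of the same length does better.
  have h2 : -∑ j ∈ Finset.range J, sineCoeff h j ^ 2 / 2 ≤
      ∑ j ∈ Finset.range J, (a j ^ 2 / 2 - a j * sineCoeff h j) := by
    rw [← Finset.sum_neg_distrib]
    exact Finset.sum_le_sum fun j _ => by nlinarith [sq_nonneg (a j - sineCoeff h j)]
  linarith

theorem hasSum_sq_sineCoeff {h : ℝ → ℝ} (hh : Continuous h) :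
    HasSum (fun j => sineCoeff h j ^ 2 / 2) (∫ u in (0 : ℝ)..1, h u ^ 2) := by
  rw [hasSum_iff_tendsto_nat_of_nonneg fun j => by positivity]
  have h1 := (tendsto_integral_sq_sub_partial hh).const_sub (∫ u in (0 : ℝ)..1, h u ^ 2)
  simpa only [integral_sq_sub_partial hh, sub_sub_cancel, sub_zero] using h1

theorem sineCoeff_add {f g : ℝ → ℝ} (hf : Continuous f) (hg : Continuous g) (j : ℕ) :
    sineCoeff (fun u => f u + g u) j = sineCoeff f j + sineCoeff g j := by
  simp only [sineCoeff, add_mul]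
  rw [intervalIntegral.integral_add, mul_add]
  · exact Continuous.intervalIntegrable (by fun_prop) _ _
  · exact Continuous.intervalIntegrable (by fun_prop) _ _

theorem sineCoeff_sub {f g : ℝ → ℝ} (hf : Continuous f) (hg : Continuous g) (j : ℕ) :
    sineCoeff (fun u => f u - g u) j = sineCoeff f j - sineCoeff g j := by
  simp only [sineCoeff, sub_mul]
  rw [intervalIntegral.integral_sub, mul_sub]
  · exact Continuous.intervalIntegrable (by fun_prop) _ _
  · exact Continuous.intervalIntegrable (by fun_prop) _ _

/-- Parseval's identity. -/
theorem hasSum_sineCoeff_mul {f g : ℝ → ℝ} (hf : Continuous f) (hg : Continuous g) :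
    HasSum (fun j => sineCoeff f j * sineCoeff g j / 2) (∫ u in (0 : ℝ)..1, f u * g u) := by
  have e : ∀ j, sineCoeff f j * sineCoeff g j / 2 =
      (sineCoeff (fun u => f u + g u) j ^ 2 / 2 - sineCoeff (fun u => f u - g u) j ^ 2 / 2) / 4 := by
    intro j
    rw [sineCoeff_add hf hg, sineCoeff_sub hf hg]
    ring
  have i : ∫ u in (0 : ℝ)..1, f u * g u =
      ((∫ u in (0 : ℝ)..1, (f u + g u) ^ 2) - ∫ u in (0 : ℝ)..1, (f u - g u) ^ 2) / 4 := by
    rw [← intervalIntegral.integral_sub, ← intervalIntegral.integral_div]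
    · congr 1 with u
      ring
    · exact Continuous.intervalIntegrable (by fun_prop) _ _
    · exact Continuous.intervalIntegrable (by fun_prop) _ _
  simp_rw [e]
  rw [i]
  exact ((hasSum_sq_sineCoeff (hf.add hg)).sub (hasSum_sq_sineCoeff (hf.sub hg))).div_const 4

theorem summable_abs_sineCoeff_mul {f g : ℝ → ℝ} (hf : Continuous f) (hg : Continuous g) :
    Summable fun j => |sineCoeff f j * sineCoeff g j| := by
  refine Summable.of_nonneg_of_le (fun _ => abs_nonneg _) (fun j => ?_)
    ((hasSum_sq_sineCoeff hf).summable.add (hasSum_sq_sineCoeff hg).summable)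
  rw [abs_le]
  constructor <;> nlinarith [sq_nonneg (sineCoeff f j - sineCoeff g j),
    sq_nonneg (sineCoeff f j + sineCoeff g j)]

theorem exists_abs_sineCoeff_le (h : ℝ → ℝ) (hh : Continuous h) :
    ∃ C, 0 ≤ C ∧ ∀ j, |sineCoeff h j| ≤ C := by
  obtain ⟨M, hM⟩ := isCompact_Icc.exists_bound_of_continuousOn (s := Icc (0 : ℝ) 1) hh.continuousOn
  have hM0 : 0 ≤ M := (norm_nonneg _).trans (hM 0 (left_mem_Icc.2 zero_le_one))
  refine ⟨2 * M, by positivity, fun j => ?_⟩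
  rw [sineCoeff, abs_mul, abs_two]
  refine mul_le_mul_of_nonneg_left ?_ zero_le_two
  have h1 := intervalIntegral.norm_integral_le_of_norm_le_const (a := (0 : ℝ)) (b := 1)
    (f := fun u => h u * sineMode j u) (C := M) fun u hu => ?_
  · simpa using h1
  · rw [uIoc_of_le zero_le_one] at hu
    rw [norm_mul]
    calc _ ≤ M * 1 := mul_le_mul (hM u ⟨hu.1.le, hu.2⟩) (abs_sineMode_le j u) (abs_nonneg _) hM0
      _ = M := mul_one M

end HarmonicChain

namespace HarmonicChain

/-! ### The macroscopic profile -/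

/-- The decay rates of the Dirichlet eigenfunctions under the heat flow. -/
noncomputable def heatRate (γ : ℝ) (j : ℕ) : ℝ := (Real.pi * (j + 1)) ^ 2 / (2 * γ)

/-- The exponentially weighted trigonometric series with coefficients `d` and phase `ψ`. -/
noncomputable def heatSeries (γ : ℝ) (d : ℕ → ℝ) (ψ : ℝ) (z : ℝ × ℝ) : ℝ :=
  ∑' j, d j * Real.exp (-(heatRate γ j * z.1)) * Real.sin (Real.pi * (j + 1) * z.2 + ψ)

theorem heatRate_pos {γ : ℝ} (hγ : 0 < γ) (j : ℕ) : 0 < heatRate γ j := by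
  have := Real.pi_pos
  rw [heatRate]
  positivity

/-- Sequences of polynomial growth. -/
def PolyGrowth (d : ℕ → ℝ) : Prop := ∃ C : ℝ, ∃ m : ℕ, ∀ j, |d j| ≤ C * ((j : ℝ) + 1) ^ m

theorem PolyGrowth.mul {d e : ℕ → ℝ} (hd : PolyGrowth d) (he : PolyGrowth e) :
    PolyGrowth fun j => d j * e j := by
  obtain ⟨C, m, h⟩ := hd
  obtain ⟨C', m', h'⟩ := he
  refine ⟨C * C', m + m', fun j => ?_⟩
  rw [abs_mul]
  calc |d j| * |e j| ≤ (C * ((j : ℝ) + 1) ^ m) * (C' * ((j : ℝ) + 1) ^ m') :=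
        mul_le_mul (h j) (h' j) (abs_nonneg _) ((abs_nonneg _).trans (h j))
    _ = _ := by ring

theorem polyGrowth_freq : PolyGrowth fun j => Real.pi * (j + 1) :=
  ⟨Real.pi, 1, fun j => by
    rw [abs_of_nonneg (mul_nonneg Real.pi_pos.le (by positivity)), pow_one]⟩

theorem polyGrowth_heatRate {γ : ℝ} (hγ : 0 < γ) : PolyGrowth fun j => -heatRate γ j :=
  ⟨Real.pi ^ 2 / (2 * γ), 2, fun j => by
    rw [abs_neg, abs_of_pos (heatRate_pos hγ j), heatRate]
    apply le_of_eq
    ring⟩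

theorem PolyGrowth.summable {γ : ℝ} (hγ : 0 < γ) {d : ℕ → ℝ} (hd : PolyGrowth d) {a : ℝ}
    (ha : 0 < a) : Summable fun j => |d j| * Real.exp (-(heatRate γ j * a)) := by
  obtain ⟨C, m, h⟩ := hd
  have hr : 0 < Real.pi ^ 2 / (2 * γ) * a := by
    have := Real.pi_pos
    positivity
  have h1 := (Real.summable_pow_mul_exp_neg_nat_mul m hr).comp_injective (add_left_injective 1)
  refine Summable.of_nonneg_of_le (fun j => by positivity) (fun j => ?_) (h1.mul_left C)
  simp only [Function.comp_apply]
  rw [← mul_assoc]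
  push_cast
  refine mul_le_mul (h j) ?_ (Real.exp_pos _).le ((abs_nonneg _).trans (h j))
  rw [Real.exp_le_exp, heatRate]
  have h2 : ((j : ℝ) + 1) ≤ ((j : ℝ) + 1) ^ 2 := by nlinarith [(Nat.cast_nonneg j : (0 : ℝ) ≤ j)]
  have h3 := mul_le_mul_of_nonneg_left h2 hr.le
  calc -((Real.pi * (j + 1)) ^ 2 / (2 * γ) * a) = -(Real.pi ^ 2 / (2 * γ) * a * ((j : ℝ) + 1) ^ 2) := by
        ring
    _ ≤ _ := by linarith

/-- The family is closed under differentiation: `∂_t` multiplies the coefficients by minus the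
rates, while `∂_u` multiplies them by the frequencies and shifts the phase by `π/2`. Both preserve
polynomial growth, so the exponential weight at half the time dominates all terms near `z`. -/
theorem hasFDerivAt_heatSeries {γ : ℝ} (hγ : 0 < γ) {d : ℕ → ℝ} (hd : PolyGrowth d) (ψ : ℝ)
    {z : ℝ × ℝ} (hz : 0 < z.1) : HasFDerivAt (heatSeries γ d ψ)
      (heatSeries γ (fun j => d j * -heatRate γ j) ψ z • ContinuousLinearMap.fst ℝ ℝ ℝ +
        heatSeries γ (fun j => d j * (Real.pi * (j + 1))) (ψ + Real.pi / 2) z •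
          ContinuousLinearMap.snd ℝ ℝ ℝ) z := by
  have hd1 := hd.mul (polyGrowth_heatRate hγ)
  have hd2 := hd.mul polyGrowth_freq
  set a := z.1 / 2 with ha
  have ha0 : 0 < a := half_pos hz
  set s : Set (ℝ × ℝ) := Ioi a ×ˢ univ with hs
  have hso : IsOpen s := isOpen_Ioi.prod isOpen_univ
  have hsc : IsPreconnected s := ((convex_Ioi a).prod convex_univ).isPreconnected
  have hzs : z ∈ s := ⟨half_lt_self hz, mem_univ _⟩
  have hexp : ∀ j, ∀ w ∈ s, Real.exp (-(heatRate γ j * w.1)) ≤ Real.exp (-(heatRate γ j * a)) := by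
    intro j w hw
    rw [Real.exp_le_exp, neg_le_neg_iff]
    exact mul_le_mul_of_nonneg_left (le_of_lt hw.1) (heatRate_pos hγ j).le
  have hbd : ∀ (e : ℕ → ℝ) (θ : ℝ) j, ∀ w ∈ s,
      ‖e j * Real.exp (-(heatRate γ j * w.1)) * Real.sin (Real.pi * (j + 1) * w.2 + θ)‖ ≤
      |e j| * Real.exp (-(heatRate γ j * a)) := by
    intro e θ j w hw
    rw [Real.norm_eq_abs, abs_mul, abs_mul, Real.abs_exp]
    calc _ ≤ |e j| * Real.exp (-(heatRate γ j * a)) * 1 := by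
          refine mul_le_mul ?_ (Real.abs_sin_le_one _) (abs_nonneg _) (by positivity)
          exact mul_le_mul_of_nonneg_left (hexp j w hw) (abs_nonneg _)
      _ = _ := mul_one _
  have hsum : ∀ (e : ℕ → ℝ) (θ : ℝ), PolyGrowth e → ∀ w ∈ s, Summable fun j =>
      e j * Real.exp (-(heatRate γ j * w.1)) * Real.sin (Real.pi * (j + 1) * w.2 + θ) :=
    fun e θ he w hw => Summable.of_norm_bounded (he.summable hγ ha0) fun j => hbd e θ j w hw
  have hterm : ∀ j, ∀ w ∈ s, HasFDerivAt (fun w : ℝ × ℝ =>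
      d j * Real.exp (-(heatRate γ j * w.1)) * Real.sin (Real.pi * (j + 1) * w.2 + ψ))
      ((d j * -heatRate γ j * Real.exp (-(heatRate γ j * w.1)) *
        Real.sin (Real.pi * (j + 1) * w.2 + ψ)) • ContinuousLinearMap.fst ℝ ℝ ℝ +
      (d j * (Real.pi * (j + 1)) * Real.exp (-(heatRate γ j * w.1)) *
        Real.sin (Real.pi * (j + 1) * w.2 + (ψ + Real.pi / 2))) •
          ContinuousLinearMap.snd ℝ ℝ ℝ) w := by
    intro j w _
    have h1 : HasFDerivAt (fun w : ℝ × ℝ => Real.exp (-(heatRate γ j * w.1))) _ w :=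
      ((hasFDerivAt_fst.const_mul (heatRate γ j)).neg).exp
    have h2 : HasFDerivAt (fun w : ℝ × ℝ => Real.sin (Real.pi * (j + 1) * w.2 + ψ)) _ w :=
      ((hasFDerivAt_snd.const_mul (Real.pi * (j + 1))).add_const ψ).sin
    refine ((h1.const_mul (d j)).mul h2).congr_fderiv ?_
    rw [← add_assoc, Real.sin_add_pi_div_two]
    ext <;> simp <;> ring
  have key := hasFDerivAt_tsum_of_isPreconnected ((hd1.summable hγ ha0).add (hd2.summable hγ ha0))
    hso hsc hterm (fun j w hw => ?_) hzs (hsum d ψ hd z hzs) hzs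
  · refine key.congr_fderiv ?_
    have s1 := hsum _ ψ hd1 z hzs
    have s2 := hsum _ (ψ + Real.pi / 2) hd2 z hzs
    rw [Summable.tsum_add (s1.smul_const _) (s2.smul_const _), s1.tsum_smul_const,
      s2.tsum_smul_const]
    rfl
  · refine (norm_add_le _ _).trans (add_le_add ?_ ?_)
    · rw [norm_smul]
      refine (mul_le_of_le_one_right (norm_nonneg _) (ContinuousLinearMap.norm_fst_le ℝ ℝ ℝ)).trans ?_
      exact hbd (fun j => d j * -heatRate γ j) ψ j w hw
    · rw [norm_smul]
      refine (mul_le_of_le_one_right (norm_nonneg _) (ContinuousLinearMap.norm_snd_le ℝ ℝ ℝ)).trans ?_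
      exact hbd (fun j => d j * (Real.pi * (j + 1))) _ j w hw

/-- Induction on the order for all coefficients and phases at once, since the derivative is made of
two series of the same kind. -/
theorem contDiffOn_heatSeries {γ : ℝ} (hγ : 0 < γ) {d : ℕ → ℝ} (hd : PolyGrowth d) (ψ : ℝ) :
    ContDiffOn ℝ (⊤ : ℕ∞) (heatSeries γ d ψ) (Ioi 0 ×ˢ univ) := by
  have hso : IsOpen (Ioi (0 : ℝ) ×ˢ (univ : Set ℝ)) := isOpen_Ioi.prod isOpen_univ
  rw [contDiffOn_infty]
  intro n
  induction n generalizing d ψ with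
  | zero =>
    exact contDiffOn_zero.2 fun z hz =>
      (hasFDerivAt_heatSeries hγ hd ψ hz.1).continuousAt.continuousWithinAt
  | succ n ih =>
    push_cast
    rw [contDiffOn_succ_iff_fderiv_of_isOpen hso]
    refine ⟨fun z hz => (hasFDerivAt_heatSeries hγ hd ψ hz.1).differentiableAt.differentiableWithinAt,
      fun h => absurd h (by simp), ?_⟩
    refine ContDiffOn.congr ?_ fun z hz => (hasFDerivAt_heatSeries hγ hd ψ hz.1).fderiv
    exact ((ih (hd.mul (polyGrowth_heatRate hγ)) ψ).smul contDiffOn_const).add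
      ((ih (hd.mul polyGrowth_freq) _).smul contDiffOn_const)

/-- The solution of the heat equation on the unit interval with the boundary values `0` and `Fbar`,
started from the profile `Fbar u + ∑ c_j sin (π (j + 1) u)`. -/
noncomputable def heatProfile (γ Fbar : ℝ) (c : ℕ → ℝ) (t u : ℝ) : ℝ :=
  Fbar * u + ∑' j, c j * Real.exp (-(heatRate γ j * t)) * sineMode j u

theorem heatProfile_eq (γ Fbar : ℝ) (c : ℕ → ℝ) (t u : ℝ) :
    heatProfile γ Fbar c t u = Fbar * u + heatSeries γ c 0 (t, u) := by
  simp only [heatProfile, heatSeries, add_zero, sineMode]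

theorem contDiffOn_heatProfile {γ : ℝ} (hγ : 0 < γ) (Fbar : ℝ) {c : ℕ → ℝ} (hc : PolyGrowth c) :
    ContDiffOn ℝ (⊤ : ℕ∞) (Function.uncurry (heatProfile γ Fbar c)) (Ioi 0 ×ˢ Icc 0 1) := by
  have h1 : Function.uncurry (heatProfile γ Fbar c) = fun z => Fbar * z.2 + heatSeries γ c 0 z := by
    ext ⟨t, u⟩
    exact heatProfile_eq γ Fbar c t u
  rw [h1]
  exact ((contDiff_const.mul contDiff_snd).contDiffOn.add (contDiffOn_heatSeries hγ hc 0)).mono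
    (prod_mono le_rfl (subset_univ _))

theorem polyGrowth_sineCoeff {h : ℝ → ℝ} (hh : Continuous h) : PolyGrowth (sineCoeff h) := by
  obtain ⟨C, _, hC⟩ := exists_abs_sineCoeff_le h hh
  exact ⟨C, 0, fun j => by simpa using hC j⟩

theorem continuous_heatProfile {γ : ℝ} (hγ : 0 < γ) (Fbar : ℝ) {c : ℕ → ℝ} (hc : PolyGrowth c)
    {t : ℝ} (ht : 0 < t) : Continuous (heatProfile γ Fbar c t) := by
  refine continuous_iff_continuousAt.2 fun u => ?_
  simp_rw [funext (heatProfile_eq γ Fbar c t)]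
  refine ContinuousAt.add (by fun_prop) ?_
  exact (hasFDerivAt_heatSeries hγ hc 0 (z := (t, u)) ht).continuousAt.comp
    (f := fun u => (t, u)) (by fun_prop)

theorem integral_mul_heatProfile {γ : ℝ} (hγ : 0 < γ) (Fbar : ℝ) {c : ℕ → ℝ} (hc : PolyGrowth c)
    {t : ℝ} (ht : 0 < t) {f : ℝ → ℝ} (hf : Continuous f) :
    ∫ u in (0 : ℝ)..1, f u * heatProfile γ Fbar c t u =
      Fbar * (∫ u in (0 : ℝ)..1, f u * u) +
        ∑' j, c j * sineCoeff f j / 2 * Real.exp (-(heatRate γ j * t)) := by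
  obtain ⟨M, hM⟩ := isCompact_Icc.exists_bound_of_continuousOn (s := Icc (0 : ℝ) 1) hf.continuousOn
  have hs := hc.summable hγ ht
  have hterm : ∀ j u, |c j * Real.exp (-(heatRate γ j * t)) * sineMode j u| ≤
      |c j| * Real.exp (-(heatRate γ j * t)) := fun j u => by
    rw [abs_mul, abs_mul, Real.abs_exp]
    exact mul_le_of_le_one_right (by positivity) (abs_sineMode_le j u)
  have hsum : ∀ u, Summable fun j => c j * Real.exp (-(heatRate γ j * t)) * sineMode j u := fun u =>
    Summable.of_norm_bounded hs fun j => hterm j u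
  have h1 := intervalIntegral.hasSum_integral_of_dominated_convergence (μ := volume) (a := 0) (b := 1)
    (F := fun j u => f u * (c j * Real.exp (-(heatRate γ j * t)) * sineMode j u))
    (f := fun u => f u * ∑' j, c j * Real.exp (-(heatRate γ j * t)) * sineMode j u)
    (fun j _ => M * (|c j| * Real.exp (-(heatRate γ j * t))))
    (fun j => Continuous.aestronglyMeasurable (by fun_prop))
    (fun j => Eventually.of_forall fun u hu => ?_)
    (Eventually.of_forall fun u _ => hs.mul_left M) intervalIntegrable_const
    (Eventually.of_forall fun u _ => (hsum u).hasSum.mul_left (f u))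
  · have h2 : ∀ j, ∫ u in (0 : ℝ)..1, f u * (c j * Real.exp (-(heatRate γ j * t)) * sineMode j u) =
        c j * sineCoeff f j / 2 * Real.exp (-(heatRate γ j * t)) := by
      intro j
      have e : ∀ u, f u * (c j * Real.exp (-(heatRate γ j * t)) * sineMode j u) =
          c j * Real.exp (-(heatRate γ j * t)) * (f u * sineMode j u) := fun u => by ring
      simp_rw [e]
      rw [intervalIntegral.integral_const_mul, sineCoeff]
      ring
    simp_rw [h2] at h1
    rw [h1.tsum_eq, ← intervalIntegral.integral_const_mul, ← intervalIntegral.integral_add]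
    · congr 1 with u
      rw [heatProfile]
      ring
    · exact Continuous.intervalIntegrable (by fun_prop) _ _
    · have e : ∀ u, f u * ∑' j, c j * Real.exp (-(heatRate γ j * t)) * sineMode j u =
          f u * (heatProfile γ Fbar c t u - Fbar * u) := fun u => by rw [heatProfile]; ring
      simp_rw [e]
      have := continuous_heatProfile hγ Fbar hc ht
      exact Continuous.intervalIntegrable (by fun_prop) _ _
  · rw [uIoc_of_le zero_le_one] at hu
    rw [norm_mul]
    exact mul_le_mul (hM u ⟨hu.1.le, hu.2⟩) (hterm j u) (norm_nonneg _)
      ((norm_nonneg _).trans (hM u ⟨hu.1.le, hu.2⟩))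

/-- The profile at all times, with the given continuous profile `ρ` at time `0`. -/
noncomputable def profile (γ Fbar : ℝ) (ρ : ℝ → ℝ) (t u : ℝ) : ℝ :=
  if t = 0 then ρ u else heatProfile γ Fbar (sineCoeff fun u => ρ u - Fbar * u) t u

theorem continuous_profile {γ : ℝ} (hγ : 0 < γ) (Fbar : ℝ) {ρ : ℝ → ℝ} (hρ : Continuous ρ) {t : ℝ}
    (ht : 0 ≤ t) : Continuous (profile γ Fbar ρ t) := by
  rcases ht.eq_or_lt with rfl | h
  · have e : profile γ Fbar ρ 0 = ρ := funext fun u => if_pos rfl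
    rwa [e]
  · have e : profile γ Fbar ρ t = heatProfile γ Fbar (sineCoeff fun u => ρ u - Fbar * u) t :=
      funext fun u => if_neg h.ne'
    rw [e]
    exact continuous_heatProfile hγ Fbar
      (polyGrowth_sineCoeff (hρ.sub (continuous_const.mul continuous_id))) h

/-- The series need not converge pointwise at time `0`, so the profile is prescribed there. Its
integrals against continuous functions still follow the same formula, by Parseval's identity, which
gives weak continuity down to `t = 0`. -/
theorem integral_mul_profile {γ : ℝ} (hγ : 0 < γ) (Fbar : ℝ) {ρ : ℝ → ℝ} (hρ : Continuous ρ) {t : ℝ}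
    (ht : 0 ≤ t) {f : ℝ → ℝ} (hf : Continuous f) :
    ∫ u in (0 : ℝ)..1, f u * profile γ Fbar ρ t u = Fbar * (∫ u in (0 : ℝ)..1, f u * u) +
      ∑' j, sineCoeff (fun u => ρ u - Fbar * u) j * sineCoeff f j / 2 *
        Real.exp (-(heatRate γ j * t)) := by
  have hh : Continuous fun u => ρ u - Fbar * u := by fun_prop
  rcases ht.eq_or_lt with rfl | h
  · simp only [mul_zero, neg_zero, Real.exp_zero, mul_one]
    rw [(hasSum_sineCoeff_mul hh hf).tsum_eq, ← intervalIntegral.integral_const_mul,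
      ← intervalIntegral.integral_add]
    · congr 1 with u
      rw [profile, if_pos rfl]
      ring
    · exact Continuous.intervalIntegrable (by fun_prop) _ _
    · exact Continuous.intervalIntegrable (by fun_prop) _ _
  · rw [← integral_mul_heatProfile hγ Fbar (polyGrowth_sineCoeff hh) h hf]
    congr 1 with u
    rw [profile, if_neg h.ne']

theorem abs_mul_exp_le {γ : ℝ} (hγ : 0 < γ) {t : ℝ} (ht : 0 ≤ t) (a : ℝ) (j : ℕ) :
    ‖a / 2 * Real.exp (-(heatRate γ j * t))‖ ≤ |a| / 2 := by
  rw [Real.norm_eq_abs, abs_mul, Real.abs_exp, abs_div, abs_two]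
  refine mul_le_of_le_one_right (by positivity) (Real.exp_le_one_iff.2 ?_)
  have := mul_nonneg (heatRate_pos hγ j).le ht
  linarith

theorem continuous_integral_mul_profile {γ : ℝ} (hγ : 0 < γ) (Fbar : ℝ) {ρ : ℝ → ℝ}
    (hρ : Continuous ρ) {f : ℝ → ℝ} (hf : Continuous f) :
    Continuous fun t : ℝ≥0 => ∫ u in (0 : ℝ)..1, f u * profile γ Fbar ρ t u := by
  have hh : Continuous fun u => ρ u - Fbar * u := by fun_prop
  simp_rw [fun t : ℝ≥0 => integral_mul_profile hγ Fbar hρ t.coe_nonneg hf]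
  refine continuous_const.add (continuous_tsum (fun j => by fun_prop)
    ((summable_abs_sineCoeff_mul hh hf).div_const 2) fun j t =>
      abs_mul_exp_le hγ t.coe_nonneg _ j)

/-- The profile solves the heat equation in the weak sense. -/
theorem integral_mul_profile_sub {γ : ℝ} (hγ : 0 < γ) (Fbar : ℝ) {ρ : ℝ → ℝ} (hρ : Continuous ρ)
    {φ φ' φ'' : ℝ → ℝ} (hφ : Continuous φ) (hφ'c : ContinuousOn φ' (Icc 0 1))
    (hφ'' : Continuous φ'') (h0 : φ 0 = 0) (h1 : φ 1 = 0)
    (hd : ∀ u ∈ Ioo (0 : ℝ) 1, HasDerivAt φ (φ' u) u)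
    (hd' : ∀ u ∈ Ioo (0 : ℝ) 1, HasDerivAt φ' (φ'' u) u) {t : ℝ} (ht : 0 ≤ t) :
    (∫ u in (0 : ℝ)..1, φ u * profile γ Fbar ρ t u) - ∫ u in (0 : ℝ)..1, φ u * ρ u =
      1 / (2 * γ) * (∫ s in (0 : ℝ)..t, ∫ u in (0 : ℝ)..1, φ'' u * profile γ Fbar ρ s u) -
      Fbar * t / (2 * γ) * φ' 1 := by
  have hh : Continuous fun u => ρ u - Fbar * u := by fun_prop
  set c := sineCoeff fun u => ρ u - Fbar * u with hc
  have hIcc : uIcc (0 : ℝ) 1 = Icc 0 1 := uIcc_of_le zero_le_one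
  have hmin : Ioo (min (0 : ℝ) 1) (max 0 1) = Ioo 0 1 := by simp
  have hφ'i : IntervalIntegrable φ' volume 0 1 := (hIcc ▸ hφ'c).intervalIntegrable
  have hint : ∫ u in (0 : ℝ)..1, φ' u = 0 := by
    rw [intervalIntegral.integral_eq_sub_of_hasDerivAt_of_le zero_le_one hφ.continuousOn hd hφ'i,
      h0, h1, sub_zero]
  -- The stationary part `F̄ u`, tested against `φ''`, produces exactly the boundary term of the
  -- weak formulation.
  have hlin : ∫ u in (0 : ℝ)..1, φ'' u * u = φ' 1 := by
    have e := intervalIntegral.integral_mul_deriv_eq_deriv_mul_of_hasDerivAt (a := 0) (b := 1)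
      (u := fun u => u) (v := φ') (u' := fun _ => 1) (v' := φ'') continuousOn_id (hIcc ▸ hφ'c)
      (fun u _ => hasDerivAt_id u) (hmin ▸ hd') intervalIntegrable_const
      (hφ''.intervalIntegrable _ _)
    simp only [one_mul, zero_mul, sub_zero, hint] at e
    simpa only [mul_comm] using e
  -- Two integrations by parts; the boundary terms vanish because both `φ` and the sine mode vanish
  -- at the end points.
  have hcoeff : ∀ j, sineCoeff φ'' j = -(Real.pi * (j + 1)) ^ 2 * sineCoeff φ j := by
    intro j
    have hds : ∀ u, HasDerivAt (sineMode j)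
        (Real.pi * (j + 1) * Real.cos (Real.pi * (j + 1) * u)) u := fun u => by
      have := ((hasDerivAt_id u).const_mul (Real.pi * (j + 1))).sin
      simp only [id, mul_one] at this
      rw [mul_comm]
      exact this
    have hdc : ∀ u, HasDerivAt (fun u => Real.pi * (j + 1) * Real.cos (Real.pi * (j + 1) * u))
        (-(Real.pi * (j + 1)) ^ 2 * sineMode j u) u := fun u => by
      have := (((hasDerivAt_id u).const_mul (Real.pi * (j + 1))).cos).const_mul (Real.pi * (j + 1))
      simp only [id, mul_one] at this
      refine this.congr_deriv ?_
      rw [sineMode]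
      ring
    have hs0 : sineMode j 0 = 0 := by simp [sineMode]
    have hs1 : sineMode j 1 = 0 := by
      have := Real.sin_nat_mul_pi (j + 1)
      rw [sineMode, mul_one, mul_comm]
      exact_mod_cast this
    have e1 := intervalIntegral.integral_mul_deriv_eq_deriv_mul_of_hasDerivAt (a := 0) (b := 1)
      (u := sineMode j) (v := φ') (v' := φ'')
      (u' := fun u => Real.pi * (j + 1) * Real.cos (Real.pi * (j + 1) * u))
      (continuous_sineMode j).continuousOn (hIcc ▸ hφ'c) (fun u _ => hds u) (hmin ▸ hd')
      (Continuous.intervalIntegrable (by fun_prop) _ _) (hφ''.intervalIntegrable _ _)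
    have e2 := intervalIntegral.integral_mul_deriv_eq_deriv_mul_of_hasDerivAt (a := 0) (b := 1)
      (u := fun u => Real.pi * (j + 1) * Real.cos (Real.pi * (j + 1) * u)) (v := φ) (v' := φ')
      (u' := fun u => -(Real.pi * (j + 1)) ^ 2 * sineMode j u)
      (by fun_prop) hφ.continuousOn (fun u _ => hdc u) (hmin ▸ hd)
      (Continuous.intervalIntegrable (by fun_prop) _ _) hφ'i
    rw [hs0, hs1, e2, h0, h1] at e1
    simp only [mul_assoc, intervalIntegral.integral_const_mul] at e1
    have e3 : ∀ f : ℝ → ℝ, ∫ u in (0 : ℝ)..1, f u * sineMode j u =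
      ∫ u in (0 : ℝ)..1, sineMode j u * f u := fun f => by simp only [mul_comm]
    rw [sineCoeff, sineCoeff, e3, e3, e1]
    ring
  have hs := summable_abs_sineCoeff_mul hh hφ''
  have hint2 : (∫ s in (0 : ℝ)..t, ∫ u in (0 : ℝ)..1, φ'' u * profile γ Fbar ρ s u) =
      Fbar * φ' 1 * t + ∑' j, c j * sineCoeff φ'' j / 2 *
        ((1 - Real.exp (-(heatRate γ j * t))) / heatRate γ j) := by
    have e1 : (∫ s in (0 : ℝ)..t, ∫ u in (0 : ℝ)..1, φ'' u * profile γ Fbar ρ s u) =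
        ∫ s in (0 : ℝ)..t, (Fbar * φ' 1 +
          ∑' j, c j * sineCoeff φ'' j / 2 * Real.exp (-(heatRate γ j * s))) := by
      refine intervalIntegral.integral_congr fun s hs => ?_
      rw [uIcc_of_le ht] at hs
      rw [integral_mul_profile hγ Fbar hρ hs.1 hφ'', hlin]
    have hs2 := hs.div_const 2
    have e2 := intervalIntegral.hasSum_integral_of_dominated_convergence (μ := volume) (a := 0)
      (b := t) (F := fun j s => c j * sineCoeff φ'' j / 2 * Real.exp (-(heatRate γ j * s)))
      (f := fun s => ∑' j, c j * sineCoeff φ'' j / 2 * Real.exp (-(heatRate γ j * s)))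
      (fun j _ => |c j * sineCoeff φ'' j| / 2)
      (fun j => Continuous.aestronglyMeasurable (by fun_prop))
      (fun j => Eventually.of_forall fun s hs => by
        rw [uIoc_of_le ht] at hs
        exact abs_mul_exp_le hγ hs.1.le _ j)
      (Eventually.of_forall fun _ _ => hs2) intervalIntegrable_const
      (Eventually.of_forall fun s hs => by
        rw [uIoc_of_le ht] at hs
        exact (Summable.of_norm_bounded hs2 fun j => abs_mul_exp_le hγ hs.1.le _ j).hasSum)
    have e3 : ∀ j, ∫ s in (0 : ℝ)..t, c j * sineCoeff φ'' j / 2 * Real.exp (-(heatRate γ j * s)) =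
        c j * sineCoeff φ'' j / 2 * ((1 - Real.exp (-(heatRate γ j * t))) / heatRate γ j) := by
      intro j
      have hr := (heatRate_pos hγ j).ne'
      rw [intervalIntegral.integral_const_mul]
      congr 1
      have e4 : ∀ s ∈ uIcc 0 t, HasDerivAt (fun s => -Real.exp (-(heatRate γ j * s)) / heatRate γ j)
          (Real.exp (-(heatRate γ j * s))) s := fun s _ => by
        have := ((((hasDerivAt_id s).const_mul (heatRate γ j)).neg).exp.neg).div_const (heatRate γ j)
        refine this.congr_deriv ?_
        simp only [id, mul_one, Pi.neg_apply]
        field_simp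
      rw [intervalIntegral.integral_eq_sub_of_hasDerivAt e4
        (Continuous.intervalIntegrable (by fun_prop) _ _)]
      simp
      ring
    rw [e1, intervalIntegral.integral_add intervalIntegrable_const, ← e2.tsum_eq]
    · simp only [e3]
      simp
      ring
    · have hc : ContinuousOn (fun s => ∑' j, c j * sineCoeff φ'' j / 2 *
          Real.exp (-(heatRate γ j * s))) (uIcc 0 t) := by
        refine continuousOn_tsum (fun j => by fun_prop) hs2 fun j s hs => ?_
        rw [uIcc_of_le ht] at hs
        exact abs_mul_exp_le hγ hs.1 _ j
      exact hc.intervalIntegrable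
  have hsφ := (summable_abs_sineCoeff_mul hh hφ).div_const 2
  have hS : Summable fun j => c j * sineCoeff φ j / 2 * Real.exp (-(heatRate γ j * t)) :=
    Summable.of_norm_bounded hsφ fun j => abs_mul_exp_le hγ ht _ j
  have hP : HasSum (fun j => c j * sineCoeff φ j / 2) _ := hasSum_sineCoeff_mul hh hφ
  have hinit : ∫ u in (0 : ℝ)..1, φ u * ρ u =
      Fbar * (∫ u in (0 : ℝ)..1, φ u * u) + ∑' j, c j * sineCoeff φ j / 2 := by
    rw [hP.tsum_eq, ← intervalIntegral.integral_const_mul, ← intervalIntegral.integral_add]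
    · congr 1 with u
      ring
    · exact Continuous.intervalIntegrable (by fun_prop) _ _
    · exact Continuous.intervalIntegrable (by fun_prop) _ _
  -- The factor `-(π(j+1))²` from the second derivative divided by the heat rate is `-2γ`, so the
  -- time integral returns the change of the coefficient of `φ`.
  have e5 : ∀ j, c j * sineCoeff φ'' j / 2 *
      ((1 - Real.exp (-(heatRate γ j * t))) / heatRate γ j) =
      2 * γ * (c j * sineCoeff φ j / 2 * Real.exp (-(heatRate γ j * t)) -
        c j * sineCoeff φ j / 2) := by
    intro j
    have hp : Real.pi * ((j : ℝ) + 1) ≠ 0 := mul_ne_zero Real.pi_ne_zero (by positivity)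
    rw [hcoeff, heatRate]
    generalize Real.exp (-((Real.pi * (j + 1)) ^ 2 / (2 * γ) * t)) = x
    generalize Real.pi * ((j : ℝ) + 1) = y at *
    field_simp
    ring
  rw [integral_mul_profile hγ Fbar hρ ht hφ, hint2, hinit, ← hc]
  simp_rw [e5]
  rw [tsum_mul_left, hS.tsum_sub hP.summable]
  generalize (∑' j, c j * sineCoeff φ j / 2 * Real.exp (-(heatRate γ j * t))) = S₁
  generalize (∑' j, c j * sineCoeff φ j / 2) = S₂
  field_simp
  ring

end HarmonicChain

namespace HarmonicChain

/-! ### Weak solutions of the macroscopic equation -/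

/-- Data given only on the unit interval are extended by constants, so that global continuity can be
used without changing any integral over it. -/
theorem continuous_comp_projIcc {φ : ℝ → ℝ} (h : ContinuousOn φ (Icc 0 1)) :
    Continuous fun u => φ (projIcc (0 : ℝ) 1 zero_le_one u) :=
  h.domRestrict.comp continuous_projIcc

theorem comp_projIcc_eq (φ : ℝ → ℝ) {u : ℝ} (hu : u ∈ Icc (0 : ℝ) 1) :
    φ (projIcc (0 : ℝ) 1 zero_le_one u) = φ u := by
  rw [projIcc_of_mem _ hu]

theorem contDiffOn_two_Icc {φ : ℝ → ℝ} (h : ContDiffOn ℝ 2 φ (Icc 0 1)) :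
    ContinuousOn (derivWithin φ (Icc 0 1)) (Icc 0 1) ∧
    ContinuousOn (iteratedDerivWithin 2 φ (Icc 0 1)) (Icc 0 1) ∧
    (∀ u ∈ Ioo (0 : ℝ) 1, HasDerivAt φ (derivWithin φ (Icc 0 1) u) u) ∧
    ∀ u ∈ Ioo (0 : ℝ) 1,
      HasDerivAt (derivWithin φ (Icc 0 1)) (iteratedDerivWithin 2 φ (Icc 0 1) u) u := by
  have hI : UniqueDiffOn ℝ (Icc (0 : ℝ) 1) := uniqueDiffOn_Icc zero_lt_one
  have h2 : ContDiffOn ℝ (1 + 1) φ (Icc 0 1) := by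
    norm_num
    exact h
  obtain ⟨hd, -, h1⟩ := (contDiffOn_succ_iff_derivWithin hI).1 h2
  have h1' : ContDiffOn ℝ (0 + 1) (derivWithin φ (Icc 0 1)) (Icc 0 1) := by simpa using h1
  obtain ⟨hd', -, -⟩ := (contDiffOn_succ_iff_derivWithin hI).1 h1'
  refine ⟨hd'.continuousOn, h.continuousOn_iteratedDerivWithin le_rfl hI, fun u hu => ?_,
    fun u hu => ?_⟩
  · exact ((hd u (Ioo_subset_Icc_self hu)).hasDerivWithinAt).hasDerivAt (Icc_mem_nhds hu.1 hu.2)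
  · have e : iteratedDerivWithin 2 φ (Icc 0 1) u =
        derivWithin (derivWithin φ (Icc 0 1)) (Icc 0 1) u := by
      rw [iteratedDerivWithin_succ]
      refine derivWithin_congr (fun v hv => ?_) ?_
      · rw [iteratedDerivWithin_one]
      · rw [iteratedDerivWithin_one]
    rw [e]
    exact ((hd' u (Ioo_subset_Icc_self hu)).hasDerivWithinAt).hasDerivAt (Icc_mem_nhds hu.1 hu.2)

theorem hasDerivAt_congr_Ioo {φ ψ : ℝ → ℝ} (h : ∀ u ∈ Icc (0 : ℝ) 1, ψ u = φ u) {d u : ℝ}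
    (hu : u ∈ Ioo (0 : ℝ) 1) (hd : HasDerivAt φ d u) : HasDerivAt ψ d u :=
  hd.congr_of_eventuallyEq (by
    filter_upwards [Icc_mem_nhds hu.1 hu.2] with v hv using h v hv)

/-- The measures with the density `profile`. -/
noncomputable def profileMeasure (γ Fbar : ℝ) (ρ : ℝ → ℝ) (t : ℝ≥0) : SignedMeasure unitInterval :=
  (volume : Measure unitInterval).withDensityᵥ fun u => profile γ Fbar ρ t u

theorem signedIntegral_profileMeasure {γ : ℝ} (hγ : 0 < γ) (Fbar : ℝ) {ρ : ℝ → ℝ}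
    (hρ : Continuous ρ) (t : ℝ≥0) {f : ℝ → ℝ} (hf : Continuous f) :
    ∫ᵛ u, f (u : ℝ) ∂•(profileMeasure γ Fbar ρ t) =
      ∫ u in (0 : ℝ)..1, f u * profile γ Fbar ρ t u := by
  have h1 : Continuous fun u : unitInterval => f u := hf.comp continuous_subtype_val
  have h2 : Continuous fun u : unitInterval => profile γ Fbar ρ t u :=
    (continuous_profile hγ Fbar hρ t.coe_nonneg).comp continuous_subtype_val
  rw [profileMeasure, signedIntegral_withDensity h1 h2,
    ← integral_unitInterval fun u => f u * profile γ Fbar ρ t u]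

theorem isWeakSolution_profileMeasure {γ : ℝ} (hγ : 0 < γ) (Fbar : ℝ) {r₀ ρ : ℝ → ℝ}
    (hρ : Continuous ρ) (hr₀ : ∀ u ∈ Icc (0 : ℝ) 1, ρ u = r₀ u) :
    IsWeakSolution γ Fbar r₀ (profileMeasure γ Fbar ρ) := by
  have hval : ∀ (f : ℝ → ℝ) (u : unitInterval),
      f (projIcc (0 : ℝ) 1 zero_le_one (u : ℝ)) = f u := fun f u => comp_projIcc_eq f u.2
  refine ⟨fun f => ?_, fun φ hφ h0 h1 t => ?_⟩
  · have hf : Continuous fun u : ℝ => f (projIcc (0 : ℝ) 1 zero_le_one u) :=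
      f.continuous.comp continuous_projIcc
    have e : ∀ t, ∫ᵛ u, f u ∂•(profileMeasure γ Fbar ρ t) =
        ∫ u in (0 : ℝ)..1, f (projIcc (0 : ℝ) 1 zero_le_one u) * profile γ Fbar ρ t u := by
      intro t
      rw [← signedIntegral_profileMeasure hγ Fbar hρ t hf]
      congr 1 with u
      rw [projIcc_val]
    simp_rw [e]
    exact continuous_integral_mul_profile hγ Fbar hρ hf
  · obtain ⟨hc', hc'', hd, hd'⟩ := contDiffOn_two_Icc hφ
    have hφc := continuous_comp_projIcc hφ.continuousOn
    have hφ''c := continuous_comp_projIcc hc''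
    have key := integral_mul_profile_sub hγ Fbar hρ hφc hc' hφ''c
      (by rw [comp_projIcc_eq φ (left_mem_Icc.2 zero_le_one), h0])
      (by rw [comp_projIcc_eq φ (right_mem_Icc.2 zero_le_one), h1])
      (fun u hu => hasDerivAt_congr_Ioo (fun v hv => comp_projIcc_eq φ hv) hu (hd u hu))
      (fun u hu => by
        rw [comp_projIcc_eq (iteratedDerivWithin 2 φ (Icc 0 1)) (Ioo_subset_Icc_self hu)]
        exact hd' u hu) t.coe_nonneg
    have e1 : ∫ᵛ u, φ (u : ℝ) ∂•(profileMeasure γ Fbar ρ t) = ∫ u in (0 : ℝ)..1,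
        φ (projIcc (0 : ℝ) 1 zero_le_one u) * profile γ Fbar ρ t u := by
      rw [← signedIntegral_profileMeasure hγ Fbar hρ t hφc]
      congr 1 with u
      rw [hval φ]
    have e2 : ∫ u in (0 : ℝ)..1, φ u * r₀ u =
        ∫ u in (0 : ℝ)..1, φ (projIcc (0 : ℝ) 1 zero_le_one u) * ρ u := by
      refine intervalIntegral.integral_congr fun u hu => ?_
      rw [uIcc_of_le zero_le_one] at hu
      simp only [comp_projIcc_eq φ hu, hr₀ u hu]
    have e3 : (∫ s in (0 : ℝ)..t, ∫ᵛ u, iteratedDerivWithin 2 φ (Icc 0 1) (u : ℝ)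
          ∂•(profileMeasure γ Fbar ρ s.toNNReal)) =
        ∫ s in (0 : ℝ)..t, ∫ u in (0 : ℝ)..1, iteratedDerivWithin 2 φ (Icc 0 1)
          (projIcc (0 : ℝ) 1 zero_le_one u) * profile γ Fbar ρ s u := by
      refine intervalIntegral.integral_congr fun s hs => ?_
      rw [uIcc_of_le t.coe_nonneg] at hs
      rw [← Real.coe_toNNReal s hs.1, Real.toNNReal_coe,
        ← signedIntegral_profileMeasure hγ Fbar hρ _ hφ''c]
      congr 1 with u
      rw [hval (iteratedDerivWithin 2 φ (Icc 0 1))]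
    rw [e1, e2, e3, key]

/-! ### Uniqueness -/

/-- The iterated derivatives on the unit interval of a twice differentiable function. -/
theorem contDiffOn_of_hasDerivAt {φ φ' φ'' : ℝ → ℝ} (hd : ∀ u, HasDerivAt φ (φ' u) u)
    (hd' : ∀ u, HasDerivAt φ' (φ'' u) u) (hc : Continuous φ'') :
    ContDiffOn ℝ 2 φ (Icc 0 1) ∧
      ∀ u ∈ Icc (0 : ℝ) 1, iteratedDerivWithin 2 φ (Icc 0 1) u = φ'' u := by
  have e1 : deriv φ = φ' := funext fun u => (hd u).deriv
  have e2 : deriv φ' = φ'' := funext fun u => (hd' u).deriv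
  have h1 : ContDiff ℝ 1 φ' := contDiff_one_iff_deriv.2
    ⟨fun u => (hd' u).differentiableAt, e2 ▸ hc⟩
  have h2 : ContDiff ℝ (1 + 1) φ := contDiff_succ_iff_deriv.2
    ⟨fun u => (hd u).differentiableAt, fun h => absurd h (by simp), e1 ▸ h1⟩
  have h3 : ContDiff ℝ 2 φ := by
    norm_num at h2
    exact h2
  refine ⟨h3.contDiffOn, fun u hu => ?_⟩
  rw [iteratedDerivWithin_eq_iteratedDeriv (uniqueDiffOn_Icc zero_lt_one) h3.contDiffAt hu,
    iteratedDeriv_succ, iteratedDeriv_one, e1, e2]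

/-- A continuous function whose integrals over all intervals `[0, t]` vanish is zero. -/
theorem eq_zero_of_integral_eq_zero {z : ℝ≥0 → ℝ} (hz : Continuous z)
    (h : ∀ t : ℝ≥0, ∫ s in (0 : ℝ)..t, z s.toNNReal = 0) (t : ℝ≥0) : z t = 0 := by
  have hc : Continuous fun s : ℝ => z s.toNNReal := hz.comp continuous_real_toNNReal
  -- Derivatives within the half-line, so that `t = 0` is included.
  have h1 := ((hc.integral_hasStrictDerivAt 0 (t : ℝ)).hasDerivAt).hasDerivWithinAt (s := Ici 0)
  have h2 : HasDerivWithinAt (fun t : ℝ => ∫ s in (0 : ℝ)..t, z s.toNNReal) 0 (Ici 0) (t : ℝ) := by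
    refine (hasDerivWithinAt_const (t : ℝ) (Ici 0) (0 : ℝ)).congr (fun s hs => ?_) (h t)
    have := h s.toNNReal
    rwa [Real.coe_toNNReal s hs] at this
  have h3 := (uniqueDiffOn_Ici (0 : ℝ) _ t.coe_nonneg).eq_deriv _ h1 h2
  simpa only [Real.toNNReal_coe] using h3

/-- The integrating factor `exp(-a t)` makes `∫ z` constant, hence zero, whatever the sign of `a`.
-/
theorem eq_zero_of_eq_mul_integral {z : ℝ≥0 → ℝ} (hz : Continuous z) {a : ℝ}
    (h : ∀ t : ℝ≥0, z t = a * ∫ s in (0 : ℝ)..t, z s.toNNReal) (t : ℝ≥0) : z t = 0 := by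
  have hc : Continuous fun s : ℝ => z s.toNNReal := hz.comp continuous_real_toNNReal
  set Z : ℝ → ℝ := fun t => ∫ s in (0 : ℝ)..t, z s.toNNReal with hZ
  have hZd : ∀ t, 0 < t → HasDerivAt (fun t => Real.exp (-(a * t)) * Z t) 0 t := by
    intro t ht
    have h1 : HasDerivAt (fun t : ℝ => Real.exp (-(a * t))) (Real.exp (-(a * t)) * -a) t := by
      simpa using (((hasDerivAt_id t).const_mul a).neg).exp
    refine (h1.mul (hc.integral_hasStrictDerivAt 0 t).hasDerivAt).congr_deriv ?_
    rw [h t.toNNReal, Real.coe_toNNReal t ht.le]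
    ring
  have hZc : Continuous fun t => Real.exp (-(a * t)) * Z t := by
    have : Continuous Z := continuous_iff_continuousAt.2 fun t =>
      (hc.integral_hasStrictDerivAt 0 t).hasDerivAt.continuousAt
    fun_prop
  have h0 : Z 0 = 0 := intervalIntegral.integral_same
  have h1 := antitoneOn_of_hasDerivAt_nonpos hZc hZd le_rfl (fun _ _ _ _ => le_rfl) t.coe_nonneg
  have h2 := antitoneOn_of_hasDerivAt_nonpos hZc.neg (fun u hu => (hZd u hu).neg) le_rfl
    (fun _ _ _ _ => neg_zero.le) t.coe_nonneg
  simp only [h0, mul_zero, Pi.neg_apply, neg_zero] at h1 h2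
  have h3 : Real.exp (-(a * t)) * Z t = 0 := by linarith
  have h4 : Z t = 0 := (mul_eq_zero.1 h3).resolve_left (Real.exp_pos _).ne'
  rw [h t]
  exact mul_eq_zero_of_right _ h4

namespace IsWeakSolution

variable {γ Fbar : ℝ} {r₀ : ℝ → ℝ} {m m' : ℝ≥0 → SignedMeasure unitInterval}

theorem continuous_signedIntegral (h : IsWeakSolution γ Fbar r₀ m) {f : ℝ → ℝ} (hf : Continuous f) :
    Continuous fun t => ∫ᵛ u, f (u : ℝ) ∂•(m t) :=
  h.continuous ⟨fun u => f u, hf.comp continuous_subtype_val⟩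

/-- The initial profile and the boundary term are common to both solutions and cancel. -/
theorem sub_eq (h : IsWeakSolution γ Fbar r₀ m) (h' : IsWeakSolution γ Fbar r₀ m')
    {φ φ' φ'' : ℝ → ℝ} (hd : ∀ u, HasDerivAt φ (φ' u) u) (hd' : ∀ u, HasDerivAt φ' (φ'' u) u)
    (hc : Continuous φ'') (h0 : φ 0 = 0) (h1 : φ 1 = 0) (t : ℝ≥0) :
    (∫ᵛ u, φ (u : ℝ) ∂•(m t)) - ∫ᵛ u, φ (u : ℝ) ∂•(m' t) =
      1 / (2 * γ) * ∫ s in (0 : ℝ)..t, ((∫ᵛ u, φ'' (u : ℝ) ∂•(m s.toNNReal)) -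
        ∫ᵛ u, φ'' (u : ℝ) ∂•(m' s.toNNReal)) := by
  obtain ⟨hφ, hφ''⟩ := contDiffOn_of_hasDerivAt hd hd' hc
  have e1 := h.weak φ hφ h0 h1 t
  have e2 := h'.weak φ hφ h0 h1 t
  have e3 : ∀ u : unitInterval, iteratedDerivWithin 2 φ (Icc 0 1) (u : ℝ) = φ'' u := fun u =>
    hφ'' u u.2
  simp_rw [e3] at e1 e2
  rw [intervalIntegral.integral_sub]
  · linear_combination e1 - e2
  · exact ((h.continuous_signedIntegral hc).comp continuous_real_toNNReal).intervalIntegrable _ _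
  · exact ((h'.continuous_signedIntegral hc).comp continuous_real_toNNReal).intervalIntegrable _ _

/-- A sine mode is an eigenfunction of the second derivative, so the equation for the difference
closes on a single function of time. -/
theorem signedIntegral_sineMode_eq (h : IsWeakSolution γ Fbar r₀ m)
    (h' : IsWeakSolution γ Fbar r₀ m') (j : ℕ) (t : ℝ≥0) :
    ∫ᵛ u, sineMode j (u : ℝ) ∂•(m t) = ∫ᵛ u, sineMode j (u : ℝ) ∂•(m' t) := by
  have hds : ∀ u, HasDerivAt (sineMode j)
      (Real.pi * (j + 1) * Real.cos (Real.pi * (j + 1) * u)) u := fun u => by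
    have := ((hasDerivAt_id u).const_mul (Real.pi * (j + 1))).sin
    simp only [id, mul_one] at this
    rw [mul_comm]
    exact this
  have hdc : ∀ u, HasDerivAt (fun u => Real.pi * (j + 1) * Real.cos (Real.pi * (j + 1) * u))
      (-(Real.pi * (j + 1)) ^ 2 * sineMode j u) u := fun u => by
    have := (((hasDerivAt_id u).const_mul (Real.pi * (j + 1))).cos).const_mul (Real.pi * (j + 1))
    simp only [id, mul_one] at this
    refine this.congr_deriv ?_
    rw [sineMode]
    ring
  have hs0 : sineMode j 0 = 0 := by simp [sineMode]
  have hs1 : sineMode j 1 = 0 := by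
    have := Real.sin_nat_mul_pi (j + 1)
    rw [sineMode, mul_one, mul_comm]
    exact_mod_cast this
  have hc : Continuous fun u : unitInterval => sineMode j (u : ℝ) :=
    (continuous_sineMode j).comp continuous_subtype_val
  have key := h.sub_eq h' hds hdc (by fun_prop) hs0 hs1
  simp_rw [signedIntegral_const_mul hc, ← mul_sub, intervalIntegral.integral_const_mul,
    ← mul_assoc] at key
  have hz := eq_zero_of_eq_mul_integral ((h.continuous_signedIntegral (continuous_sineMode j)).sub
    (h'.continuous_signedIntegral (continuous_sineMode j))) key t
  exact sub_eq_zero.1 hz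

theorem signedIntegral_eq_of_mem_span (h : IsWeakSolution γ Fbar r₀ m)
    (h' : IsWeakSolution γ Fbar r₀ m') {F : ℝ → ℝ} (hF : F ∈ Submodule.span ℝ (range sineMode))
    (t : ℝ≥0) : ∫ᵛ u, F (u : ℝ) ∂•(m t) = ∫ᵛ u, F (u : ℝ) ∂•(m' t) := by
  induction hF using Submodule.span_induction with
  | mem x hx =>
    obtain ⟨j, rfl⟩ := hx
    exact h.signedIntegral_sineMode_eq h' j t
  | zero => simp
  | add x y hx' hy' hx hy =>
    have hxc : Continuous fun u : unitInterval => x u :=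
      (continuous_of_mem_span hx').comp continuous_subtype_val
    have hyc : Continuous fun u : unitInterval => y u :=
      (continuous_of_mem_span hy').comp continuous_subtype_val
    simp only [Pi.add_apply]
    rw [signedIntegral_add hxc hyc, signedIntegral_add hxc hyc]
    exact congrArg₂ _ hx hy
  | smul a x hx' hx =>
    have hxc : Continuous fun u : unitInterval => x u :=
      (continuous_of_mem_span hx').comp continuous_subtype_val
    simp only [Pi.smul_apply, smul_eq_mul]
    rw [signedIntegral_const_mul hxc, signedIntegral_const_mul hxc]
    exact congrArg _ hx

/-- Uniform approximation by sine polynomials; the error is at most `ε` times the total masses at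
the fixed time `t`. -/
theorem signedIntegral_eq_of_vanishing (h : IsWeakSolution γ Fbar r₀ m)
    (h' : IsWeakSolution γ Fbar r₀ m') {φ : ℝ → ℝ} (hφ : Continuous φ) (h0 : φ 0 = 0) (h1 : φ 1 = 0)
    (t : ℝ≥0) : ∫ᵛ u, φ (u : ℝ) ∂•(m t) = ∫ᵛ u, φ (u : ℝ) ∂•(m' t) := by
  set V : SignedMeasure unitInterval → ℝ := fun m => m.toJordanDecomposition.posPart.real univ +
    m.toJordanDecomposition.negPart.real univ with hV
  have hV0 : ∀ m, 0 ≤ V m := fun m => by positivity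
  have key : ∀ ε : ℝ, 0 < ε →
      |(∫ᵛ u, φ (u : ℝ) ∂•(m t)) - ∫ᵛ u, φ (u : ℝ) ∂•(m' t)| ≤ ε * (V (m t) + V (m' t)) := by
    intro ε hε
    obtain ⟨F, hF, hFφ⟩ := exists_mem_span_abs_sub_le hφ h0 h1 hε
    have hFc : Continuous fun u : unitInterval => F u :=
      (continuous_of_mem_span hF).comp continuous_subtype_val
    have hRc : Continuous fun u : unitInterval => φ u - F u :=
      (hφ.comp continuous_subtype_val).sub hFc
    have hdec : ∀ m : SignedMeasure unitInterval, ∫ᵛ u, φ (u : ℝ) ∂•m =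
        (∫ᵛ u, F (u : ℝ) ∂•m) + ∫ᵛ u, (φ (u : ℝ) - F (u : ℝ)) ∂•m := by
      intro m
      rw [← signedIntegral_add hFc hRc]
      congr 1 with u
      ring
    have hb := fun m => abs_signedIntegral_le hRc (fun u => hFφ u u.2) m
    rw [hdec (m t), hdec (m' t), h.signedIntegral_eq_of_mem_span h' hF t, add_sub_add_left_eq_sub,
      mul_add]
    exact (abs_sub _ _).trans (add_le_add (hb (m t)) (hb (m' t)))
  rw [← sub_eq_zero, ← abs_eq_zero]
  refine le_antisymm (le_of_forall_pos_le_add fun ε hε => ?_) (abs_nonneg _)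
  have hp : 0 < V (m t) + V (m' t) + 1 := by
    have := hV0 (m t)
    have := hV0 (m' t)
    linarith
  refine (key (ε / (V (m t) + V (m' t) + 1)) (by positivity)).trans ?_
  rw [zero_add, div_mul_eq_mul_div, div_le_iff₀ hp]
  nlinarith

/-- Test functions that vanish at the end points cannot see atoms there. Given any `f`, take `φ`
vanishing at both ends with `φ'' = f`: the left side of the difference equation is then zero at all
times, so the time integrals of the difference of the integrals of `f` vanish, and continuity in
time concludes. -/
theorem unique (hγ : 0 < γ) (h : IsWeakSolution γ Fbar r₀ m) (h' : IsWeakSolution γ Fbar r₀ m') :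
    m = m' := by
  funext t
  refine signedMeasure_ext_of_integral fun f hf => ?_
  set g : ℝ → ℝ := fun u => f (projIcc (0 : ℝ) 1 zero_le_one u) with hg
  have hgc : Continuous g := hf.comp continuous_projIcc
  set g₁ : ℝ → ℝ := fun u => ∫ v in (0 : ℝ)..u, g v with hg₁
  have hd₁ : ∀ u, HasDerivAt g₁ (g u) u := fun u => (hgc.integral_hasStrictDerivAt 0 u).hasDerivAt
  have hg₁c : Continuous g₁ := continuous_iff_continuousAt.2 fun u => (hd₁ u).continuousAt
  -- The slope `a` enforces `φ 1 = 0` without changing the second derivative.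
  set a := ∫ v in (0 : ℝ)..1, g₁ v with ha
  set φ : ℝ → ℝ := fun u => (∫ v in (0 : ℝ)..u, g₁ v) - a * u with hφ
  have hd : ∀ u, HasDerivAt φ (g₁ u - a) u := fun u => by
    have := (hg₁c.integral_hasStrictDerivAt 0 u).hasDerivAt.sub ((hasDerivAt_id u).const_mul a)
    exact this.congr_deriv (by rw [mul_one])
  have hφc : Continuous φ := continuous_iff_continuousAt.2 fun u => (hd u).continuousAt
  have h0 : φ 0 = 0 := by simp [hφ]
  have h1 : φ 1 = 0 := by simp [hφ, ← ha]
  have key := h.sub_eq h' hd (fun u => (hd₁ u).sub_const a) hgc h0 h1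
  have hz := eq_zero_of_integral_eq_zero
    ((h.continuous_signedIntegral hgc).sub (h'.continuous_signedIntegral hgc)) (fun t => by
      have e := key t
      rw [h.signedIntegral_eq_of_vanishing h' hφc h0 h1 t, sub_self] at e
      exact (mul_eq_zero.1 e.symm).resolve_left (by positivity)) t
  have e : (fun u : unitInterval => g (u : ℝ)) = f := by
    funext u
    simp only [hg, projIcc_val]
  have hz' := sub_eq_zero.1 hz
  rwa [e] at hz'

end IsWeakSolution

end HarmonicChain

namespace HarmonicChain

/-! ### The force -/

/-- The oscillating part of the force. -/
noncomputable def oscillation (Fhat : ℤ → ℂ) (θ t : ℝ) : ℝ :=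
  (∑' ℓ : ℤ, if ℓ = 0 then (0 : ℂ)
    else Fhat ℓ * Complex.exp (Complex.I * ℓ * ((2 * Real.pi / θ : ℝ) : ℂ) * t)).re

/-- There is no zero mode, so each term integrates to itself divided by `iℓω`, and `|ℓω| ≥ ω`. The
primitive is bounded uniformly in time, which is what makes the force harmless over times of order
`n²`. -/
theorem exists_primitive_oscillation {Fhat : ℤ → ℂ} (hF : Summable fun ℓ : ℤ => ‖Fhat ℓ‖) {θ : ℝ}
    (hθ : 0 < θ) : ∃ (H : ℝ → ℝ) (a b : ℝ), (∀ t, HasDerivAt H (oscillation Fhat θ t) t) ∧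
      (∀ t, |oscillation Fhat θ t| ≤ a) ∧ ∀ t, |H t| ≤ b := by
  set ω : ℝ := 2 * Real.pi / θ with hω
  have hω0 : 0 < ω := by
    have := Real.pi_pos
    positivity
  have hnorm : ∀ (ℓ : ℤ) (t : ℝ), ‖Complex.exp (Complex.I * ℓ * (ω : ℂ) * t)‖ = 1 := fun ℓ t => by
    have : Complex.I * ℓ * (ω : ℂ) * t = ((ℓ * ω * t : ℝ) : ℂ) * Complex.I := by
      push_cast
      ring
    rw [this, Complex.norm_exp_ofReal_mul_I]
  set g : ℤ → ℝ → ℂ := fun ℓ t => if ℓ = 0 then (0 : ℂ) else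
    Fhat ℓ * (Complex.exp (Complex.I * ℓ * (ω : ℂ) * t) / (Complex.I * ℓ * ω)) with hg
  set g' : ℤ → ℝ → ℂ := fun ℓ t => if ℓ = 0 then (0 : ℂ) else
    Fhat ℓ * Complex.exp (Complex.I * ℓ * (ω : ℂ) * t) with hg'
  have hgd : ∀ ℓ t, HasDerivAt (g ℓ) (g' ℓ t) t := by
    intro ℓ t
    simp only [hg, hg']
    by_cases hℓ : ℓ = 0
    · simp only [hℓ, if_true]
      exact hasDerivAt_const _ _
    · simp only [hℓ, if_false]
      have hne : Complex.I * ℓ * (ω : ℂ) ≠ 0 := by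
        refine mul_ne_zero (mul_ne_zero Complex.I_ne_zero (by exact_mod_cast hℓ)) ?_
        exact_mod_cast hω0.ne'
      have h1 : HasDerivAt (fun t : ℝ => Complex.I * ℓ * (ω : ℂ) * (t : ℂ))
          (Complex.I * ℓ * (ω : ℂ) * 1) t := (Complex.ofRealCLM.hasDerivAt (x := t)).const_mul _
      refine ((h1.cexp.div_const (Complex.I * ℓ * (ω : ℂ))).const_mul (Fhat ℓ)).congr_deriv ?_
      rw [mul_one, mul_div_cancel_right₀ _ hne]
  have hg'b : ∀ ℓ t, ‖g' ℓ t‖ ≤ ‖Fhat ℓ‖ := by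
    intro ℓ t
    simp only [hg']
    split_ifs
    · simp
    · rw [norm_mul, hnorm, mul_one]
  have hgb : ∀ ℓ t, ‖g ℓ t‖ ≤ ‖Fhat ℓ‖ / ω := by
    intro ℓ t
    simp only [hg]
    split_ifs with hℓ
    · rw [norm_zero]
      positivity
    · rw [norm_mul, norm_div, hnorm, norm_mul, norm_mul, Complex.norm_I, one_mul,
        Complex.norm_real, Real.norm_of_nonneg hω0.le, mul_one_div]
      have h1 : (1 : ℝ) ≤ ‖(ℓ : ℂ)‖ := by
        rw [Complex.norm_intCast]
        exact_mod_cast Int.one_le_abs hℓ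
      exact div_le_div_of_nonneg_left (norm_nonneg _) hω0 (le_mul_of_one_le_left hω0.le h1)
  have hF' := hF.div_const ω
  have key : ∀ t, HasDerivAt (fun t => ∑' ℓ, g ℓ t) (∑' ℓ, g' ℓ t) t := fun t =>
    hasDerivAt_tsum hF hgd hg'b (y₀ := 0) (Summable.of_norm_bounded hF' fun ℓ => hgb ℓ 0) t
  refine ⟨fun t => (∑' ℓ, g ℓ t).re, ∑' ℓ, ‖Fhat ℓ‖, ∑' ℓ, ‖Fhat ℓ‖ / ω, fun t => ?_, fun t => ?_,
    fun t => ?_⟩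
  · exact (Complex.reCLM.hasFDerivAt.comp_hasDerivAt t (key t))
  · exact (Complex.abs_re_le_norm _).trans (tsum_of_norm_bounded hF.hasSum fun ℓ => hg'b ℓ t)
  · exact (Complex.abs_re_le_norm _).trans (tsum_of_norm_bounded hF'.hasSum fun ℓ => hgb ℓ t)

theorem continuous_oscillation {Fhat : ℤ → ℂ} (hF : Summable fun ℓ : ℤ => ‖Fhat ℓ‖) (θ : ℝ) :
    Continuous (oscillation Fhat θ) := by
  refine Complex.continuous_re.comp (continuous_tsum (fun ℓ => ?_) hF fun ℓ t => ?_)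
  · split_ifs <;> fun_prop
  · split_ifs
    · simp
    · have : Complex.I * ℓ * ((2 * Real.pi / θ : ℝ) : ℂ) * t =
          ((ℓ * (2 * Real.pi / θ) * t : ℝ) : ℂ) * Complex.I := by
        push_cast
        ring
      rw [norm_mul, this, Complex.norm_exp_ofReal_mul_I, mul_one]

/-! ### The decay of the chain -/

/-- The smallness `η` required of the initial stretch does not depend on the energy constant `C`,
because the initial energy loses a factor `n²`. Hence the number of subtracted modes can be chosen
from `η`, although it changes `C`. -/
theorem eventually_chainEnergy_le {γ : ℝ} (hγ : 0 < γ) {G H : ℝ → ℝ} {a b : ℝ}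
    (hH : ∀ t, HasDerivAt H (G t) t) (ha : ∀ t, |G t| ≤ a) (hb : ∀ t, |H t| ≤ b) {t : ℝ}
    (ht : 0 < t) {ε : ℝ} (hε : 0 < ε) : ∃ η : ℝ, 0 < η ∧ ∀ (r p : ℕ → ℝ → ℕ → ℝ) (C : ℝ),
      (∀ᶠ n : ℕ in atTop, IsForcedChain γ n (fun s => 1 / √(n : ℝ) * G s) (r n) (p n)) →
      (∀ᶠ n : ℕ in atTop, chainEnergy n (r n 0) (p n 0) ≤ C * n) →
      (∀ᶠ n : ℕ in atTop, ∑ x ∈ Finset.range n, r n 0 (x + 1) ^ 2 ≤ η * n) →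
      ∀ᶠ n : ℕ in atTop,
        chainEnergy n (r n ((n : ℝ) ^ 2 * t)) (p n ((n : ℝ) ^ 2 * t)) ≤ ε * n := by
  -- The window in `energy_le` has length `n² θ`. This `θ` limits the energy injected over it to
  -- `ε/4` per site, and `η = εθ/(2t)` below makes the initial stretch cost another `ε/4`; all else
  -- is `O(n⁻²)` per site.
  set θ : ℝ := min t (ε * γ / (a ^ 2 + 1)) with hθ
  have hθ0 : 0 < θ := lt_min ht (by positivity)
  have hθa : a ^ 2 * θ / (4 * γ) ≤ ε / 4 := by
    have h1 : θ * (a ^ 2 + 1) ≤ ε * γ := by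
      rw [← le_div_iff₀ (by positivity)]
      exact min_le_right _ _
    rw [div_le_iff₀ (by positivity)]
    nlinarith
  refine ⟨ε * θ / (2 * t), by positivity, fun r p C hchain hE hδ => ?_⟩
  have hlim : Tendsto (fun n : ℕ => (2 / γ * C / θ) / (n : ℝ) ^ 2 +
      ((b ^ 2 / 2 + a ^ 2 / (2 * γ ^ 2)) * t / θ) / (n : ℝ) ^ 2 +
      (b ^ 2 / (2 * γ) / θ) / (n : ℝ) ^ 4) atTop (𝓝 (0 + 0 + 0)) := by
    have h : ∀ k : ℕ, k ≠ 0 → Tendsto (fun n : ℕ => (n : ℝ) ^ k) atTop atTop := fun k hk =>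
      (tendsto_pow_atTop hk).comp tendsto_natCast_atTop_atTop
    exact ((tendsto_const_nhds.div_atTop (h 2 two_ne_zero)).add
      (tendsto_const_nhds.div_atTop (h 2 two_ne_zero))).add
      (tendsto_const_nhds.div_atTop (h 4 four_ne_zero))
  rw [add_zero, add_zero] at hlim
  filter_upwards [hchain, hE, hδ, hlim.eventually_le_const (by positivity : (0 : ℝ) < ε / 2),
    eventually_ge_atTop 1] with n h1 h2 h3 h4 hn
  have hn0 : (0 : ℝ) < n := by exact_mod_cast hn
  have hsq : √(n : ℝ) ^ 2 = n := Real.sq_sqrt hn0.le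
  have key := h1.energy_le hγ (H := fun s => 1 / √(n : ℝ) * H s) (a := 1 / √(n : ℝ) * a)
    (b := 1 / √(n : ℝ) * b) (fun s => (hH s).const_mul _) (fun s => ?_) (fun s => ?_)
    (τ := (n : ℝ) ^ 2 * θ) (t := (n : ℝ) ^ 2 * t) (by positivity)
    (mul_le_mul_of_nonneg_left (min_le_left _ _) (by positivity))
  · simp only [mul_pow, div_pow, hsq, one_pow] at key
    set E := chainEnergy n (r n ((n : ℝ) ^ 2 * t)) (p n ((n : ℝ) ^ 2 * t)) with hEdef
    have h5 : 2 / γ * chainEnergy n (r n 0) (p n 0) ≤ 2 / γ * (C * n) :=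
      mul_le_mul_of_nonneg_left h2 (by positivity)
    have h6 : ((∑ x ∈ Finset.range n, r n 0 (x + 1) ^ 2) / 2 + 1 / n * b ^ 2 / 2 +
        1 / n * a ^ 2 / (2 * γ ^ 2)) * ((n : ℝ) ^ 2 * t) ≤
        (ε * θ / (2 * t) * n / 2 + 1 / n * b ^ 2 / 2 + 1 / n * a ^ 2 / (2 * γ ^ 2)) *
          ((n : ℝ) ^ 2 * t) := by
      gcongr
    have h7 : (n : ℝ) ^ 2 * θ * E ≤ (n : ℝ) ^ 2 * θ * (n * ((2 / γ * C / θ) / (n : ℝ) ^ 2 +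
        ((b ^ 2 / 2 + a ^ 2 / (2 * γ ^ 2)) * t / θ) / (n : ℝ) ^ 2 +
        (b ^ 2 / (2 * γ) / θ) / (n : ℝ) ^ 4 + ε / 4 + a ^ 2 * θ / (4 * γ))) := by
      refine (key.trans (add_le_add_left (add_le_add_left (add_le_add h5 h6) _) _)).trans (le_of_eq ?_)
      field_simp
      ring
    have h8 := le_of_mul_le_mul_left h7 (by positivity)
    have h9 : (2 / γ * C / θ) / (n : ℝ) ^ 2 +
        ((b ^ 2 / 2 + a ^ 2 / (2 * γ ^ 2)) * t / θ) / (n : ℝ) ^ 2 +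
        (b ^ 2 / (2 * γ) / θ) / (n : ℝ) ^ 4 + ε / 4 + a ^ 2 * θ / (4 * γ) ≤ ε := by linarith
    calc E ≤ _ := h8
      _ ≤ n * ε := mul_le_mul_of_nonneg_left h9 hn0.le
      _ = ε * n := mul_comm _ _
  · rw [abs_mul, abs_of_nonneg (by positivity)]
    exact mul_le_mul_of_nonneg_left (ha s) (by positivity)
  · rw [abs_mul, abs_of_nonneg (by positivity)]
    exact mul_le_mul_of_nonneg_left (hb s) (by positivity)

/-! ### The slow modes of the chain -/

/-- The angle of a mode of the chain of length `n`. -/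
noncomputable def modeAngle (n j : ℕ) : ℝ := Real.pi * (j + 1) / (n + 1)

/-- The frequency of a mode of the chain of length `n`. -/
noncomputable def modeFreq (n j : ℕ) : ℝ := 2 * Real.sin (modeAngle n j / 2)

/-- The decay rate of a mode of the chain of length `n`. -/
noncomputable def modeRate (γ : ℝ) (n j : ℕ) : ℝ := γ - √(γ ^ 2 - modeFreq n j ^ 2)

theorem tendsto_mul_modeFreq (j : ℕ) :
    Tendsto (fun n : ℕ => (n : ℝ) * modeFreq n j) atTop (𝓝 (Real.pi * (j + 1))) := by
  have hα : Tendsto (fun n : ℕ => modeAngle n j / 2) atTop (𝓝 0) := by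
    have h : Tendsto (fun n : ℕ => (Real.pi * (j + 1) / 2) * (1 / ((n : ℝ) + 1))) atTop
      (𝓝 ((Real.pi * (j + 1) / 2) * 0)) :=
      tendsto_const_nhds.mul tendsto_one_div_add_atTop_nhds_zero_nat
    rw [mul_zero] at h
    refine h.congr fun n => ?_
    rw [modeAngle]
    ring
  have hs : Tendsto (fun n : ℕ => Real.sinc (modeAngle n j / 2)) atTop (𝓝 1) := by
    have := (Real.continuous_sinc.tendsto 0).comp hα
    rwa [Real.sinc_zero] at this
  have h1 := ((tendsto_natCast_div_add_atTop (1 : ℝ)).mul_const (Real.pi * (j + 1))).mul hs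
  rw [one_mul, mul_one] at h1
  refine h1.congr fun n => ?_
  have hx : modeAngle n j / 2 ≠ 0 := by
    have := Real.pi_pos
    rw [modeAngle]
    positivity
  rw [Real.sinc_of_ne_zero hx, modeFreq]
  have hn : (n : ℝ) + 1 ≠ 0 := by positivity
  have hp : Real.pi * ((j : ℝ) + 1) = modeAngle n j * (n + 1) := by
    rw [modeAngle]
    field_simp
  have hm : modeAngle n j ≠ 0 := (div_ne_zero_iff.1 hx).1
  rw [hp]
  field_simp

theorem tendsto_modeFreq (j : ℕ) : Tendsto (fun n : ℕ => modeFreq n j) atTop (𝓝 0) := by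
  have h := (tendsto_mul_modeFreq j).div_atTop tendsto_natCast_atTop_atTop
  refine h.congr' ?_
  filter_upwards [eventually_ge_atTop 1] with n hn
  have : (n : ℝ) ≠ 0 := by exact_mod_cast (by omega : n ≠ 0)
  rw [mul_div_cancel_left₀ _ this]

theorem eventually_modeFreq {γ : ℝ} (hγ : 0 < γ) (j : ℕ) :
    ∀ᶠ n : ℕ in atTop, 0 < modeFreq n j ∧ modeFreq n j ≤ γ := by
  have hp : 0 < Real.pi * ((j : ℝ) + 1) := by
    have := Real.pi_pos
    positivity
  filter_upwards [(tendsto_mul_modeFreq j).eventually_const_lt hp,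
    (tendsto_modeFreq j).eventually_le_const hγ] with n h1 h2
  exact ⟨pos_of_mul_pos_right h1 (Nat.cast_nonneg n), h2⟩

/-- The rate is the smaller, slow root of the dispersion relation. The form with the sum in the
denominator avoids the cancellation and exhibits the limit `freq² / (2γ)`. -/
theorem modeRate_eq {γ : ℝ} (hγ : 0 < γ) {n j : ℕ} (h0 : 0 < modeFreq n j) (h : modeFreq n j ≤ γ) :
    modeRate γ n j ^ 2 - 2 * γ * modeRate γ n j + modeFreq n j ^ 2 = 0 ∧
      0 ≤ modeRate γ n j ∧
      modeRate γ n j = modeFreq n j ^ 2 / (γ + √(γ ^ 2 - modeFreq n j ^ 2)) := by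
  have hD : 0 ≤ γ ^ 2 - modeFreq n j ^ 2 := by nlinarith
  have hs := Real.sq_sqrt hD
  have hs0 := Real.sqrt_nonneg (γ ^ 2 - modeFreq n j ^ 2)
  have h3 : modeRate γ n j = modeFreq n j ^ 2 / (γ + √(γ ^ 2 - modeFreq n j ^ 2)) := by
    rw [modeRate, eq_div_iff (by positivity)]
    nlinarith
  refine ⟨?_, ?_, h3⟩
  · rw [modeRate]
    nlinarith
  · rw [h3]
    positivity

theorem tendsto_mul_modeRate {γ : ℝ} (hγ : 0 < γ) (j : ℕ) :
    Tendsto (fun n : ℕ => (n : ℝ) ^ 2 * modeRate γ n j) atTop (𝓝 (heatRate γ j)) := by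
  have h1 : Tendsto (fun n : ℕ => ((n : ℝ) * modeFreq n j) ^ 2 /
      (γ + √(γ ^ 2 - modeFreq n j ^ 2))) atTop
      (𝓝 ((Real.pi * (j + 1)) ^ 2 / (γ + √(γ ^ 2 - 0 ^ 2)))) := by
    refine ((tendsto_mul_modeFreq j).pow 2).div
      (tendsto_const_nhds.add ((tendsto_const_nhds.sub ((tendsto_modeFreq j).pow 2)).sqrt)) ?_
    positivity
  have e : (Real.pi * (j + 1)) ^ 2 / (γ + √(γ ^ 2 - 0 ^ 2)) = heatRate γ j := by
    rw [heatRate]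
    norm_num [Real.sqrt_sq hγ.le]
    ring
  rw [e] at h1
  refine h1.congr' ?_
  filter_upwards [eventually_modeFreq hγ j] with n hn
  rw [(modeRate_eq hγ hn.1 hn.2).2.2]
  ring

theorem tendsto_modeRate_div {γ : ℝ} (hγ : 0 < γ) (j : ℕ) :
    Tendsto (fun n : ℕ => modeRate γ n j / modeFreq n j) atTop (𝓝 0) := by
  have hp : Real.pi * ((j : ℝ) + 1) ≠ 0 := mul_ne_zero Real.pi_ne_zero (by positivity)
  have h1 := ((tendsto_mul_modeRate hγ j).div (tendsto_mul_modeFreq j) hp).div_atTop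
    tendsto_natCast_atTop_atTop
  refine h1.congr' ?_
  filter_upwards [eventually_modeFreq hγ j, eventually_ge_atTop 1] with n hn hn1
  have : (n : ℝ) ≠ 0 := by exact_mod_cast (by omega : n ≠ 0)
  have := hn.1.ne'
  simp only [Pi.div_apply]
  field_simp

/-- The stretch in the superposition of the stationary state and finitely many modes. -/
noncomputable def modeStretch (γ Fbar : ℝ) (c : ℕ → ℝ) (J n : ℕ) (t : ℝ) (x : ℕ) : ℝ :=
  Fbar * x / (n + 1) + ∑ j ∈ Finset.range J,
    c j * (Real.exp (-(modeRate γ n j * t)) * Real.sin (modeAngle n j * x))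

/-- The momentum in the superposition of the stationary state and finitely many modes. -/
noncomputable def modeMomentum (γ Fbar : ℝ) (c : ℕ → ℝ) (J n : ℕ) (t : ℝ) (x : ℕ) : ℝ :=
  Fbar / (2 * γ * (n + 1)) + ∑ j ∈ Finset.range J,
    c j * (modeRate γ n j / modeFreq n j * Real.exp (-(modeRate γ n j * t)) *
      Real.cos (modeAngle n j * x + modeAngle n j / 2))

/-- For finitely many modes and large `n` the frequencies are below `γ`, so the modes are overdamped
and their rates are real roots. -/
theorem eventually_isForcedChain_mode {γ : ℝ} (hγ : 0 < γ) (Fbar : ℝ) (c : ℕ → ℝ) (J : ℕ) :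
    ∀ᶠ n : ℕ in atTop, IsForcedChain γ n (fun _ => Fbar) (modeStretch γ Fbar c J n)
      (modeMomentum γ Fbar c J n) := by
  have h : ∀ᶠ n : ℕ in atTop, ∀ j ∈ Finset.range J, 0 < modeFreq n j ∧ modeFreq n j ≤ γ :=
    (Filter.eventually_all_finset _).2 fun j _ => eventually_modeFreq hγ j
  filter_upwards [h] with n hn
  have h1 := (IsForcedChain.stationary hγ.ne' n Fbar).add
    (IsForcedChain.sum (Finset.range J) (n := n) (γ := γ)
      (r := fun j t x => c j * (Real.exp (-(modeRate γ n j * t)) * Real.sin (modeAngle n j * x)))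
      (p := fun j t x => c j * (modeRate γ n j / modeFreq n j * Real.exp (-(modeRate γ n j * t)) *
      Real.cos (modeAngle n j * x + modeAngle n j / 2))) fun j hj => ?_)
  · simp only [add_zero] at h1
    exact h1
  · have hf := hn j hj
    have hα : Real.sin (modeAngle n j * (n + 1)) = 0 := by
      have e : modeAngle n j * (n + 1) = ((j + 1 : ℕ) : ℝ) * Real.pi := by
        rw [modeAngle]
        push_cast
        field_simp
      rw [e, Real.sin_nat_mul_pi]
    have h0 : Real.sin (modeAngle n j / 2) ≠ 0 := fun h => by
      have := hf.1
      rw [modeFreq, h] at this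
      simp at this
    have h2 := (IsForcedChain.mode (γ := γ) n hα h0 (modeRate_eq hγ hf.1 hf.2).1).const_mul (c j)
    simp only [mul_zero] at h2
    exact h2

/-- The momenta in the slow modes are uniformly small. -/
theorem tendsto_modeMomentum {γ : ℝ} (hγ : 0 < γ) (Fbar : ℝ) (c : ℕ → ℝ) (J : ℕ) :
    ∃ e : ℕ → ℝ, Tendsto e atTop (𝓝 0) ∧
      ∀ᶠ n : ℕ in atTop, ∀ t, 0 ≤ t → ∀ x, |modeMomentum γ Fbar c J n t x| ≤ e n := by
  refine ⟨fun n => |Fbar| / (2 * γ) * (1 / ((n : ℝ) + 1)) +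
    ∑ j ∈ Finset.range J, |c j| * |modeRate γ n j / modeFreq n j|, ?_, ?_⟩
  · have h1 : Tendsto (fun n : ℕ => |Fbar| / (2 * γ) * (1 / ((n : ℝ) + 1))) atTop (𝓝 0) := by
      simpa using tendsto_const_nhds.mul (tendsto_one_div_add_atTop_nhds_zero_nat (𝕜 := ℝ))
    have h2 := tendsto_finsetSum (Finset.range J) fun j _ =>
      (tendsto_const_nhds (x := |c j|)).mul (tendsto_modeRate_div hγ j).abs
    simpa using h1.add h2
  · have h : ∀ᶠ n : ℕ in atTop, ∀ j ∈ Finset.range J, 0 < modeFreq n j ∧ modeFreq n j ≤ γ :=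
      (Filter.eventually_all_finset _).2 fun j _ => eventually_modeFreq hγ j
    filter_upwards [h] with n hn t ht x
    refine (abs_add_le _ _).trans (add_le_add (le_of_eq ?_)
      ((Finset.abs_sum_le_sum_abs _ _).trans (Finset.sum_le_sum fun j hj => ?_)))
    · rw [abs_div, abs_of_pos (by positivity : 0 < 2 * γ * ((n : ℝ) + 1))]
      field_simp
    · rw [abs_mul, abs_mul, abs_mul, Real.abs_exp]
      refine mul_le_mul_of_nonneg_left ?_ (abs_nonneg _)
      have h1 : Real.exp (-(modeRate γ n j * t)) ≤ 1 := by
        have := mul_nonneg (modeRate_eq hγ (hn j hj).1 (hn j hj).2).2.1 ht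
        exact Real.exp_le_one_iff.2 (by linarith)
      rw [mul_assoc]
      refine mul_le_of_le_one_right (abs_nonneg _) ?_
      exact mul_le_one₀ h1 (abs_nonneg _) (Real.abs_cos_le_one _)

/-- The partial sums of the macroscopic profile. -/
noncomputable def partialProfile (γ Fbar : ℝ) (c : ℕ → ℝ) (J : ℕ) (t u : ℝ) : ℝ :=
  Fbar * u + ∑ j ∈ Finset.range J, c j * Real.exp (-(heatRate γ j * t)) * sineMode j u

/-- The slow modes converge to the macroscopic profile. -/
theorem tendsto_modeStretch {γ : ℝ} (hγ : 0 < γ) (Fbar : ℝ) (c : ℕ → ℝ) (J : ℕ) {t : ℝ}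
    (ht : 0 ≤ t) : ∃ e : ℕ → ℝ, Tendsto e atTop (𝓝 0) ∧ ∀ᶠ n : ℕ in atTop, ∀ x ≤ n,
      |modeStretch γ Fbar c J n ((n : ℝ) ^ 2 * t) x -
        partialProfile γ Fbar c J t ((x : ℝ) / n)| ≤ e n := by
  refine ⟨fun n => |Fbar| * (1 / ((n : ℝ) + 1)) + ∑ j ∈ Finset.range J, |c j| *
    (|Real.exp (-((n : ℝ) ^ 2 * modeRate γ n j * t)) - Real.exp (-(heatRate γ j * t))| +
      Real.pi * (j + 1) * (1 / ((n : ℝ) + 1))), ?_, ?_⟩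
  · have h0 : ∀ a : ℝ, Tendsto (fun n : ℕ => a * (1 / ((n : ℝ) + 1))) atTop (𝓝 0) := fun a => by
      simpa using tendsto_const_nhds.mul (tendsto_one_div_add_atTop_nhds_zero_nat (𝕜 := ℝ))
    have h1 : ∀ j, Tendsto (fun n : ℕ => |Real.exp (-((n : ℝ) ^ 2 * modeRate γ n j * t)) -
        Real.exp (-(heatRate γ j * t))|) atTop (𝓝 0) := fun j => by
      have h2 := ((Real.continuous_exp.tendsto _).comp
        (((tendsto_mul_modeRate hγ j).mul_const t).neg)).sub_const (Real.exp (-(heatRate γ j * t)))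
      rw [sub_self] at h2
      simpa using h2.abs
    have h2 := tendsto_finsetSum (Finset.range J) fun j _ =>
      (tendsto_const_nhds (x := |c j|)).mul ((h1 j).add (h0 (Real.pi * (j + 1))))
    simpa using (h0 |Fbar|).add h2
  · filter_upwards [eventually_ge_atTop 1] with n hn x hx
    have hn0 : (0 : ℝ) < n := by exact_mod_cast hn
    have hx' : (x : ℝ) ≤ n := by exact_mod_cast hx
    -- The exact modes live on the grid of mesh `1/(n+1)`, as the force sits at site `n + 1`, while
    -- the profile is sampled at `x/n`.
    have hq : |(x : ℝ) / (n + 1) - x / n| ≤ 1 / ((n : ℝ) + 1) := by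
      have e : (x : ℝ) / (n + 1) - x / n = -((x / n) * (1 / ((n : ℝ) + 1))) := by
        field_simp
        ring
      rw [e, abs_neg, abs_of_nonneg (by positivity)]
      exact mul_le_of_le_one_left (by positivity) ((div_le_one hn0).2 hx')
    have e : modeStretch γ Fbar c J n ((n : ℝ) ^ 2 * t) x -
        partialProfile γ Fbar c J t ((x : ℝ) / n) = Fbar * ((x : ℝ) / (n + 1) - x / n) +
        ∑ j ∈ Finset.range J, c j * ((Real.exp (-((n : ℝ) ^ 2 * modeRate γ n j * t)) -
          Real.exp (-(heatRate γ j * t))) * Real.sin (modeAngle n j * x) +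
          Real.exp (-(heatRate γ j * t)) *
            (Real.sin (modeAngle n j * x) - sineMode j ((x : ℝ) / n))) := by
      rw [modeStretch, partialProfile, add_sub_add_comm, ← Finset.sum_sub_distrib]
      congr 1
      · ring
      · refine Finset.sum_congr rfl fun j _ => ?_
        rw [show modeRate γ n j * ((n : ℝ) ^ 2 * t) = (n : ℝ) ^ 2 * modeRate γ n j * t by ring]
        ring
    rw [e]
    refine (abs_add_le _ _).trans (add_le_add ?_
      ((Finset.abs_sum_le_sum_abs _ _).trans (Finset.sum_le_sum fun j hj => ?_)))
    · rw [abs_mul]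
      exact mul_le_mul_of_nonneg_left hq (abs_nonneg _)
    · rw [abs_mul]
      refine mul_le_mul_of_nonneg_left ((abs_add_le _ _).trans (add_le_add ?_ ?_)) (abs_nonneg _)
      · rw [abs_mul]
        exact mul_le_of_le_one_right (abs_nonneg _) (Real.abs_sin_le_one _)
      · rw [abs_mul, Real.abs_exp]
        have h1 : Real.exp (-(heatRate γ j * t)) ≤ 1 := by
          have := mul_nonneg (heatRate_pos hγ j).le ht
          exact Real.exp_le_one_iff.2 (by linarith)
        refine (mul_le_of_le_one_left (abs_nonneg _) h1).trans ?_
        have hsin : |Real.sin (modeAngle n j * x) - sineMode j ((x : ℝ) / n)| ≤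
            |modeAngle n j * x - Real.pi * (j + 1) * ((x : ℝ) / n)| := by
          have := Real.lipschitzWith_sin.dist_le_mul (modeAngle n j * x)
            (Real.pi * (j + 1) * ((x : ℝ) / n))
          simpa [Real.dist_eq, sineMode] using this
        refine hsin.trans ?_
        have e2 : modeAngle n j * x - Real.pi * (j + 1) * ((x : ℝ) / n) =
            Real.pi * (j + 1) * ((x : ℝ) / (n + 1) - x / n) := by
          rw [modeAngle]
          ring
        have hp : 0 ≤ Real.pi * ((j : ℝ) + 1) := by
          have := Real.pi_pos
          positivity
        rw [e2, abs_mul, abs_of_nonneg hp]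
        exact mul_le_mul_of_nonneg_left hq hp

/-- The partial sums of the macroscopic profile converge uniformly in space. -/
theorem tendsto_partialProfile {γ : ℝ} (hγ : 0 < γ) (Fbar : ℝ) {c : ℕ → ℝ} (hc : PolyGrowth c)
    {t : ℝ} (ht : 0 < t) {ε : ℝ} (hε : 0 < ε) : ∀ᶠ J : ℕ in atTop, ∀ u,
      |partialProfile γ Fbar c J t u - heatProfile γ Fbar c t u| ≤ ε := by
  have hs := hc.summable hγ ht
  have hu := tendstoUniformly_tsum_nat (f := fun j u =>
    c j * Real.exp (-(heatRate γ j * t)) * sineMode j u) hs fun j u => by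
      rw [Real.norm_eq_abs, abs_mul, abs_mul, Real.abs_exp]
      exact mul_le_of_le_one_right (by positivity) (abs_sineMode_le j u)
  filter_upwards [Metric.tendstoUniformly_iff.1 hu ε hε] with J hJ u
  have h := (hJ u).le
  rw [Real.dist_eq, abs_sub_comm] at h
  rw [partialProfile, heatProfile, add_sub_add_left_eq_sub]
  exact h

end HarmonicChain

namespace HarmonicChain

/-! ### Convergence to the macroscopic profile -/

theorem sum_Icc_one_eq (f : ℕ → ℝ) (n : ℕ) :
    ∑ x ∈ Finset.Icc 1 n, f x = ∑ x ∈ Finset.range n, f (x + 1) := by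
  induction n with
  | zero => simp
  | succ n ih => rw [Finset.sum_Icc_succ_top (by omega), Finset.sum_range_succ, ih]

theorem abs_modeStretch_zero_le (γ Fbar : ℝ) (c : ℕ → ℝ) (J : ℕ) {n x : ℕ} (hx : x ≤ n) :
    |modeStretch γ Fbar c J n 0 x| ≤ |Fbar| + ∑ j ∈ Finset.range J, |c j| := by
  rw [modeStretch]
  refine (abs_add_le _ _).trans (add_le_add ?_
    ((Finset.abs_sum_le_sum_abs _ _).trans (Finset.sum_le_sum fun j _ => ?_)))
  · have h : (x : ℝ) ≤ n := by exact_mod_cast hx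
    rw [mul_div_assoc, abs_mul]
    refine mul_le_of_le_one_right (abs_nonneg _) ?_
    rw [abs_of_nonneg (by positivity), div_le_one (by positivity)]
    linarith
  · rw [mul_zero, neg_zero, Real.exp_zero, one_mul, abs_mul]
    exact mul_le_of_le_one_right (abs_nonneg _) (Real.abs_sin_le_one _)

/-- The discrepancy between the chain at the macroscopic time `t` and the macroscopic profile. -/
theorem tendsto_discrepancy {γ : ℝ} (hγ : 0 < γ) {G H : ℝ → ℝ} {a b : ℝ}
    (hH : ∀ t, HasDerivAt H (G t) t) (ha : ∀ t, |G t| ≤ a) (hb : ∀ t, |H t| ≤ b) (Fbar : ℝ)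
    {ρ : ℝ → ℝ} (hρ : Continuous ρ) {r p : ℕ → ℝ → ℕ → ℝ}
    (hchain : ∀ n : ℕ, 1 ≤ n → IsForcedChain γ n (fun s => Fbar + 1 / √(n : ℝ) * G s) (r n) (p n))
    {K : ℝ} (hAvg : ∀ n : ℕ, 1 ≤ n → 1 / (n : ℝ) * ∑ x ∈ Finset.range (n + 1),
      (r n 0 x ^ 2 + p n 0 x ^ 2) ≤ K)
    (hProfile : Tendsto (fun n : ℕ => 1 / (n : ℝ) * ∑ x ∈ Finset.Icc 1 n,
      (r n 0 x - ρ ((x : ℝ) / n)) ^ 2) atTop (𝓝 0)) {t : ℝ} (ht : 0 < t) :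
    Tendsto (fun n : ℕ => 1 / (n : ℝ) * (∑ x ∈ Finset.Icc 1 n, (r n ((n : ℝ) ^ 2 * t) x -
        heatProfile γ Fbar (sineCoeff fun u => ρ u - Fbar * u) t ((x : ℝ) / n)) ^ 2 +
      ∑ x ∈ Finset.range (n + 1), p n ((n : ℝ) ^ 2 * t) x ^ 2)) atTop (𝓝 0) := by
  have hh : Continuous fun u => ρ u - Fbar * u := by fun_prop
  set c := sineCoeff fun u => ρ u - Fbar * u with hc
  rw [Metric.tendsto_nhds]
  intro ε' hε'
  -- The minimum with `1` gives `ε² ≤ ε`; the errors collected below add up to at most `16 ε` per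
  -- site.
  set ε : ℝ := min 1 (ε' / 20) with hε
  have hε0 : 0 < ε := lt_min one_pos (by positivity)
  obtain ⟨η, hη, hmain⟩ := eventually_chainEnergy_le hγ hH ha hb ht hε0
  -- One `J` for two purposes: the initial remainder is below `η/6` in mean square, since a factor
  -- `3` is lost below, and the tail of the series at time `t` is uniformly below `ε`.
  obtain ⟨J, hJ1, hJ2⟩ := (((tendsto_integral_sq_sub_partial hh).eventually_lt_const
    (by positivity : 0 < η / 6)).and
    (tendsto_partialProfile hγ Fbar (polyGrowth_sineCoeff hh) ht hε0)).exists
  rw [← hc] at hJ1 hJ2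
  obtain ⟨e₀, he₀, hs₀⟩ := tendsto_modeStretch hγ Fbar c J le_rfl
  obtain ⟨e₁, he₁, hs₁⟩ := tendsto_modeStretch hγ Fbar c J ht.le
  obtain ⟨e₂, he₂, hs₂⟩ := tendsto_modeMomentum hγ Fbar c J
  have hmode := eventually_isForcedChain_mode hγ Fbar c J
  set L : ℝ := |Fbar| + ∑ j ∈ Finset.range J, |c j| with hL
  -- the initial discrepancy
  have hR : Tendsto (fun n : ℕ => 1 / (n : ℝ) * ∑ x ∈ Finset.Icc 1 n,
      (ρ ((x : ℝ) / n) - partialProfile γ Fbar c J 0 ((x : ℝ) / n)) ^ 2) atTop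
      (𝓝 (∫ u in (0 : ℝ)..1, (ρ u - partialProfile γ Fbar c J 0 u) ^ 2)) := by
    refine tendsto_riemann_right (g := fun u => (ρ u - partialProfile γ Fbar c J 0 u) ^ 2) ?_
    have : Continuous (partialProfile γ Fbar c J 0) := by
      unfold partialProfile
      fun_prop
    exact Continuous.continuousOn (by fun_prop)
  have hRint : ∫ u in (0 : ℝ)..1, (ρ u - partialProfile γ Fbar c J 0 u) ^ 2 < η / 6 := by
    refine lt_of_eq_of_lt ?_ hJ1
    congr 1 with u
    simp only [partialProfile, mul_zero, neg_zero, Real.exp_zero, mul_one]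
    ring
  have hinit : Tendsto (fun n : ℕ => 3 * (1 / (n : ℝ) * ∑ x ∈ Finset.Icc 1 n,
      (r n 0 x - ρ ((x : ℝ) / n)) ^ 2) + 3 * (1 / (n : ℝ) * ∑ x ∈ Finset.Icc 1 n,
      (ρ ((x : ℝ) / n) - partialProfile γ Fbar c J 0 ((x : ℝ) / n)) ^ 2) + 3 * e₀ n ^ 2) atTop
      (𝓝 (3 * 0 + 3 * (∫ u in (0 : ℝ)..1, (ρ u - partialProfile γ Fbar c J 0 u) ^ 2) +
        3 * 0 ^ 2)) :=
    ((hProfile.const_mul 3).add (hR.const_mul 3)).add ((he₀.pow 2).const_mul 3)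
  -- By linearity the chain minus the modes is driven by the oscillation alone. The constant bounds
  -- its initial energy per site: `K` from the data, `L²` from the mode stretches and `2` from the
  -- mode momenta.
  have hevent := hmain (fun n s x => r n s x - modeStretch γ Fbar c J n s x)
    (fun n s x => p n s x - modeMomentum γ Fbar c J n s x) (K + L ^ 2 + 2) ?_ ?_ ?_
  · have h1 := he₁.pow 2
    have h2 := he₂.pow 2
    rw [zero_pow two_ne_zero] at h1 h2
    filter_upwards [hevent, hs₁, hs₂, h1.eventually_le_const hε0, h2.eventually_le_const hε0,
      eventually_ge_atTop 1] with n hE hr hp h1 h2 hn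
    have hn0 : (0 : ℝ) < n := by exact_mod_cast hn
    have hn1 : (1 : ℝ) ≤ n := by exact_mod_cast hn
    rw [Real.dist_0_eq_abs, abs_of_nonneg (by positivity)]
    rw [chainEnergy] at hE
    have hA : ∑ x ∈ Finset.Icc 1 n, (r n ((n : ℝ) ^ 2 * t) x -
        heatProfile γ Fbar c t ((x : ℝ) / n)) ^ 2 ≤
        3 * ∑ x ∈ Finset.range n, (r n ((n : ℝ) ^ 2 * t) (x + 1) -
          modeStretch γ Fbar c J n ((n : ℝ) ^ 2 * t) (x + 1)) ^ 2 + n * (6 * ε) := by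
      rw [sum_Icc_one_eq (fun x => (r n ((n : ℝ) ^ 2 * t) x -
        heatProfile γ Fbar c t ((x : ℝ) / n)) ^ 2), Finset.mul_sum]
      have : (n : ℝ) * (6 * ε) = ∑ x ∈ Finset.range n, 6 * ε := by simp
      rw [this, ← Finset.sum_add_distrib]
      refine Finset.sum_le_sum fun x hx => ?_
      have b1 := hr (x + 1) (Finset.mem_range.1 hx)
      have b2 := hJ2 (((x + 1 : ℕ) : ℝ) / n)
      have b3 := (sq_le_sq' (neg_le_of_abs_le b1) (le_of_abs_le b1)).trans h1
      have b4 := sq_le_sq' (neg_le_of_abs_le b2) (le_of_abs_le b2)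
      have b5 : ε ^ 2 ≤ ε := by nlinarith [min_le_left 1 (ε' / 20)]
      set A := r n ((n : ℝ) ^ 2 * t) (x + 1)
      set B := modeStretch γ Fbar c J n ((n : ℝ) ^ 2 * t) (x + 1)
      set C := partialProfile γ Fbar c J t (((x + 1 : ℕ) : ℝ) / n)
      set D := heatProfile γ Fbar c t (((x + 1 : ℕ) : ℝ) / n)
      nlinarith [sq_nonneg ((A - B) - (B - C)), sq_nonneg ((A - B) - (C - D)),
        sq_nonneg ((B - C) - (C - D))]
    have hB : ∑ x ∈ Finset.range (n + 1), p n ((n : ℝ) ^ 2 * t) x ^ 2 ≤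
        2 * ∑ x ∈ Finset.range (n + 1), (p n ((n : ℝ) ^ 2 * t) x -
          modeMomentum γ Fbar c J n ((n : ℝ) ^ 2 * t) x) ^ 2 + (n + 1) * (2 * ε) := by
      rw [Finset.mul_sum]
      have : ((n : ℝ) + 1) * (2 * ε) = ∑ x ∈ Finset.range (n + 1), 2 * ε := by simp
      rw [this, ← Finset.sum_add_distrib]
      refine Finset.sum_le_sum fun x hx => ?_
      have b1 := hp ((n : ℝ) ^ 2 * t) (by positivity) x
      have b3 := (sq_le_sq' (neg_le_of_abs_le b1) (le_of_abs_le b1)).trans h2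
      set A := p n ((n : ℝ) ^ 2 * t) x
      set B := modeMomentum γ Fbar c J n ((n : ℝ) ^ 2 * t) x
      nlinarith [sq_nonneg ((A - B) - B)]
    rw [one_div_mul_eq_div, div_lt_iff₀ hn0]
    have hS : 0 ≤ ∑ x ∈ Finset.range (n + 1), (p n ((n : ℝ) ^ 2 * t) x -
          modeMomentum γ Fbar c J n ((n : ℝ) ^ 2 * t) x) ^ 2 := by positivity
    have hε20 : 20 * ε ≤ ε' := by
      have := min_le_right 1 (ε' / 20)
      rw [← hε] at this
      linarith
    have h5 : 20 * ε * n ≤ ε' * n := mul_le_mul_of_nonneg_right hε20 hn0.le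
    have h6 : ε ≤ ε * n := le_mul_of_one_le_right hε0.le hn1
    have h7 : 0 < ε * n := by positivity
    nlinarith
  · filter_upwards [hmode, eventually_ge_atTop 1] with n h1 hn
    have := (hchain n hn).sub h1
    simpa only [add_sub_cancel_left] using this
  · have h2 := he₂.pow 2
    rw [zero_pow two_ne_zero] at h2
    filter_upwards [hs₂, h2.eventually_le_const one_pos, eventually_ge_atTop 1] with n hp h2 hn
    have hn0 : (0 : ℝ) < n := by exact_mod_cast hn
    have hn1 : (1 : ℝ) ≤ n := by exact_mod_cast hn
    have hA := hAvg n hn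
    rw [one_div_mul_eq_div, div_le_iff₀ hn0, Finset.sum_add_distrib, Finset.sum_range_succ',
      (hchain n hn).left] at hA
    have hB : ∑ x ∈ Finset.range n, (r n 0 (x + 1) - modeStretch γ Fbar c J n 0 (x + 1)) ^ 2 ≤
        2 * ∑ x ∈ Finset.range n, r n 0 (x + 1) ^ 2 + n * (2 * L ^ 2) := by
      rw [Finset.mul_sum]
      have : (n : ℝ) * (2 * L ^ 2) = ∑ x ∈ Finset.range n, 2 * L ^ 2 := by simp
      rw [this, ← Finset.sum_add_distrib]
      refine Finset.sum_le_sum fun x hx => ?_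
      have b1 := abs_modeStretch_zero_le γ Fbar c J (n := n) (x := x + 1) (Finset.mem_range.1 hx)
      have b2 := sq_le_sq' (neg_le_of_abs_le b1) (le_of_abs_le b1)
      nlinarith [sq_nonneg (r n 0 (x + 1) + modeStretch γ Fbar c J n 0 (x + 1))]
    have hC : ∑ x ∈ Finset.range (n + 1), (p n 0 x - modeMomentum γ Fbar c J n 0 x) ^ 2 ≤
        2 * ∑ x ∈ Finset.range (n + 1), p n 0 x ^ 2 + (n + 1) * 2 := by
      rw [Finset.mul_sum]
      have : ((n : ℝ) + 1) * 2 = ∑ x ∈ Finset.range (n + 1), (2 : ℝ) := by simp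
      rw [this, ← Finset.sum_add_distrib]
      refine Finset.sum_le_sum fun x hx => ?_
      have b1 := hp 0 le_rfl x
      have b2 := (sq_le_sq' (neg_le_of_abs_le b1) (le_of_abs_le b1)).trans h2
      nlinarith [sq_nonneg (p n 0 x + modeMomentum γ Fbar c J n 0 x)]
    rw [chainEnergy]
    nlinarith
  · have h0 : 3 * 0 + 3 * (∫ u in (0 : ℝ)..1, (ρ u - partialProfile γ Fbar c J 0 u) ^ 2) +
        3 * 0 ^ 2 < η := by linarith
    filter_upwards [hinit.eventually_le_const h0, hs₀, eventually_ge_atTop 1] with n h1 hr hn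
    have hn0 : (0 : ℝ) < n := by exact_mod_cast hn
    simp only [mul_zero] at hr
    have hA : ∑ x ∈ Finset.range n, (r n 0 (x + 1) - modeStretch γ Fbar c J n 0 (x + 1)) ^ 2 ≤
        3 * ∑ x ∈ Finset.Icc 1 n, (r n 0 x - ρ ((x : ℝ) / n)) ^ 2 +
        3 * ∑ x ∈ Finset.Icc 1 n,
          (ρ ((x : ℝ) / n) - partialProfile γ Fbar c J 0 ((x : ℝ) / n)) ^ 2 +
        n * (3 * e₀ n ^ 2) := by
      rw [sum_Icc_one_eq (fun x => (r n 0 x - ρ ((x : ℝ) / n)) ^ 2),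
        sum_Icc_one_eq (fun x => (ρ ((x : ℝ) / n) - partialProfile γ Fbar c J 0 ((x : ℝ) / n)) ^ 2),
        Finset.mul_sum, Finset.mul_sum]
      have : (n : ℝ) * (3 * e₀ n ^ 2) = ∑ x ∈ Finset.range n, 3 * e₀ n ^ 2 := by simp
      rw [this, ← Finset.sum_add_distrib, ← Finset.sum_add_distrib]
      refine Finset.sum_le_sum fun x hx => ?_
      have b1 := hr (x + 1) (Finset.mem_range.1 hx)
      have b3 := sq_le_sq' (neg_le_of_abs_le b1) (le_of_abs_le b1)
      set A := r n 0 (x + 1)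
      set B := ρ (((x + 1 : ℕ) : ℝ) / n)
      set C := partialProfile γ Fbar c J 0 (((x + 1 : ℕ) : ℝ) / n)
      set D := modeStretch γ Fbar c J n 0 (x + 1)
      nlinarith [sq_nonneg ((A - B) - (B - C)), sq_nonneg ((A - B) - (C - D)),
        sq_nonneg ((B - C) - (C - D))]
    refine hA.trans ?_
    have h2 := mul_le_mul_of_nonneg_right h1 hn0.le
    refine le_trans (le_of_eq ?_) h2
    field_simp

/-! ### Riemann sums along converging profiles -/

/-- Cauchy–Schwarz, with the mean of `ψ²` bounded because it converges as a Riemann sum. -/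
theorem tendsto_sum_mul_of_tendsto_sq {ψ : ℝ → ℝ} (hψ : ContinuousOn ψ (Icc 0 1)) {d : ℕ → ℕ → ℝ}
    (hd : Tendsto (fun n : ℕ => 1 / (n : ℝ) * ∑ x ∈ Finset.Icc 1 n, d n x ^ 2) atTop (𝓝 0)) :
    Tendsto (fun n : ℕ => 1 / (n : ℝ) * ∑ x ∈ Finset.Icc 1 n, ψ ((x : ℝ) / n) * d n x) atTop
      (𝓝 0) := by
  have h1 := (tendsto_riemann_right (g := fun u => ψ u ^ 2) (hψ.pow 2)).mul hd
  rw [mul_zero] at h1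
  have h2 : Tendsto (fun n : ℕ => (1 / (n : ℝ) * ∑ x ∈ Finset.Icc 1 n, ψ ((x : ℝ) / n) * d n x) ^ 2)
      atTop (𝓝 0) := by
    refine squeeze_zero (fun _ => sq_nonneg _) (fun n => ?_) h1
    have := Finset.sum_mul_sq_le_sq_mul_sq (Finset.Icc 1 n) (fun x : ℕ => ψ ((x : ℝ) / n)) (d n)
    rw [mul_pow, mul_mul_mul_comm, ← sq]
    exact mul_le_mul_of_nonneg_left this (sq_nonneg _)
  have h3 := h2.sqrt
  rw [Real.sqrt_zero] at h3
  simp only [Real.sqrt_sq_eq_abs] at h3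
  exact (tendsto_zero_iff_abs_tendsto_zero _).2 h3

theorem tendsto_sum_mul_profile {f ψ : ℝ → ℝ} (hf : ContinuousOn f (Icc 0 1))
    (hψ : ContinuousOn ψ (Icc 0 1)) {r : ℕ → ℕ → ℝ}
    (hd : Tendsto (fun n : ℕ => 1 / (n : ℝ) * ∑ x ∈ Finset.Icc 1 n,
      (r n x - f ((x : ℝ) / n)) ^ 2) atTop (𝓝 0)) :
    Tendsto (fun n : ℕ => 1 / (n : ℝ) * ∑ x ∈ Finset.Icc 1 n, ψ ((x : ℝ) / n) * r n x) atTop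
      (𝓝 (∫ u in (0 : ℝ)..1, ψ u * f u)) := by
  have h1 := (tendsto_riemann_right (g := fun u => ψ u * f u) (hψ.mul hf)).add
    (tendsto_sum_mul_of_tendsto_sq hψ hd)
  rw [add_zero] at h1
  refine h1.congr fun n => ?_
  rw [← mul_add, ← Finset.sum_add_distrib]
  congr 1
  exact Finset.sum_congr rfl fun x _ => by ring

theorem abs_sum_mul_le {s : Finset ℕ} {M : ℝ} {a d : ℕ → ℝ} (ha : ∀ x ∈ s, |a x| ≤ M)
    (hd : ∀ x ∈ s, 0 ≤ d x) : |∑ x ∈ s, a x * d x| ≤ M * ∑ x ∈ s, d x := by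
  rw [Finset.mul_sum]
  refine (Finset.abs_sum_le_sum_abs _ _).trans (Finset.sum_le_sum fun x hx => ?_)
  rw [abs_mul, abs_of_nonneg (hd x hx)]
  exact mul_le_mul_of_nonneg_right (ha x hx) (hd x hx)

theorem tendsto_sum_mul_of_tendsto_nonneg {ψ : ℝ → ℝ} (hψ : ContinuousOn ψ (Icc 0 1))
    {s : ℕ → Finset ℕ} (hs : ∀ n, ∀ x ∈ s n, x ≤ n) {d : ℕ → ℕ → ℝ} (hd0 : ∀ n x, 0 ≤ d n x)
    (hd : Tendsto (fun n : ℕ => 1 / (n : ℝ) * ∑ x ∈ s n, d n x) atTop (𝓝 0)) :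
    Tendsto (fun n : ℕ => 1 / (n : ℝ) * ∑ x ∈ s n, ψ ((x : ℝ) / n) * d n x) atTop (𝓝 0) := by
  obtain ⟨M, hM⟩ := isCompact_Icc.exists_bound_of_continuousOn hψ
  have h1 := hd.const_mul M
  rw [mul_zero] at h1
  refine squeeze_zero_norm (fun n => ?_) h1
  rw [Real.norm_eq_abs, abs_mul, abs_of_nonneg (by positivity : (0 : ℝ) ≤ 1 / n), mul_left_comm]
  refine mul_le_mul_of_nonneg_left (abs_sum_mul_le (fun x hx => hM _ ⟨by positivity, ?_⟩)
    fun x _ => hd0 n x) (by positivity)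
  exact div_le_one_of_le₀ (by exact_mod_cast hs n x hx) (Nat.cast_nonneg n)

/-- Expand `r² = f² + 2 f (r - f) + (r - f)²`: a Riemann sum, a Cauchy–Schwarz term and a
nonnegative vanishing term. -/
theorem tendsto_sum_mul_profile_sq {f ψ : ℝ → ℝ} (hf : ContinuousOn f (Icc 0 1))
    (hψ : ContinuousOn ψ (Icc 0 1)) {r : ℕ → ℕ → ℝ}
    (hd : Tendsto (fun n : ℕ => 1 / (n : ℝ) * ∑ x ∈ Finset.Icc 1 n,
      (r n x - f ((x : ℝ) / n)) ^ 2) atTop (𝓝 0)) :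
    Tendsto (fun n : ℕ => 1 / (n : ℝ) * ∑ x ∈ Finset.Icc 1 n, ψ ((x : ℝ) / n) * r n x ^ 2) atTop
      (𝓝 (∫ u in (0 : ℝ)..1, ψ u * f u ^ 2)) := by
  have h1 := ((tendsto_riemann_right (g := fun u => ψ u * f u ^ 2) (hψ.mul (hf.pow 2))).add
    ((tendsto_sum_mul_of_tendsto_sq (ψ := fun u => ψ u * f u) (hψ.mul hf) hd).const_mul 2)).add
    (tendsto_sum_mul_of_tendsto_nonneg hψ (fun n x hx => (Finset.mem_Icc.1 hx).2)
      (fun n x => sq_nonneg _) hd)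
  rw [mul_zero, add_zero, add_zero] at h1
  refine h1.congr fun n => ?_
  rw [mul_left_comm, ← mul_add, ← mul_add, Finset.mul_sum, ← Finset.sum_add_distrib,
    ← Finset.sum_add_distrib]
  congr 1
  exact Finset.sum_congr rfl fun x _ => by ring

end HarmonicChain

/-! ### The averages as a solution of the damped chain -/

namespace HarmonicChain

theorem hasDerivAt_of_eq_add_integral {y : ℝ≥0 → ℝ} {g : ℝ → ℝ} (hg : Continuous g)
    (h : ∀ t : ℝ≥0, y t = y 0 + ∫ s in (0 : ℝ)..t, g s) {t : ℝ} (ht : 0 < t) :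
    HasDerivAt (fun t => y t.toNNReal) (g t) t := by
  have h1 := ((hg.integral_hasStrictDerivAt 0 t).hasDerivAt).const_add (y 0)
  refine h1.congr_of_eventuallyEq ?_
  filter_upwards [Ioi_mem_nhds ht] with s hs
  rw [h s.toNNReal, Real.coe_toNNReal s (le_of_lt hs)]

/-- The averages of the chain solve the equations of motion of the damped chain. -/
theorem IsChainProcess.isForcedChain {Ω : Type*} [MeasurableSpace Ω] {P : Measure Ω}
    [IsProbabilityMeasure P] {γ : ℝ≥0} {T : ℝ} {n : ℕ} {F : ℝ → ℝ} {N : ℕ → ℝ≥0 → Ω → ℕ}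
    {w : ℝ≥0 → Ω → ℝ} {X : ℝ≥0 → Ω → Config n} (h : IsChainProcess P γ T n F N w X) (hγ : 0 < γ)
    (hn : 1 ≤ n) (hF : Continuous F) (hInt : Integrable (X 0) P) :
    IsForcedChain γ n F
      (fun t x => if x ≤ n then meanStretch P X t.toNNReal x else F t)
      (fun t x => meanMomentum P X t.toNNReal x) where
  left t := by simp [meanStretch, stretch_zero]
  -- By convention the stretch at site `n + 1` is `0`, so the family is overridden there by the
  -- force.
  right t := if_neg (by omega)
  continuous_stretch x hx := by
    simp only [hx, if_true]
    exact (h.continuous_meanStretch hn hF hInt x).comp continuous_real_toNNReal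
  continuous_momentum x _ :=
    (h.continuous_meanMomentum hγ hn hF hInt x).comp continuous_real_toNNReal
  deriv_stretch x hx t ht := by
    have hx1 : x + 1 ≤ n := hx
    simp only [hx1, if_true]
    have hc : ∀ y, Continuous fun s : ℝ => meanMomentum P X s.toNNReal y := fun y =>
      (h.continuous_meanMomentum hγ hn hF hInt y).comp continuous_real_toNNReal
    exact hasDerivAt_of_eq_add_integral ((hc (x + 1)).sub (hc x))
      (fun t => h.meanStretch_eq hn hF hInt (Nat.le_add_left 1 x) hx1 t) ht
  deriv_momentum x hx t ht := by
    have hcM : ∀ y, Continuous fun s : ℝ => meanMomentum P X s.toNNReal y := fun y =>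
      (h.continuous_meanMomentum hγ hn hF hInt y).comp continuous_real_toNNReal
    have hcS : ∀ y, Continuous fun s : ℝ => meanStretch P X s.toNNReal y := fun y =>
      (h.continuous_meanStretch hn hF hInt y).comp continuous_real_toNNReal
    have hc : Continuous fun s : ℝ => if x = n then F s else meanStretch P X s.toNNReal (x + 1) := by
      split_ifs
      · exact hF
      · exact hcS _
    refine (hasDerivAt_of_eq_add_integral ((hc.sub (hcS x)).sub ((hcM x).const_mul (2 * γ)))
      (fun t => h.meanMomentum_eq_add hγ hn hF hInt hx t) ht).congr_deriv ?_
    have e : (x + 1 ≤ n) ↔ ¬ x = n := by omega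
    simp only [Pi.sub_apply, hx, if_true, e, ite_not]

end HarmonicChain

/-! ### Assembly of the main theorem -/

theorem mainTheorem3
    (γ : ℝ≥0) (hγ : 0 < γ) (T : ℝ) (hT : 0 < T)
    -- the force
    (Fbar : ℝ) (θ : ℝ) (hθ : 0 < θ) (Fhat : ℤ → ℂ)
    (hFreal : ∀ ℓ : ℤ, ℓ ≠ 0 → Fhat (-ℓ) = (starRingEnd ℂ) (Fhat ℓ))
    (hFsum : Summable fun ℓ : ℤ => ‖Fhat ℓ‖)
    -- for every `n ≥ 1`, the stretch/momentum process of the chain of length `n`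
    {Ω : ℕ → Type*} [∀ n, MeasurableSpace (Ω n)]
    (P : ∀ n, Measure (Ω n)) [∀ n, IsProbabilityMeasure (P n)]
    (N : ∀ n, ℕ → ℝ≥0 → Ω n → ℕ) (w : ∀ n, ℝ≥0 → Ω n → ℝ)
    (X : ∀ n, ℝ≥0 → Ω n → HarmonicChain.Config n)
    (hX : ∀ n, 1 ≤ n → HarmonicChain.IsChainProcess (P n) γ T n
      (HarmonicChain.force Fbar Fhat θ n) (N n) (w n) (X n))
    -- the initial averages exist and are bounded in mean square
    (hInt : ∀ n, 1 ≤ n → Integrable (X n 0) (P n))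
    (hAvg : ∃ H : ℝ, 0 < H ∧ ∀ n : ℕ, 1 ≤ n →
      1 / (n : ℝ) * ∑ x ∈ Finset.range (n + 1),
        (HarmonicChain.meanStretch (P n) (X n) 0 x ^ 2 +
          HarmonicChain.meanMomentum (P n) (X n) 0 x ^ 2) ≤ H)
    -- the initial stretch profile
    (r₀ : ℝ → ℝ) (hr₀ : ContinuousOn r₀ (Set.Icc 0 1))
    (hProfile : Tendsto (fun n : ℕ => 1 / (n : ℝ) * ∑ x ∈ Finset.Icc 1 n,
      (HarmonicChain.meanStretch (P n) (X n) 0 x - r₀ ((x : ℝ) / n)) ^ 2) atTop (𝓝 0)) :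
    -- the averages exist at all times
    (∀ n, 1 ≤ n → ∀ t, Integrable (X n t) (P n)) ∧
    -- the macroscopic equation has a unique weak solution
    (∃! m : ℝ≥0 → SignedMeasure unitInterval, HarmonicChain.IsWeakSolution γ Fbar r₀ m) ∧
    -- its smooth density `r` is the limit profile
    ∃ r : ℝ → ℝ → ℝ,
      ContDiffOn ℝ (⊤ : ℕ∞) (Function.uncurry r) (Set.Ioi 0 ×ˢ Set.Icc 0 1) ∧
      (∀ m : ℝ≥0 → SignedMeasure unitInterval, HarmonicChain.IsWeakSolution γ Fbar r₀ m →
        ∀ t : ℝ≥0, 0 < t →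
          m t = (volume : Measure unitInterval).withDensityᵥ fun u => r t u) ∧
      ∀ φ : ℝ → ℝ, ContinuousOn φ (Set.Icc 0 1) → ∀ t : ℝ≥0, 0 < t →
        Tendsto (fun n : ℕ => 1 / (n : ℝ) * ∑ x ∈ Finset.Icc 1 n,
            φ ((x : ℝ) / n) * HarmonicChain.meanStretch (P n) (X n) ((n : ℝ≥0) ^ 2 * t) x)
          atTop (𝓝 (∫ u in (0 : ℝ)..1, r t u * φ u)) ∧
        Tendsto (fun n : ℕ => 1 / (n : ℝ) * ∑ x ∈ Finset.range (n + 1),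
            φ ((x : ℝ) / n) * HarmonicChain.mechEnergy (P n) (X n) ((n : ℝ≥0) ^ 2 * t) x)
          atTop (𝓝 (∫ u in (0 : ℝ)..1, φ u * (1 / 2 * r t u ^ 2))) := by
  obtain ⟨G, a, b, hG, ha, hb⟩ := HarmonicChain.exists_primitive_oscillation hFsum hθ
  have hF : ∀ n : ℕ, Continuous (HarmonicChain.force Fbar Fhat θ n) := fun n =>
    continuous_const.add (continuous_const.mul (HarmonicChain.continuous_oscillation hFsum θ))
  have hγ' : (0 : ℝ) < γ := hγ
  set ρ : ℝ → ℝ := fun u => r₀ (projIcc (0 : ℝ) 1 zero_le_one u) with hρdef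
  have hρ : Continuous ρ := HarmonicChain.continuous_comp_projIcc hr₀
  have hρr : ∀ u ∈ Icc (0 : ℝ) 1, ρ u = r₀ u := fun u hu => HarmonicChain.comp_projIcc_eq r₀ hu
  have hh : Continuous fun u => ρ u - Fbar * u := by fun_prop
  have hsol := HarmonicChain.isWeakSolution_profileMeasure hγ' Fbar hρ hρr
  refine ⟨fun n hn => (hX n hn).integrable hn (hF n) (hInt n hn),
    ⟨_, hsol, fun m hm => hm.unique hγ' hsol⟩,
    HarmonicChain.heatProfile γ Fbar (HarmonicChain.sineCoeff fun u => ρ u - Fbar * u),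
    HarmonicChain.contDiffOn_heatProfile hγ' Fbar (HarmonicChain.polyGrowth_sineCoeff hh),
    fun m hm t ht => ?_, fun φ hφ t ht => ?_⟩
  · rw [hm.unique hγ' hsol]
    have ht' : (t : ℝ) ≠ 0 := by exact_mod_cast ht.ne'
    simp only [HarmonicChain.profileMeasure, HarmonicChain.profile, if_neg ht']
  · have ht' : (0 : ℝ) < t := ht
    set f := HarmonicChain.heatProfile γ Fbar
      (HarmonicChain.sineCoeff fun u => ρ u - Fbar * u) t with hf
    have hfc : ContinuousOn f (Icc 0 1) := (HarmonicChain.continuous_heatProfile hγ' Fbar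
      (HarmonicChain.polyGrowth_sineCoeff hh) ht').continuousOn
    obtain ⟨K, -, hK⟩ := hAvg
    have key := HarmonicChain.tendsto_discrepancy hγ' hG ha hb Fbar hρ
      (r := fun n s x => if x ≤ n then HarmonicChain.meanStretch (P n) (X n) s.toNNReal x
        else HarmonicChain.force Fbar Fhat θ n s)
      (p := fun n s x => HarmonicChain.meanMomentum (P n) (X n) s.toNNReal x)
      (fun n hn => (hX n hn).isForcedChain hγ hn (hF n) (hInt n hn)) (K := K) (fun n hn => ?_)
      ?_ ht'
    · have htime : ∀ n : ℕ, ((n : ℝ) ^ 2 * t).toNNReal = (n : ℝ≥0) ^ 2 * t := fun n => by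
        have : ((n : ℝ) ^ 2 * t) = (((n : ℝ≥0) ^ 2 * t : ℝ≥0) : ℝ) := by push_cast; rfl
        rw [this, Real.toNNReal_coe]
      simp only [htime] at key
      have hS : Tendsto (fun n : ℕ => 1 / (n : ℝ) * ∑ x ∈ Finset.Icc 1 n,
          (HarmonicChain.meanStretch (P n) (X n) ((n : ℝ≥0) ^ 2 * t) x - f ((x : ℝ) / n)) ^ 2)
          atTop (𝓝 0) := by
        refine squeeze_zero (fun n => by positivity) (fun n => ?_) key
        refine mul_le_mul_of_nonneg_left ?_ (by positivity)
        refine le_add_of_le_of_nonneg (Finset.sum_le_sum fun x hx => ?_) (by positivity)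
        rw [if_pos (Finset.mem_Icc.1 hx).2]
      have hM : Tendsto (fun n : ℕ => 1 / (n : ℝ) * ∑ x ∈ Finset.range (n + 1),
          HarmonicChain.meanMomentum (P n) (X n) ((n : ℝ≥0) ^ 2 * t) x ^ 2) atTop (𝓝 0) := by
        refine squeeze_zero (fun n => by positivity) (fun n => ?_) key
        refine mul_le_mul_of_nonneg_left ?_ (by positivity)
        exact le_add_of_nonneg_left (by positivity)
      constructor
      · have h1 := HarmonicChain.tendsto_sum_mul_profile hfc hφ hS
        simpa only [mul_comm (f _)] using h1
      · have h1 := ((HarmonicChain.tendsto_sum_mul_profile_sq hfc hφ hS).add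
          (HarmonicChain.tendsto_sum_mul_of_tendsto_nonneg hφ
            (fun n x hx => Nat.lt_succ_iff.1 (Finset.mem_range.1 hx)) (fun n x => sq_nonneg _)
            hM)).const_mul (1 / 2)
        rw [add_zero, ← intervalIntegral.integral_const_mul] at h1
        have e : ∀ u, 1 / 2 * (φ u * f u ^ 2) = φ u * (1 / 2 * f u ^ 2) := fun u => by ring
        simp only [e] at h1
        refine h1.congr fun n => ?_
        rw [← mul_add, mul_left_comm]
        congr 1
        -- The energy sum starts at site `0`, where the stretch is zero, so the stretch sum from `1`
        -- can be extended to it.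
        have hzero : HarmonicChain.meanStretch (P n) (X n) ((n : ℝ≥0) ^ 2 * t) 0 = 0 := by
          simp [HarmonicChain.meanStretch, HarmonicChain.stretch_zero]
        have e2 : ∑ x ∈ Finset.Icc 1 n, φ ((x : ℝ) / n) *
            HarmonicChain.meanStretch (P n) (X n) ((n : ℝ≥0) ^ 2 * t) x ^ 2 =
            ∑ x ∈ Finset.range (n + 1), φ ((x : ℝ) / n) *
            HarmonicChain.meanStretch (P n) (X n) ((n : ℝ≥0) ^ 2 * t) x ^ 2 := by
          rw [Finset.sum_range_succ', HarmonicChain.sum_Icc_one_eq (fun x => φ ((x : ℝ) / n) *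
            HarmonicChain.meanStretch (P n) (X n) ((n : ℝ≥0) ^ 2 * t) x ^ 2), hzero]
          ring
        rw [e2, ← Finset.sum_add_distrib, Finset.mul_sum]
        refine Finset.sum_congr rfl fun x _ => ?_
        rw [HarmonicChain.mechEnergy]
        ring
    · refine le_trans (le_of_eq ?_) (hK n hn)
      congr 1
      refine Finset.sum_congr rfl fun x hx => ?_
      rw [if_pos (Nat.lt_succ_iff.1 (Finset.mem_range.1 hx)), Real.toNNReal_zero]
    · refine hProfile.congr fun n => ?_
      congr 1
      refine Finset.sum_congr rfl fun x hx => ?_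
      obtain ⟨hx1, hx2⟩ := Finset.mem_Icc.1 hx
      rw [if_pos hx2, Real.toNNReal_zero, hρr]
      exact ⟨by positivity, div_le_one_of_le₀ (by exact_mod_cast hx2) (Nat.cast_nonneg n)⟩
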